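/- Let $N\ge 1$ and $0\le k\le N$. Let $\mathcal C^N$ be the set of quasi-concave functions on $\mathbb R^N$, i.e. of all $f\colon\mathbb R^N\to[0,\infty)$ such that for every $t>0$ the superlevel set $L_t(f)=\{x: f(x)\ge t\}$ is empty or a convex body (a non-empty compact convex set). A functional $\mu\colon\mathcal C^N\to\mathbb R$ is a valuation if $\mu(0)=0$ and $\mu(f)+\mu(g)=\mu(f\vee g)+\mu(f\wedge g)$ whenever $f,g,f\vee g\in\mathcal C^N$ (pointwise maximum and minimum); it is continuous if $\mu(f_i)\to\mu(f)$ whenever $f_i,f\in\mathcal C^N$, $f_i\to f$ pointwise and $(f_i)$ is pointwise increasing or pointwise decreasing; it is $k$-homogeneous if $\mu(f(\cdot/\lambda))=\lambda^k\mu(f)$ for all $f\in\mathcal C^N$ and $\lambda>0$. Let $\mathrm{Val}_k(\mathcal C^N)$ be the set of continuous, translation invariant, $k$-homogeneous valuations on $\mathcal C^N$. For $f\in\mathcal C^N$ put $u_k(t)=V_k(L_t(f))$, $t>0$, where $V_k$ is the $k$-th intrinsic volume and $V_k(\varnothing)=0$, and let $S_k(f;\cdot)$ be the Radon measure on $(0,\infty)$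 such that $-S_k(f;\cdot)$ is the distributional derivative of $u_k$. Let $\mathrm{Gr}(N,k)$ be the set of $k$-dimensional linear subspaces of $\mathbb R^N$. The Klain function of $\mu\in \mathrm{Val}_k(\mathcal C^N)$ is the function $\mathrm{Kl}_\mu\colon(0,\infty)\times\mathrm{Gr}(N,k)\to\mathbb R$ such that, for every $E\in\mathrm{Gr}(N,k)$, $\mathrm{Kl}_\mu(\cdot,E)$ is $S_k(f;\cdot)$-integrable and $$\mu(f)=\int_{(0,\infty)}\mathrm{Kl}_\mu(t,E)\,dS_k(f;t)\qquad\text{for all } f\in\mathcal C^N \text{ with } \mathrm{supp}(f)\subseteq E .$$ Theorem. Let $\mu\in\mathrm{Val}_k(\mathcal C^N)$ be also invariant under $\mathbf O(N)$, i.e. $\mu(f\circ R)=\mu(f)$ for all $f\in\mathcal C^N$ and $R\in\mathbf O(N)$. Then the Klain function of $\mu$ exists, is unique and depends only on $t$: there is a continuous function $\varphi\colon[0,\infty)\to\mathbb R$ with $\varphi(0)=0$ and, if $k\ge1$, with $\varphi=0$ on $[0,\delta]$ for some $\delta>0$, such that $\mathrm{Kl}_\mu(t,E)=\varphi(t)$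 for all $t>0$ and $E\in\mathrm{Gr}(N,k)$. Moreover, for every $f\in\mathcal C^N$, $\varphi$ is integrable with respect to $S_k(f;\cdot)$ and $$\mu(f)=\int_{(0,\infty)}\varphi(t)\,dS_k(f;t).$$ -/

import Mathlib

open Set Filter Topology MeasureTheory
open scoped ContDiff

noncomputable section

namespace QuasiConcaveVal

/-- The Euclidean space `ℝ^N`. -/
abbrev E (N : ℕ) : Type := EuclideanSpace ℝ (Fin N)

/-- The superlevel set `L_t(f) = {x | f(x) ≥ t}`. -/
def levelSet {N : ℕ} (f : E N → ℝ) (t : ℝ) : Set (E N) := {x | t ≤ f x}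

/-- A function is quasi-concave if it is non-negative and each of its superlevel sets at a positive
level is a convex body (compact and convex) or empty. -/
def IsQC {N : ℕ} (f : E N → ℝ) : Prop :=
  (∀ x, 0 ≤ f x) ∧ ∀ t : ℝ, 0 < t → IsCompact (levelSet f t) ∧ Convex ℝ (levelSet f t)

/-- The class `𝒞^N` of quasi-concave functions. -/
abbrev QC (N : ℕ) : Type := {f : E N → ℝ // IsQC f}

namespace QC

variable {N : ℕ}

instance : CoeFun (QC N) (fun _ => E N → ℝ) := ⟨Subtype.val⟩

theorem isQC_zero : IsQC (fun _ : E N => (0 : ℝ)) := by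
  refine ⟨fun _ => le_rfl, fun t ht => ?_⟩
  have h : levelSet (fun _ : E N => (0 : ℝ)) t = ∅ := by
    ext x
    simp [levelSet, ht]
  rw [h]
  exact ⟨isCompact_empty, convex_empty⟩

/-- The identically zero function. -/
def zero (N : ℕ) : QC N := ⟨fun _ => 0, isQC_zero⟩

theorem isQC_inf {f g : E N → ℝ} (hf : IsQC f) (hg : IsQC g) :
    IsQC (fun x => min (f x) (g x)) := by
  refine ⟨fun x => le_min (hf.1 x) (hg.1 x), fun t ht => ?_⟩
  have h : levelSet (fun x => min (f x) (g x)) t = levelSet f t ∩ levelSet g t := by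
    ext x
    simp [levelSet]
  rw [h]
  exact ⟨(hf.2 t ht).1.inter (hg.2 t ht).1, (hf.2 t ht).2.inter (hg.2 t ht).2⟩

/-- The pointwise minimum `f ∧ g`. -/
def inf (f g : QC N) : QC N := ⟨fun x => min (f x) (g x), isQC_inf f.2 g.2⟩

theorem isQC_comp {f : E N → ℝ} (hf : IsQC f) (T : E N ≃ₜ E N) (A : E N →ᵃ[ℝ] E N)
    (hA : ∀ x, A x = T x) : IsQC (fun x => f (T x)) := by
  refine ⟨fun x => hf.1 _, fun t ht => ⟨?_, ?_⟩⟩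
  · exact T.isCompact_preimage.2 (hf.2 t ht).1
  · have h : levelSet (fun x => f (T x)) t = A ⁻¹' levelSet f t := by
      ext x
      simp [levelSet, hA]
    rw [h]
    exact (hf.2 t ht).2.affine_preimage A

/-- The translate `x ↦ f (x + v)`. -/
def translate (v : E N) (f : QC N) : QC N :=
  ⟨fun x => f (x + v), isQC_comp f.2 (Homeomorph.addRight v)
    (AffineMap.id ℝ (E N) + AffineMap.const ℝ (E N) v) (fun _ => rfl)⟩

/-- The rotated function `x ↦ f (R x)`, for a linear isometry `R` of `ℝ^N`. -/
def rotate (R : E N ≃ₗᵢ[ℝ] E N) (f : QC N) : QC N :=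
  ⟨fun x => f (R x), isQC_comp f.2 R.toHomeomorph R.toLinearEquiv.toLinearMap.toAffineMap
    (fun _ => rfl)⟩

/-- The dilated function `x ↦ f (x / l)`, for `l > 0`. -/
def dilate (l : ℝ) (hl : 0 < l) (f : QC N) : QC N :=
  ⟨fun x => f (l⁻¹ • x), isQC_comp f.2 (Homeomorph.smulOfNeZero l⁻¹ (inv_ne_zero hl.ne'))
    (l⁻¹ • (LinearMap.id : E N →ₗ[ℝ] E N)).toAffineMap (fun _ => rfl)⟩

end QC

/-- `μ` is a valuation on `𝒞^N`: it vanishes at the zero function, and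
`μ(f) + μ(g) = μ(f ∨ g) + μ(f ∧ g)` whenever `f ∨ g` belongs to `𝒞^N`. -/
def IsValuation {N : ℕ} (μ : QC N → ℝ) : Prop :=
  μ (QC.zero N) = 0 ∧
    ∀ (f g : QC N) (h : IsQC (fun x => max (f x) (g x))),
      μ f + μ g = μ ⟨fun x => max (f x) (g x), h⟩ + μ (QC.inf f g)

/-- Continuity along monotone (increasing or decreasing) sequences that converge pointwise. -/
def IsContinuousVal {N : ℕ} (μ : QC N → ℝ) : Prop :=
  ∀ (F : ℕ → QC N) (f : QC N), (∀ x, Tendsto (fun i => F i x) atTop (𝓝 (f x))) →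
    ((∀ x, Monotone (fun i => F i x)) ∨ (∀ x, Antitone (fun i => F i x))) →
    Tendsto (fun i => μ (F i)) atTop (𝓝 (μ f))

/-- Invariance under translations. -/
def IsTranslationInvariant {N : ℕ} (μ : QC N → ℝ) : Prop :=
  ∀ (v : E N) (f : QC N), μ (f.translate v) = μ f

/-- Invariance under the group `O(N)`. -/
def IsRotationInvariant {N : ℕ} (μ : QC N → ℝ) : Prop :=
  ∀ (R : E N ≃ₗᵢ[ℝ] E N) (f : QC N), μ (f.rotate R) = μ f

/-- Homogeneity of degree `k`. -/
def IsHomogeneous {N : ℕ} (k : ℕ) (μ : QC N → ℝ) : Prop :=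
  ∀ (l : ℝ) (hl : 0 < l) (f : QC N), μ (f.dilate l hl) = l ^ k * μ f

/-- `μ ∈ Val_k(𝒞^N)`: a continuous, translation invariant and `k`-homogeneous valuation. -/
structure IsVal {N : ℕ} (k : ℕ) (μ : QC N → ℝ) : Prop where
  valuation : IsValuation μ
  continuous : IsContinuousVal μ
  translation : IsTranslationInvariant μ
  homogeneous : IsHomogeneous k μ

instance compactSpace_orthogonalGroup (N : ℕ) :
    CompactSpace (Matrix.orthogonalGroup (Fin N) ℝ) := by
  have hc : IsClosed ((Matrix.orthogonalGroup (Fin N) ℝ : Set (Matrix (Fin N) (Fin N) ℝ))) :=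
    isClosed_unitary
  have hK : IsCompact (Set.pi Set.univ fun _ : Fin N => Set.pi Set.univ fun _ : Fin N =>
      Set.Icc (-1 : ℝ) 1) :=
    isCompact_univ_pi fun _ => isCompact_univ_pi fun _ => isCompact_Icc
  refine isCompact_iff_compactSpace.1 (hK.of_isClosed_subset hc ?_)
  intro g hg i _ j _
  have h := entry_norm_bound_of_unitary hg i j
  rw [Real.norm_eq_abs] at h
  exact abs_le.1 h

instance measurableSpace_orthogonalGroup (N : ℕ) :
    MeasurableSpace (Matrix.orthogonalGroup (Fin N) ℝ) := borel _

instance borelSpace_orthogonalGroup (N : ℕ) :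
    BorelSpace (Matrix.orthogonalGroup (Fin N) ℝ) := ⟨rfl⟩

/-- The Haar probability measure on `O(N)`. -/
def haarO (N : ℕ) : Measure (Matrix.orthogonalGroup (Fin N) ℝ) :=
  Measure.haarMeasure ⊤

/-- The volume `κ_n` of the unit ball of `ℝ^n`. -/
def kappa (n : ℕ) : ℝ := (volume (Metric.ball (0 : E n) 1)).toReal

/-- The coordinates, in the orthonormal basis `g e_1, …, g e_k`, of the orthogonal projection of `x`
onto the span of `g e_1, …, g e_k`. -/
def proj {N k : ℕ} (hk : k ≤ N) (g : Matrix.orthogonalGroup (Fin N) ℝ) (x : E N) : E k :=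
  WithLp.toLp 2 fun i => ∑ j, g.1 j (Fin.castLE hk i) * x j

/-- The `k`-th intrinsic volume `V_k(K)` of a convex body (with `V_k(∅) = 0`): the mean
`k`-dimensional volume of the orthogonal projections of `K` onto `k`-dimensional subspaces, times
`binom(N, k) κ_N / (κ_k κ_{N-k})`. -/
def intrinsicVolume {N k : ℕ} (hk : k ≤ N) (K : Set (E N)) : ℝ :=
  (N.choose k : ℝ) * kappa N / (kappa k * kappa (N - k)) *
    (∫⁻ g, volume (proj hk g '' K) ∂(haarO N)).toReal

/-- `S` is the Radon measure on `(0, ∞)` (viewed as a Borel measure on `ℝ` without mass outside of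
`(0, ∞)`) such that `-S` is the distributional derivative of `u_k(t) = V_k(L_t(f))`. -/
structure IsLevelMeasure {N k : ℕ} (hk : k ≤ N) (f : QC N) (S : Measure ℝ) : Prop where
  null : S (Iic 0) = 0
  finite : ∀ K : Set ℝ, IsCompact K → K ⊆ Ioi 0 → S K < ⊤
  deriv_eq : ∀ ψ : ℝ → ℝ, ContDiff ℝ ∞ ψ → HasCompactSupport ψ → tsupport ψ ⊆ Ioi 0 →
    ∫ t in Ioi (0 : ℝ), deriv ψ t * intrinsicVolume hk (levelSet f t) = ∫ t in Ioi (0 : ℝ), ψ t ∂S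

/-- The measure `S_k(f; ·)`: the unique measure with the property `IsLevelMeasure`. -/
def levelMeasure {N k : ℕ} (hk : k ≤ N) (f : QC N) : Measure ℝ :=
  Classical.epsilon (IsLevelMeasure hk f)

/-- The Grassmannian of the `k`-dimensional linear subspaces of `ℝ^N`. -/
abbrev Gr (N k : ℕ) : Type := {F : Submodule ℝ (E N) // Module.finrank ℝ F = k}

/-- `Kl : (0, ∞) × Gr(N, k) → ℝ` is the Klain function of `μ`: for every `F ∈ Gr(N, k)`,
`μ(f) = ∫_{(0, ∞)} Kl(t, F) dS_k(f; t)` for all `f ∈ 𝒞^N` whose support is contained in `F`.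
Only the values of `Kl` at `t > 0` matter. -/
def IsKlainFunction {N k : ℕ} (hk : k ≤ N) (μ : QC N → ℝ) (Kl : ℝ → Gr N k → ℝ) : Prop :=
  ∀ (F : Gr N k) (f : QC N), tsupport (f : E N → ℝ) ⊆ (F.1 : Set (E N)) →
    IntegrableOn (fun t => Kl t F) (Ioi 0) (levelMeasure hk f) ∧
      μ f = ∫ t in Ioi (0 : ℝ), Kl t F ∂(levelMeasure hk f)

end QuasiConcaveVal

end

/-! For a fixed height `t`, the map K ↦ μ(t·1_K) is a valuation on convex bodies: invariant under
rigid motions, homogeneous of degree k, continuous along decreasing sequences. It must be a multiple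
φ(t)·V_k(K) (`IsVal.step_eq`), because its difference with the multiple of V_k that agrees on one
k-dimensional unit cube vanishes on all such cubes, and a k-homogeneous valuation of this kind is
zero (`IsBodyVal.eq_zero_of_homogeneous`).

The last claim is a form of Hadwiger's theorem. By induction on the dimension of the span it reduces
to the volume theorem `IsBodyVal.eq_zero_of_cubes`: ν vanishing on bodies in hyperplanes and on unit
cubes is zero. Every body arises by cuts and decreasing limits from orthoschemes
(`IsSimple.eq_zero_of_orthoschemes`). The double of an orthoscheme is cut into two translates of it
and products of lower-dimensional bodies. Products contribute nothing, by induction on the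
dimension, so ν(2K) = 2ν(K) (`IsSimple.two_smul`). This makes ν Minkowski additive
(`IsBodyVal.add`), so ν is unchanged when K is replaced by a Minkowski mean of its rotated copies.
In the limit the mean is a ball, and comparison with a cube of the same mean width gives ν(K) = 0.
Since continuity is known only along decreasing sequences of bodies, all approximations of bodies
are made from outside.

For functions, the valuation property evaluates μ on a staircase max_j t_j·1_{K_j} as a telescoping
sum, which is the integral of φ against S_k. Rounding f down to multiples of 2^{-m} gives staircases
that increase to f (`exists_dyadic_approx`), and dominated convergence finishes
(`IsVal.integral_density`). The domination comes from the behaviour of φ near 0: for k ≥ 1 it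
vanishes there, since otherwise an infinite staircase in the class would have a divergent value
(`density_eventually_zero`); for k = 0 the measure is finite. Testing on t·1_Q with Q a unit cube in
E gives uniqueness of the Klain function. -/

open scoped Pointwise

/-! ### Cut-additive functionals: reduction from bodies to pyramids -/

namespace BodyValuation

variable {V : Type*} [NormedAddCommGroup V] [InnerProductSpace ℝ V]

/-- A convex body or the empty set. -/
structure IsBody (K : Set V) : Prop where
  compact : IsCompact K
  convex : Convex ℝ K

theorem isBody_empty : IsBody (∅ : Set V) := ⟨isCompact_empty, convex_empty⟩

theorem isBody_singleton (v : V) : IsBody ({v} : Set V) :=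
  ⟨isCompact_singleton, convex_singleton v⟩

theorem IsBody.inter_closed {K C : Set V} (hK : IsBody K) (hC : IsClosed C) (hC' : Convex ℝ C) :
    IsBody (K ∩ C) :=
  ⟨hK.compact.inter_right hC, hK.convex.inter hC'⟩

theorem IsBody.inter {K L : Set V} (hK : IsBody K) (hL : IsBody L) : IsBody (K ∩ L) :=
  hK.inter_closed hL.compact.isClosed hL.convex

theorem IsBody.add {K L : Set V} (hK : IsBody K) (hL : IsBody L) : IsBody (K + L) :=
  ⟨hK.compact.add hL.compact, hK.convex.add hL.convex⟩

theorem IsBody.smul {K : Set V} (hK : IsBody K) (a : ℝ) : IsBody (a • K) :=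
  ⟨hK.compact.smul a, hK.convex.smul a⟩

theorem IsBody.image {W : Type*} [NormedAddCommGroup W] [InnerProductSpace ℝ W] {K : Set V}
    (hK : IsBody K) (g : V →L[ℝ] W) : IsBody (g '' K) :=
  ⟨hK.compact.image g.continuous, hK.convex.linear_image g.toLinearMap⟩

theorem IsBody.iInter {K : ℕ → Set V} (hK : ∀ j, IsBody (K j)) : IsBody (⋂ j, K j) :=
  ⟨(hK 0).compact.of_isClosed_subset (isClosed_iInter fun j => (hK j).compact.isClosed)
    (iInter_subset K 0), convex_iInter fun j => (hK j).convex⟩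

theorem isClosed_le (f : V →L[ℝ] ℝ) (c : ℝ) : IsClosed {x | f x ≤ c} :=
  _root_.isClosed_le f.continuous continuous_const

theorem isClosed_ge (f : V →L[ℝ] ℝ) (c : ℝ) : IsClosed {x | c ≤ f x} :=
  _root_.isClosed_le continuous_const f.continuous

theorem convex_le (f : V →L[ℝ] ℝ) (c : ℝ) : Convex ℝ {x | f x ≤ c} :=
  convex_halfSpace_le f.toLinearMap.isLinear c

theorem convex_ge (f : V →L[ℝ] ℝ) (c : ℝ) : Convex ℝ {x | c ≤ f x} :=
  convex_halfSpace_ge f.toLinearMap.isLinear c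

theorem IsBody.inter_le {K : Set V} (hK : IsBody K) (f : V →L[ℝ] ℝ) (c : ℝ) :
    IsBody (K ∩ {x | f x ≤ c}) := hK.inter_closed (isClosed_le f c) (convex_le f c)

theorem IsBody.inter_ge {K : Set V} (hK : IsBody K) (f : V →L[ℝ] ℝ) (c : ℝ) :
    IsBody (K ∩ {x | c ≤ f x}) := hK.inter_closed (isClosed_ge f c) (convex_ge f c)

/-- Continuity along decreasing sequences of bodies. -/
def AntitoneContinuous (η : Set V → ℝ) : Prop :=
  ∀ K : ℕ → Set V, (∀ j, IsBody (K j)) → Antitone K →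
    Tendsto (fun j => η (K j)) atTop (𝓝 (η (⋂ j, K j)))

/-- Functionals on bodies that are additive under hyperplane cuts and continuous along decreasing
sequences. -/
structure IsSimple (η : Set V → ℝ) : Prop where
  empty : η ∅ = 0
  cut : ∀ K, IsBody K → ∀ f : V →L[ℝ] ℝ, f ≠ 0 → ∀ c,
    η K = η (K ∩ {x | f x ≤ c}) + η (K ∩ {x | c ≤ f x})
  anti : AntitoneContinuous η

theorem IsSimple.eq_zero_of_subset {η : Set V → ℝ} (hη : IsSimple η) {K : Set V} (hK : IsBody K)
    {f : V →L[ℝ] ℝ} (hf : f ≠ 0) {c : ℝ} (h : ∀ x ∈ K, f x = c) : η K = 0 := by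
  have h1 : K ∩ {x | f x ≤ c} = K := inter_eq_left.2 fun x hx => (h x hx).le
  have h2 : K ∩ {x | c ≤ f x} = K := inter_eq_left.2 fun x hx => (h x hx).ge
  have := hη.cut K hK f hf c
  rw [h1, h2] at this
  linarith

/-- Closed convex cones with apex `0`. -/
structure IsCone (C : Set V) : Prop where
  closed : IsClosed C
  convex : Convex ℝ C
  smul : ∀ x ∈ C, ∀ a : ℝ, 0 ≤ a → a • x ∈ C

theorem IsCone.inter_le {C : Set V} (hC : IsCone C) (f : V →L[ℝ] ℝ) :
    IsCone (C ∩ {x | f x ≤ 0}) := by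
  refine ⟨hC.closed.inter (isClosed_le f 0), hC.convex.inter (convex_le f 0), ?_⟩
  rintro x ⟨hx, hfx⟩ a ha
  refine ⟨hC.smul x hx a ha, ?_⟩
  simp only [mem_ofPred_eq, map_smul, smul_eq_mul] at hfx ⊢
  exact mul_nonpos_of_nonneg_of_nonpos ha hfx

theorem IsCone.subset_zero {C : Set V} (hC : IsCone C) (hc : IsCompact C) : C ⊆ {0} := by
  intro x hx
  obtain ⟨R, hR⟩ := hc.isBounded.exists_norm_le
  by_contra hx0
  have hpos : 0 < ‖x‖ := norm_pos_iff.2 hx0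
  have hR0 : 0 ≤ R := (norm_nonneg x).trans (hR x hx)
  have := hR _ (hC.smul x hx ((R + 1) / ‖x‖) (by positivity))
  rw [norm_smul, Real.norm_of_nonneg (by positivity), div_mul_cancel₀ _ hpos.ne'] at this
  linarith

/-- The truncation of a set by the halfspaces `{l ≤ 1}`. -/
def trunc (I : List (V →L[ℝ] ℝ)) : Set V := {x | ∀ l ∈ I, l x ≤ 1}

theorem trunc_cons (l : V →L[ℝ] ℝ) (I : List (V →L[ℝ] ℝ)) :
    trunc (l :: I) = {x | l x ≤ 1} ∩ trunc I := by
  ext x; simp [trunc]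

theorem isClosed_trunc (I : List (V →L[ℝ] ℝ)) : IsClosed (trunc I) := by
  induction I with
  | nil => simp [trunc]
  | cons l I ih => rw [trunc_cons]; exact (isClosed_le l 1).inter ih

theorem convex_trunc (I : List (V →L[ℝ] ℝ)) : Convex ℝ (trunc I) := by
  induction I with
  | nil => simp [trunc, convex_univ]
  | cons l I ih => rw [trunc_cons]; exact (convex_le l 1).inter ih

theorem exists_functional_ne_zero [Nontrivial V] : ∃ f : V →L[ℝ] ℝ, f ≠ 0 := by
  obtain ⟨v, hv⟩ := exists_ne (0 : V)
  refine ⟨innerSL ℝ v, fun h => hv ?_⟩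
  have := congrArg (fun g : V →L[ℝ] ℝ => g v) h
  simpa using this

theorem IsSimple.eq_zero_of_subsingleton [Nontrivial V] {η : Set V → ℝ} (hη : IsSimple η)
    {v : V} {K : Set V} (h : K ⊆ {v}) : η K = 0 := by
  obtain ⟨f, hf⟩ := exists_functional_ne_zero (V := V)
  rcases subset_singleton_iff_eq.1 h with rfl | rfl
  · exact hη.empty
  · exact hη.eq_zero_of_subset (isBody_singleton v) hf (c := f v) (by simp)

theorem exists_isCompact_trunc [FiniteDimensional ℝ V] {R : ℝ} (hR : 0 < R) :
    ∃ I : List (V →L[ℝ] ℝ), IsCompact (trunc I) ∧ Metric.closedBall 0 R ⊆ trunc I := by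
  let b := stdOrthonormalBasis ℝ V
  let f : Fin (Module.finrank ℝ V) → V →L[ℝ] ℝ := fun i => R⁻¹ • innerSL ℝ (b i)
  let I : List (V →L[ℝ] ℝ) := List.ofFn f ++ List.ofFn (fun i => -f i)
  have hf : ∀ i x, f i x = R⁻¹ * inner ℝ (b i) x := by
    intro i x; simp [f]
  have hmem : ∀ x, x ∈ trunc I ↔ ∀ i, |f i x| ≤ 1 := by
    intro x
    simp only [trunc, I, List.mem_append, List.mem_ofFn, mem_ofPred_eq, abs_le]
    constructor
    · intro h i
      have h1 := h _ (Or.inl ⟨i, rfl⟩)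
      have h2 := h _ (Or.inr ⟨i, rfl⟩)
      simp only [neg_apply] at h2
      exact ⟨by linarith, h1⟩
    · rintro h l (⟨i, rfl⟩ | ⟨i, rfl⟩)
      · exact (h i).2
      · simp only [neg_apply]
        linarith [(h i).1]
  refine ⟨I, ?_, ?_⟩
  · refine Metric.isCompact_of_isClosed_isBounded (isClosed_trunc I) ?_
    refine (Metric.isBounded_iff_subset_closedBall 0).2
      ⟨∑ _i : Fin (Module.finrank ℝ V), R, fun x hx => ?_⟩
    rw [hmem] at hx
    rw [mem_closedBall_zero_iff, ← b.sum_repr' x]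
    refine (norm_sum_le _ _).trans (Finset.sum_le_sum fun i _ => ?_)
    rw [norm_smul, b.norm_eq_one, mul_one, Real.norm_eq_abs]
    have := hx i
    rwa [hf, abs_mul, abs_of_pos (inv_pos.2 hR), inv_mul_le_iff₀ hR, mul_one] at this
  · intro x hx
    rw [hmem]
    intro i
    rw [mem_closedBall_zero_iff] at hx
    rw [hf, abs_mul, abs_of_pos (inv_pos.2 hR), inv_mul_le_iff₀ hR, mul_one]
    refine (abs_real_inner_le_norm _ _).trans ?_
    rw [b.norm_eq_one, one_mul]
    exact hx

section Cones

variable [Nontrivial V] {η : Set V → ℝ}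

/-- A functional that vanishes on all pyramids with apex `0`. -/
def VanishesOnPyramids (η : Set V → ℝ) : Prop :=
  ∀ (C : Set V) (f : V →L[ℝ] ℝ), IsCone C → f ≠ 0 → IsCompact (C ∩ {x | f x ≤ 1}) →
    η (C ∩ {x | f x ≤ 1}) = 0

/-- Two truncations `l ≤ 1` and `l' ≤ 1` are separated by the cut along `l = l'`, a hyperplane
through the apex: on either side one truncation implies the other and the cone stays a cone.
Iterating leaves a single truncation, that is a pyramid. -/
theorem IsSimple.eq_zero_cone_inter_trunc (hη : IsSimple η) (h : VanishesOnPyramids η) (n : ℕ) :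
    ∀ I : List (V →L[ℝ] ℝ), I.length = n → ∀ C : Set V, IsCone C → IsCompact (C ∩ trunc I) →
      η (C ∩ trunc I) = 0 := by
  induction n with
  | zero =>
    intro I hI C hC hc
    obtain rfl := List.length_eq_zero_iff.1 hI
    have : trunc ([] : List (V →L[ℝ] ℝ)) = univ := by simp [trunc]
    rw [this, inter_univ] at hc ⊢
    exact hη.eq_zero_of_subsingleton (hC.subset_zero hc)
  | succ n ih =>
    intro I hI C hC hc
    match I, hI with
    | l :: I, hI =>
      have hI' : I.length = n := by simpa using hI
      by_cases hl : l = 0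
      · have : trunc (l :: I) = trunc I := by
          rw [trunc_cons, hl]; simp
        rw [this] at hc ⊢
        exact ih I hI' C hC hc
      match I, hI' with
      | [], _ =>
        have : trunc [l] = {x | l x ≤ 1} := by simp [trunc]
        rw [this] at hc ⊢
        exact h C l hC hl hc
      | l' :: I, hI' =>
        by_cases hll : l - l' = 0
        · obtain rfl := sub_eq_zero.1 hll
          have : trunc (l :: l :: I) = trunc (l :: I) := by
            ext x; simp [trunc]
          rw [this] at hc ⊢
          exact ih _ hI' C hC hc
        have hb : IsBody (C ∩ trunc (l :: l' :: I)) :=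
          ⟨hc, hC.convex.inter (convex_trunc _)⟩
        have e1 : C ∩ trunc (l :: l' :: I) ∩ {x | (l - l') x ≤ 0} =
            C ∩ {x | (l - l') x ≤ 0} ∩ trunc (l' :: I) := by
          ext x
          simp only [trunc, mem_inter_iff, mem_ofPred_eq, List.forall_mem_cons,
            sub_apply]
          constructor
          · rintro ⟨⟨a, b, c, d⟩, e⟩; exact ⟨⟨a, e⟩, c, d⟩
          · rintro ⟨⟨a, e⟩, c, d⟩; exact ⟨⟨a, by linarith, c, d⟩, e⟩
        have e2 : C ∩ trunc (l :: l' :: I) ∩ {x | 0 ≤ (l - l') x} =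
            C ∩ {x | (l' - l) x ≤ 0} ∩ trunc (l :: I) := by
          ext x
          simp only [trunc, mem_inter_iff, mem_ofPred_eq, List.forall_mem_cons,
            sub_apply]
          constructor
          · rintro ⟨⟨a, b, c, d⟩, e⟩; exact ⟨⟨a, by linarith⟩, b, d⟩
          · rintro ⟨⟨a, e⟩, c, d⟩; exact ⟨⟨a, c, by linarith, d⟩, by linarith⟩
        have c1 := (hb.inter_le (l - l') 0).compact
        have c2 := (hb.inter_ge (l - l') 0).compact
        rw [e1] at c1
        rw [e2] at c2
        rw [hη.cut _ hb (l - l') hll 0, e1, e2,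
          ih (l' :: I) hI' _ (hC.inter_le _) c1,
          ih (l :: I) (by simpa using hI') _ (hC.inter_le _) c2, add_zero]

/-- A halfspace `f ≤ b` is absorbed into the cone if `b = 0` and into the truncations, as `b⁻¹ • f ≤
1`, if `b > 0`. If `b < 0`, the opposite halfspace is of the second kind, and cut-additivity passes
to the complementary piece. -/
theorem IsSimple.eq_zero_polytope (hη : IsSimple η) (h : VanishesOnPyramids η)
    (P : List ((V →L[ℝ] ℝ) × ℝ)) :
    ∀ (I : List (V →L[ℝ] ℝ)) (C : Set V), IsCone C → IsCompact (C ∩ trunc I) →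
      η (C ∩ trunc I ∩ {x | ∀ p ∈ P, p.1 x ≤ p.2}) = 0 := by
  induction P with
  | nil =>
    intro I C hC hc
    simpa using hη.eq_zero_cone_inter_trunc h _ I rfl C hC hc
  | cons p P ih =>
    intro I C hC hc
    obtain ⟨f, b⟩ := p
    have key : ∀ (f : V →L[ℝ] ℝ) (b : ℝ), 0 ≤ b →
        η (C ∩ trunc I ∩ {x | ∀ p ∈ (f, b) :: P, p.1 x ≤ p.2}) = 0 := by
      intro f b hb
      rcases hb.eq_or_lt with rfl | hb
      · have e : C ∩ trunc I ∩ {x | ∀ p ∈ (f, 0) :: P, p.1 x ≤ p.2} =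
            (C ∩ {x | f x ≤ 0}) ∩ trunc I ∩ {x | ∀ p ∈ P, p.1 x ≤ p.2} := by
          ext x
          simp only [mem_inter_iff, mem_ofPred_eq, List.forall_mem_cons]
          tauto
        rw [e]
        refine ih I _ (hC.inter_le f) ?_
        have : C ∩ {x | f x ≤ 0} ∩ trunc I = C ∩ trunc I ∩ {x | f x ≤ 0} := by
          ext x; simp only [mem_inter_iff]; tauto
        rw [this]
        exact hc.inter_right (isClosed_le f 0)
      · have hfb : ∀ x, (b⁻¹ • f) x ≤ 1 ↔ f x ≤ b := by
          intro x
          rw [smul_apply, smul_eq_mul, inv_mul_le_iff₀ hb, mul_one]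
        have e : C ∩ trunc I ∩ {x | ∀ p ∈ (f, b) :: P, p.1 x ≤ p.2} =
            C ∩ trunc ((b⁻¹ • f) :: I) ∩ {x | ∀ p ∈ P, p.1 x ≤ p.2} := by
          ext x
          simp only [mem_inter_iff, mem_ofPred_eq, List.forall_mem_cons, trunc, hfb]
          tauto
        rw [e]
        refine ih _ _ hC ?_
        have : C ∩ trunc ((b⁻¹ • f) :: I) = C ∩ trunc I ∩ {x | f x ≤ b} := by
          ext x
          simp only [mem_inter_iff, mem_ofPred_eq, List.forall_mem_cons, trunc, hfb]
          tauto
        rw [this]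
        exact hc.inter_right (isClosed_le f b)
    rcases le_or_gt 0 b with hb | hb
    · exact key f b hb
    by_cases hf : f = 0
    · have e : C ∩ trunc I ∩ {x | ∀ p ∈ (f, b) :: P, p.1 x ≤ p.2} = ∅ := by
        ext x
        simp [hf, hb]
      rw [e, hη.empty]
    have hX : IsBody (C ∩ trunc I ∩ {x | ∀ p ∈ P, p.1 x ≤ p.2}) := by
      refine IsBody.inter_closed ⟨hc, hC.convex.inter (convex_trunc _)⟩ ?_ ?_
      · rw [show {x : V | ∀ p ∈ P, p.1 x ≤ p.2} = ⋂ p ∈ P, {x | p.1 x ≤ p.2} by ext; simp]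
        exact isClosed_iInter fun p => isClosed_iInter fun _ => isClosed_le _ _
      · rw [show {x : V | ∀ p ∈ P, p.1 x ≤ p.2} = ⋂ p ∈ P, {x | p.1 x ≤ p.2} by ext; simp]
        exact convex_iInter fun p => convex_iInter fun _ => convex_le _ _
    have hcut := hη.cut _ hX f hf b
    rw [ih I C hC hc] at hcut
    have e1 : C ∩ trunc I ∩ {x | ∀ p ∈ P, p.1 x ≤ p.2} ∩ {x | f x ≤ b} =
        C ∩ trunc I ∩ {x | ∀ p ∈ (f, b) :: P, p.1 x ≤ p.2} := by
      ext x
      simp only [mem_inter_iff, mem_ofPred_eq, List.forall_mem_cons]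
      tauto
    have e2 : C ∩ trunc I ∩ {x | ∀ p ∈ P, p.1 x ≤ p.2} ∩ {x | b ≤ f x} =
        C ∩ trunc I ∩ {x | ∀ p ∈ (-f, -b) :: P, p.1 x ≤ p.2} := by
      ext x
      simp only [mem_inter_iff, mem_ofPred_eq, List.forall_mem_cons, neg_apply,
        neg_le_neg_iff]
      tauto
    rw [e1, e2, key (-f) (-b) (by linarith), add_zero] at hcut
    exact hcut.symm

/-- A body is a countable intersection of halfspaces, hence a decreasing limit of polytopes; the box
`trunc I` keeps these compact, and they are polytopes in the cone `univ`. -/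
theorem IsSimple.eq_zero_of_vanishesOnPyramids [FiniteDimensional ℝ V] (hη : IsSimple η)
    (h : VanishesOnPyramids η) {K : Set V} (hK : IsBody K) : η K = 0 := by
  obtain ⟨R, hR0, hR⟩ : ∃ R : ℝ, 0 < R ∧ K ⊆ Metric.closedBall 0 R := by
    obtain ⟨R, hR⟩ := (Metric.isBounded_iff_subset_closedBall 0).1 hK.compact.isBounded
    exact ⟨max R 1, by positivity, hR.trans (Metric.closedBall_subset_closedBall (le_max_left _ _))⟩
  obtain ⟨I, hI, hRI⟩ := exists_isCompact_trunc (V := V) hR0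
  obtain ⟨l, c, hlc⟩ := RCLike.iInter_countable_halfSpaces_eq (𝕜 := ℝ) hK.convex hK.compact.isClosed
  let P : ℕ → List ((V →L[ℝ] ℝ) × ℝ) := fun j => (List.range j).map fun i => (l i, c i)
  let X : ℕ → Set V := fun j => univ ∩ trunc I ∩ {x | ∀ p ∈ P j, p.1 x ≤ p.2}
  have hXmem : ∀ j x, x ∈ X j ↔ x ∈ trunc I ∧ ∀ i < j, l i x ≤ c i := by
    intro j x
    simp [X, P]
  have hcone : IsCone (univ : Set V) := ⟨isClosed_univ, convex_univ, fun _ _ _ _ => mem_univ _⟩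
  have hX0 : ∀ j, η (X j) = 0 := fun j =>
    hη.eq_zero_polytope h (P j) I univ hcone (by simpa using hI)
  have hXb : ∀ j, IsBody (X j) := by
    intro j
    have : X j = trunc I ∩ ⋂ i, ⋂ (_ : i < j), {x | l i x ≤ c i} := by
      ext x; rw [hXmem]; simp
    rw [this]
    exact IsBody.inter_closed ⟨hI, convex_trunc I⟩
      (isClosed_iInter fun i => isClosed_iInter fun _ => isClosed_le _ _)
      (convex_iInter fun i => convex_iInter fun _ => convex_le _ _)
  have hXa : Antitone X := by
    intro i j hij x hx
    rw [hXmem] at hx ⊢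
    exact ⟨hx.1, fun m hm => hx.2 m (hm.trans_le hij)⟩
  have hXK : ⋂ j, X j = K := by
    ext x
    simp only [mem_iInter, hXmem]
    constructor
    · intro hx
      rw [← hlc]
      simp only [mem_iInter]
      intro i
      exact (hx (i + 1)).2 i (Nat.lt_succ_self i)
    · intro hx j
      refine ⟨hRI (hR hx), fun i _ => ?_⟩
      rw [← hlc] at hx
      simp only [mem_iInter] at hx
      exact hx i
  have ht := hη.anti X hXb hXa
  rw [hXK] at ht
  simp only [hX0] at ht
  exact tendsto_nhds_unique ht tendsto_const_nhds

end Cones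

end BodyValuation

/-! ### Pyramids over a base, and reduction to orthoschemes -/

namespace BodyValuation

variable {V : Type*} [NormedAddCommGroup V] [InnerProductSpace ℝ V]

/-- The pyramid with apex `0` over the base `z + Q`. -/
def pyramid {W : Submodule ℝ V} (z : V) (Q : Set W) : Set V :=
  {x | ∃ s ∈ Icc (0 : ℝ) 1, ∃ q ∈ Q, x = s • (z + q)}

section Pyramid

variable {W : Submodule ℝ V} {z : V}

theorem pyramid_empty : pyramid z (∅ : Set W) = ∅ := by
  ext x; simp [pyramid]

theorem pyramid_mono {Q R : Set W} (h : Q ⊆ R) : pyramid z Q ⊆ pyramid z R := by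
  rintro x ⟨s, hs, q, hq, rfl⟩
  exact ⟨s, hs, q, h hq, rfl⟩

theorem zero_mem_pyramid {Q : Set W} (hQ : Q.Nonempty) : (0 : V) ∈ pyramid z Q := by
  obtain ⟨q, hq⟩ := hQ
  exact ⟨0, by simp, q, hq, by simp⟩

theorem isBody_pyramid {Q : Set W} (hQ : IsBody Q) : IsBody (pyramid z Q) := by
  constructor
  · have : pyramid z Q =
        (fun p : ℝ × W => p.1 • (z + (p.2 : V))) '' (Icc (0 : ℝ) 1 ×ˢ Q) := by
      ext x
      simp only [pyramid, mem_ofPred_eq, mem_image, mem_prod, Prod.exists]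
      constructor
      · rintro ⟨s, hs, q, hq, rfl⟩; exact ⟨s, q, ⟨hs, hq⟩, rfl⟩
      · rintro ⟨s, q, ⟨hs, hq⟩, rfl⟩; exact ⟨s, hs, q, hq, rfl⟩
    rw [this]
    exact (isCompact_Icc.prod hQ.compact).image (by fun_prop)
  · rintro x ⟨s, hs, q, hq, rfl⟩ y ⟨t, ht, r, hr, rfl⟩ a b ha hb hab
    have hs' : 0 ≤ a * s := mul_nonneg ha hs.1
    have ht' : 0 ≤ b * t := mul_nonneg hb ht.1
    rcases (add_nonneg hs' ht').eq_or_lt with h0 | h0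
    · have h1 : a * s = 0 := by linarith
      have h2 : b * t = 0 := by linarith
      refine ⟨0, by simp, q, hq, ?_⟩
      rw [smul_smul, smul_smul, h1, h2]; simp
    · refine ⟨a * s + b * t, ⟨h0.le, ?_⟩,
        ((a * s) / (a * s + b * t)) • q + ((b * t) / (a * s + b * t)) • r,
        hQ.convex hq hr (by positivity) (by positivity) (by field_simp), ?_⟩
      · calc a * s + b * t ≤ a * 1 + b * 1 := by gcongr <;> [exact hs.2; exact ht.2]
          _ = 1 := by linarith
      · push_cast
        have e1 : (a * s + b * t) * (a * s / (a * s + b * t)) = a * s := mul_div_cancel₀ _ h0.ne'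
        have e2 : (a * s + b * t) * (b * t / (a * s + b * t)) = b * t := mul_div_cancel₀ _ h0.ne'
        simp only [smul_add, smul_smul, e1, e2, add_smul]
        abel

theorem pyramid_apex_coord (hz : z ∈ Wᗮ) (hz0 : z ≠ 0) (s : ℝ) (q : W) :
    inner ℝ z (s • (z + (q : V))) / ‖z‖ ^ 2 = s := by
  have h : inner ℝ z (q : V) = (0 : ℝ) := by
    rw [real_inner_comm]; exact hz q q.2
  rw [inner_smul_right, inner_add_right, h, real_inner_self_eq_norm_sq, add_zero]
  have : ‖z‖ ≠ 0 := norm_ne_zero_iff.2 hz0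
  field_simp

/-- The functional takes the value `s * (f q - c)` at `s • (z + q)`, so a cut of the base extends to
a cut through the apex. The piece of the base has to be non-empty, because the apex always satisfies
the inequality but does not belong to the pyramid over the empty set. -/
theorem pyramid_inter [W.HasOrthogonalProjection] {Q : Set W} (hz : z ∈ Wᗮ) (hz0 : z ≠ 0) (f : W →L[ℝ] ℝ) (c : ℝ)
    (hne : (Q ∩ {q | f q ≤ c}).Nonempty) :
    pyramid z Q ∩ {x | (f ∘L W.orthogonalProjectionOnto - (c / ‖z‖ ^ 2) • innerSL ℝ z) x ≤ 0} =
      pyramid z (Q ∩ {q | f q ≤ c}) := by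
  have key : ∀ (s : ℝ) (q : W),
      (f ∘L W.orthogonalProjectionOnto - (c / ‖z‖ ^ 2) • innerSL ℝ z) (s • (z + (q : V))) =
        s * (f q - c) := by
    intro s q
    have h1 : W.orthogonalProjectionOnto (s • (z + (q : V))) = s • q := by
      rw [map_smul, map_add, W.orthogonalProjectionOnto_mem_subspace_eq_self,
        Submodule.orthogonalProjectionOnto_apply_of_mem_orthogonal hz, zero_add]
    rw [sub_apply, ContinuousLinearMap.comp_apply, h1, smul_apply, innerSL_apply_apply,
      map_smul, smul_eq_mul, smul_eq_mul]
    calc s * f q - c / ‖z‖ ^ 2 * inner ℝ z (s • (z + (q : V)))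
        = s * f q - c * (inner ℝ z (s • (z + (q : V))) / ‖z‖ ^ 2) := by ring
      _ = _ := by rw [pyramid_apex_coord hz hz0]; ring
  ext x
  constructor
  · rintro ⟨⟨s, hs, q, hq, rfl⟩, hx⟩
    rw [mem_ofPred_eq, key] at hx
    rcases hs.1.eq_or_lt with rfl | hs0
    · rw [zero_smul]; exact zero_mem_pyramid hne
    · refine ⟨s, hs, q, ⟨hq, ?_⟩, rfl⟩
      simp only [mem_ofPred_eq]
      by_contra hlt
      push Not at hlt
      have : 0 < s * (f q - c) := mul_pos hs0 (by linarith)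
      linarith
  · rintro ⟨s, hs, q, ⟨hq, hqc⟩, rfl⟩
    refine ⟨⟨s, hs, q, hq, rfl⟩, ?_⟩
    rw [mem_ofPred_eq, key]
    simp only [mem_ofPred_eq] at hqc
    exact mul_nonpos_of_nonneg_of_nonpos hs.1 (by linarith)

/-- A point other than the apex determines its height `s` and its base point `q`; for the apex,
compactness gives a point in all bases. -/
theorem iInter_pyramid (hz : z ∈ Wᗮ) (hz0 : z ≠ 0) {Q : ℕ → Set W} (hQ : ∀ j, IsBody (Q j))
    (hanti : Antitone Q) : ⋂ j, pyramid z (Q j) = pyramid z (⋂ j, Q j) := by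
  refine Subset.antisymm ?_ (subset_iInter fun j => pyramid_mono (iInter_subset Q j))
  intro x hx
  rw [mem_iInter] at hx
  choose s hs q hq hxs using hx
  have hss : ∀ j, s j = s 0 := by
    intro j
    rw [← pyramid_apex_coord hz hz0 (s j) (q j), ← hxs j, hxs 0, pyramid_apex_coord hz hz0]
  by_cases h0 : s 0 = 0
  · rw [hxs 0, h0, zero_smul]
    refine zero_mem_pyramid ?_
    exact IsCompact.nonempty_iInter_of_sequence_nonempty_isCompact_isClosed Q
      (fun i => hanti (Nat.le_succ i)) (fun i => ⟨q i, hq i⟩) (hQ 0).compact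
      (fun i => (hQ i).compact.isClosed)
  · have hqq : ∀ j, q j = q 0 := by
      intro j
      have := (hxs j).symm.trans (hxs 0)
      rw [hss j] at this
      exact Subtype.ext (add_left_cancel (smul_right_injective V h0 this))
    refine ⟨s 0, hs 0, q 0, ?_, hxs 0⟩
    rw [mem_iInter]
    intro j
    rw [← hqq j]
    exact hq j

/-- This lowers the dimension by one: vanishing on pyramids over `z + W` becomes a question about a
simple functional on `W`. -/
theorem isSimple_pyramid [W.HasOrthogonalProjection] {η : Set V → ℝ} (hη : IsSimple η) (hz : z ∈ Wᗮ) (hz0 : z ≠ 0) :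
    IsSimple (fun Q : Set W => η (pyramid z Q)) := by
  refine ⟨by rw [pyramid_empty]; exact hη.empty, ?_, ?_⟩
  · intro Q hQ f hf c
    by_cases h1 : (Q ∩ {q | f q ≤ c}).Nonempty
    · by_cases h2 : (Q ∩ {q | c ≤ f q}).Nonempty
      · have hne : f ∘L W.orthogonalProjectionOnto - (c / ‖z‖ ^ 2) • innerSL ℝ z ≠ 0 := by
          intro h
          refine hf (ContinuousLinearMap.ext fun q => ?_)
          have h3 := congrArg (fun g : V →L[ℝ] ℝ => g (q : V)) h
          have h4 : inner ℝ z (q : V) = (0 : ℝ) := by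
            rw [real_inner_comm]; exact hz q q.2
          simpa [h4] using h3
        have h2' : (Q ∩ {q | (-f) q ≤ -c}).Nonempty := by simpa using h2
        have e := pyramid_inter hz hz0 (-f) (-c) h2'
        have e' : {x | ((-f) ∘L W.orthogonalProjectionOnto - (-c / ‖z‖ ^ 2) • innerSL ℝ z) x ≤ 0} =
            {x : V | 0 ≤ (f ∘L W.orthogonalProjectionOnto - (c / ‖z‖ ^ 2) • innerSL ℝ z) x} := by
          ext x
          simp only [mem_ofPred_eq, sub_apply, ContinuousLinearMap.comp_apply, neg_apply,
            smul_apply, smul_eq_mul]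
          constructor <;> intro h <;> ring_nf at h ⊢ <;> linarith
        have e'' : {q | (-f) q ≤ -c} = {q : W | c ≤ f q} := by ext; simp
        rw [e', e''] at e
        rw [hη.cut _ (isBody_pyramid hQ) _ hne 0, pyramid_inter hz hz0 f c h1, e]
      · rw [not_nonempty_iff_eq_empty] at h2
        have : Q ∩ {q | f q ≤ c} = Q := by
          refine inter_eq_left.2 fun q hq => ?_
          by_contra hlt
          simp only [mem_ofPred_eq, not_le] at hlt
          have : q ∈ Q ∩ {q | c ≤ f q} := ⟨hq, hlt.le⟩
          rw [h2] at this
          exact this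
        rw [this, h2, pyramid_empty, hη.empty, add_zero]
    · rw [not_nonempty_iff_eq_empty] at h1
      have : Q ∩ {q | c ≤ f q} = Q := by
        refine inter_eq_left.2 fun q hq => ?_
        by_contra hlt
        simp only [mem_ofPred_eq, not_le] at hlt
        have : q ∈ Q ∩ {q | f q ≤ c} := ⟨hq, hlt.le⟩
        rw [h1] at this
        exact this
      rw [this, h1, pyramid_empty, hη.empty, zero_add]
  · intro Q hQ hanti
    have := hη.anti (fun j => pyramid z (Q j)) (fun j => isBody_pyramid (hQ j))
      (fun i j hij => pyramid_mono (hanti hij))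
    rwa [iInter_pyramid hz hz0 hQ hanti] at this

end Pyramid

/-- The parametrization of `V` by the coordinates with respect to the vectors `a i • e i`. -/
def scaledCoord {n : ℕ} (e : Fin n → V) (a : Fin n → ℝ) : (Fin n → ℝ) →L[ℝ] V :=
  ∑ i, (ContinuousLinearMap.proj i : (Fin n → ℝ) →L[ℝ] ℝ).smulRight (a i • e i)

theorem scaledCoord_apply {n : ℕ} (e : Fin n → V) (a : Fin n → ℝ) (t : Fin n → ℝ) :
    scaledCoord e a t = ∑ i, t i • a i • e i := by
  simp [scaledCoord]

/-- The chain simplex `{1 ≥ t_0 ≥ ⋯ ≥ t_{n-1} ≥ 0}`. -/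
def chainSimplex (n : ℕ) : Set (Fin n → ℝ) := {t | Antitone t ∧ ∀ i, t i ∈ Icc (0 : ℝ) 1}

/-- The height becomes the new largest coordinate: `s • (d • u + ∑ t i • …)` has coordinates `s ≥ s
* t 0 ≥ …`, so a pyramid over an orthoscheme is an orthoscheme. -/
theorem pyramid_image_chainSimplex {n : ℕ} {W : Submodule ℝ V} (u : V) (d : ℝ)
    (e : Fin n → W) (a : Fin n → ℝ) :
    pyramid (d • u) (scaledCoord e a '' chainSimplex n) =
      scaledCoord (Fin.cons u fun i => (e i : V)) (Fin.cons d a) '' chainSimplex (n + 1) := by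
  ext x
  constructor
  · rintro ⟨s, hs, _, ⟨t, ht, rfl⟩, rfl⟩
    refine ⟨Fin.cons s fun i => s * t i, ⟨?_, ?_⟩, ?_⟩
    · refine Fin.antitone_iff_succ_le.2 fun i => ?_
      cases n with
      | zero => exact i.elim0
      | succ n =>
        refine Fin.cases ?_ (fun i => ?_) i
        · simp only [Fin.succ_zero_eq_one, Fin.castSucc_zero, Fin.cons_zero]
          rw [show (1 : Fin (n + 2)) = Fin.succ 0 from rfl, Fin.cons_succ]
          exact mul_le_of_le_one_right hs.1 (ht.2 0).2
        · rw [Fin.cons_succ, ← Fin.succ_castSucc, Fin.cons_succ]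
          exact mul_le_mul_of_nonneg_left (ht.1 (Fin.castSucc_le_succ i)) hs.1
    · refine Fin.cases ?_ (fun i => ?_)
      · simpa using hs
      · rw [Fin.cons_succ]
        exact ⟨mul_nonneg hs.1 (ht.2 i).1, mul_le_one₀ hs.2 (ht.2 i).1 (ht.2 i).2⟩
    · rw [scaledCoord_apply, scaledCoord_apply, Fin.sum_univ_succ]
      simp only [Fin.cons_zero, Fin.cons_succ, Submodule.coe_sum, Submodule.coe_smul, smul_add,
        Finset.smul_sum, smul_smul, mul_assoc]
  · rintro ⟨t, ht, rfl⟩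
    by_cases h0 : t 0 = 0
    · have hz : t = 0 := by
        ext i
        exact le_antisymm ((ht.1 (Fin.zero_le i)).trans h0.le) (ht.2 i).1
      rw [hz, map_zero]
      refine zero_mem_pyramid ⟨0, 0, ⟨fun _ _ _ => le_rfl, fun i => by simp⟩, map_zero _⟩
    · have h0' : 0 < t 0 := lt_of_le_of_ne (ht.2 0).1 (Ne.symm h0)
      refine ⟨t 0, ht.2 0, _, ⟨fun i => t i.succ / t 0, ⟨fun i j hij => ?_, fun i => ⟨?_, ?_⟩⟩, rfl⟩,
        ?_⟩
      · exact div_le_div_of_nonneg_right (ht.1 (Fin.succ_le_succ_iff.2 hij)) h0'.le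
      · exact div_nonneg (ht.2 _).1 h0'.le
      · exact div_le_one_of_le₀ (ht.1 (Fin.zero_le _)) h0'.le
      · rw [scaledCoord_apply, scaledCoord_apply, Fin.sum_univ_succ]
        simp only [Fin.cons_zero, Fin.cons_succ, Submodule.coe_sum, Submodule.coe_smul, smul_add,
          Finset.smul_sum]
        congr 1
        refine Finset.sum_congr rfl fun i _ => ?_
        rw [smul_smul (t 0), mul_div_cancel₀ _ h0]

theorem orthonormal_cons {n : ℕ} {W : Submodule ℝ V} {u : V} (hu : ‖u‖ = 1) (huW : u ∈ Wᗮ)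
    {e : Fin n → W} (he : Orthonormal ℝ e) :
    Orthonormal ℝ (Fin.cons u fun i => (e i : V) : Fin (n + 1) → V) := by
  have h : ∀ i, inner ℝ u (e i : V) = (0 : ℝ) := fun i => by
    rw [real_inner_comm]; exact huW _ (e i).2
  constructor
  · refine Fin.cases (by simpa using hu) fun i => ?_
    rw [Fin.cons_succ]
    exact he.1 i
  · intro i j hij
    revert hij
    refine Fin.cases ?_ (fun i => ?_) i <;> refine Fin.cases ?_ (fun j => ?_) j <;> intro hij
    · exact absurd rfl hij
    · simpa using h j
    · rw [real_inner_comm]; simpa using h i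
    · rw [Fin.cons_succ, Fin.cons_succ]
      exact he.2 (fun h => hij (by rw [h]))

/-- A cut-additive functional that vanishes on all orthoschemes with apex `0` vanishes. -/
theorem IsSimple.eq_zero_of_orthoschemes (n : ℕ) :
    ∀ {V : Type*} [NormedAddCommGroup V] [InnerProductSpace ℝ V] [FiniteDimensional ℝ V]
      (_ : Module.finrank ℝ V = n) {η : Set V → ℝ} (_ : IsSimple η)
      (_ : ∀ (e : Fin n → V) (a : Fin n → ℝ), Orthonormal ℝ e → (∀ i, 0 < a i) →
        η (scaledCoord e a '' chainSimplex n) = 0) {K : Set V}, IsBody K → η K = 0 := by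
  induction n with
  | zero =>
    intro V _ _ _ hn η hη h K hK
    have hsub : Subsingleton V := Module.finrank_zero_iff.1 hn
    have h0 := h (fun i => i.elim0) (fun i => i.elim0) ⟨fun i => i.elim0, fun i => i.elim0⟩
      (fun i => i.elim0)
    have h1 : scaledCoord (fun i => i.elim0 : Fin 0 → V) (fun i => i.elim0) '' chainSimplex 0 =
        univ := by
      refine eq_univ_of_forall fun x => ⟨0, ⟨fun i => i.elim0, fun i => i.elim0⟩,
        Subsingleton.elim _ _⟩
    rcases K.eq_empty_or_nonempty with rfl | hne
    · exact hη.empty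
    · rw [Subsingleton.eq_univ_of_nonempty hne, ← h1]
      exact h0
  | succ n ih =>
    intro V _ _ _ hn η hη h K hK
    have : Nontrivial V := Module.nontrivial_of_finrank_pos (R := ℝ) (by omega)
    have : CompleteSpace V := FiniteDimensional.complete ℝ V
    refine hη.eq_zero_of_vanishesOnPyramids ?_ hK
    intro C f hC hf hc
    obtain ⟨w, rfl⟩ := (InnerProductSpace.toDual ℝ V).surjective f
    have hw : w ≠ 0 := by rintro rfl; exact hf (map_zero _)
    have hw' : ‖w‖ ≠ 0 := norm_ne_zero_iff.2 hw
    simp only [InnerProductSpace.toDual_apply_apply] at hc ⊢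
    -- The points of the cone with ⟨w, x⟩ ≤ 0 form a cone inside the compact truncation, hence only
    -- the apex.
    have hpos : ∀ x ∈ C, inner ℝ w x ≤ 0 → x = 0 := by
      intro x hx hwx
      have hcone : IsCone (C ∩ {x | innerSL ℝ w x ≤ 0}) := hC.inter_le _
      have hcomp : IsCompact (C ∩ {x | innerSL ℝ w x ≤ 0}) := by
        refine hc.of_isClosed_subset hcone.closed ?_
        rintro y ⟨hy, hy'⟩
        simp only [mem_ofPred_eq, innerSL_apply_apply] at hy'
        exact ⟨hy, hy'.trans zero_le_one⟩
      exact hcone.subset_zero hcomp ⟨hx, by simpa using hwx⟩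
    set u : V := ‖w‖⁻¹ • w with hu_def
    -- The base of the pyramid lies in the hyperplane ⟨w, x⟩ = 1, which has distance `‖w‖⁻¹` from
    -- the apex and foot point `d • u`.
    set d : ℝ := ‖w‖⁻¹ with hd_def
    have hu : ‖u‖ = 1 := norm_smul_inv_norm (𝕜 := ℝ) hw
    let W : Submodule ℝ V := (Submodule.span ℝ {u})ᗮ
    have hd0 : d ≠ 0 := inv_ne_zero hw'
    have huW : u ∈ Wᗮ := Submodule.le_orthogonal_orthogonal _ (Submodule.mem_span_singleton_self u)
    have hdu : inner ℝ w (d • u) = (1 : ℝ) := by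
      rw [hu_def, inner_smul_right, inner_smul_right, real_inner_self_eq_norm_sq, hd_def]
      field_simp
    have hwW : ∀ q : W, inner ℝ w (q : V) = (0 : ℝ) := by
      intro q
      have : inner ℝ u (q : V) = (0 : ℝ) := q.2 u (Submodule.mem_span_singleton_self u)
      rw [hu_def, inner_smul_left] at this
      simpa [hd0] using this
    have hd : 0 < d := inv_pos.2 (norm_pos_iff.2 hw)
    have hdu0 : d • u ≠ 0 := smul_ne_zero hd0 (by rintro h; simp [h] at hu)
    have hduW : d • u ∈ Wᗮ := Submodule.smul_mem _ _ huW
    set Q : Set W := {q | d • u + (q : V) ∈ C} with hQ_def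
    have hCQ : C ∩ {x | inner ℝ w x ≤ (1 : ℝ)} ⊆ {0} ∪ pyramid (d • u) Q := by
      rintro x ⟨hx, hx1⟩
      by_cases hx0 : inner ℝ w x ≤ (0 : ℝ)
      · exact Or.inl (hpos x hx hx0)
      · right
        push Not at hx0
        set s : ℝ := inner ℝ w x
        have hq : s⁻¹ • x - d • u ∈ W := by
          rw [Submodule.mem_orthogonal_singleton_iff_inner_right, inner_sub_right]
          have e1 : inner ℝ u (s⁻¹ • x) = d := by
            rw [hu_def, inner_smul_left, inner_smul_right]
            simp only [conj_trivial]
            rw [show inner ℝ w x = s from rfl, inv_mul_cancel₀ hx0.ne', mul_one]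
          rw [e1, inner_smul_right, real_inner_self_eq_norm_sq, hu]
          ring
        refine ⟨s, ⟨hx0.le, hx1⟩, ⟨s⁻¹ • x - d • u, hq⟩, ?_, ?_⟩
        · rw [hQ_def, mem_ofPred_eq, add_sub_cancel]
          exact hC.smul x hx _ (inv_nonneg.2 hx0.le)
        · rw [add_sub_cancel, smul_smul, mul_inv_cancel₀ hx0.ne', one_smul]
    rcases Q.eq_empty_or_nonempty with hQe | hQn
    · refine hη.eq_zero_of_subsingleton (v := 0) ?_
      rw [hQe, pyramid_empty, union_empty] at hCQ
      exact hCQ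
    have hCeq : C ∩ {x | inner ℝ w x ≤ (1 : ℝ)} = pyramid (d • u) Q := by
      refine Subset.antisymm (hCQ.trans ?_) ?_
      · rw [union_subset_iff]
        exact ⟨by simpa using zero_mem_pyramid hQn, Subset.rfl⟩
      · rintro x ⟨s, hs, q, hq, rfl⟩
        refine ⟨hC.smul _ hq s hs.1, ?_⟩
        rw [mem_ofPred_eq, inner_smul_right, inner_add_right, hdu, hwW]
        linarith [hs.2]
    have hQb : IsBody Q := by
      constructor
      · have hemb : IsClosedEmbedding (fun q : W => d • u + (q : V)) :=
          (Homeomorph.addLeft (d • u)).isClosedEmbedding.comp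
            (Submodule.closed_of_finiteDimensional W).isClosedEmbedding_subtypeVal
        have : Q = (fun q : W => d • u + (q : V)) ⁻¹' (C ∩ {x | inner ℝ w x ≤ (1 : ℝ)}) := by
          ext q
          simp only [hQ_def, mem_ofPred_eq, mem_preimage, mem_inter_iff, inner_add_right, hdu, hwW]
          simp
        rw [this]
        exact hemb.isCompact_preimage hc
      · intro q hq r hr a b ha hb hab
        have := hC.convex hq hr ha hb hab
        rw [hQ_def, mem_ofPred_eq]
        convert this using 1
        push_cast
        calc d • u + (a • (q : V) + b • (r : V)) = (a + b) • d • u + (a • (q : V) + b • (r : V)) := by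
              rw [hab, one_smul]
          _ = _ := by module
    rw [hCeq]
    have hfin : Module.finrank ℝ W = n := by
      have hF : Fact (Module.finrank ℝ V = n + 1) := ⟨hn⟩
      exact Submodule.finrank_orthogonal_span_singleton (by rintro h; simp [h] at hu)
    refine ih hfin (isSimple_pyramid hη hduW hdu0) ?_ hQb
    intro e a he ha
    rw [pyramid_image_chainSimplex]
    exact h _ _ (orthonormal_cons hu huW he) (Fin.cases hd ha)

end BodyValuation

/-! ### Doubling: dissection of twice an orthoscheme -/

namespace BodyValuation

variable {V : Type*} [NormedAddCommGroup V] [InnerProductSpace ℝ V]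

theorem IsSimple.const_mul {η : Set V → ℝ} (hη : IsSimple η) (r : ℝ) :
    IsSimple (fun K => r * η K) := by
  refine ⟨by simp [hη.empty], fun K hK f hf c => ?_, fun K hK hanti => ?_⟩
  · rw [hη.cut K hK f hf c]; ring
  · exact (hη.anti K hK hanti).const_mul r

theorem IsSimple.sub {η η' : Set V → ℝ} (hη : IsSimple η) (hη' : IsSimple η') :
    IsSimple (fun K => η K - η' K) := by
  refine ⟨by simp [hη.empty, hη'.empty], fun K hK f hf c => ?_, fun K hK hanti => ?_⟩
  · rw [hη.cut K hK f hf c, hη'.cut K hK f hf c]; ring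
  · exact (hη.anti K hK hanti).sub (hη'.anti K hK hanti)

theorem smul_inter_le {a : ℝ} (ha : 0 < a) (K : Set V) (f : V →L[ℝ] ℝ) (c : ℝ) :
    a • (K ∩ {x | f x ≤ c}) = a • K ∩ {x | f x ≤ a * c} := by
  rw [smul_set_inter₀ ha.ne']
  congr 1
  ext x
  rw [mem_smul_set_iff_inv_smul_mem₀ ha.ne', mem_ofPred_eq, mem_ofPred_eq, map_smul, smul_eq_mul,
    inv_mul_le_iff₀ ha]

theorem smul_inter_ge {a : ℝ} (ha : 0 < a) (K : Set V) (f : V →L[ℝ] ℝ) (c : ℝ) :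
    a • (K ∩ {x | c ≤ f x}) = a • K ∩ {x | a * c ≤ f x} := by
  rw [smul_set_inter₀ ha.ne']
  congr 1
  ext x
  rw [mem_smul_set_iff_inv_smul_mem₀ ha.ne', mem_ofPred_eq, mem_ofPred_eq, map_smul, smul_eq_mul,
    le_inv_mul_iff₀ ha]

theorem iInter_smul {a : ℝ} (ha : a ≠ 0) (K : ℕ → Set V) : ⋂ j, a • K j = a • ⋂ j, K j := by
  ext x
  simp only [mem_iInter, mem_smul_set_iff_inv_smul_mem₀ ha]

theorem IsSimple.smul {η : Set V → ℝ} (hη : IsSimple η) {a : ℝ} (ha : 0 < a) :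
    IsSimple (fun K => η (a • K)) := by
  refine ⟨by simp [hη.empty], fun K hK f hf c => ?_, fun K hK hanti => ?_⟩
  · rw [smul_inter_le ha, smul_inter_ge ha, ← hη.cut _ (hK.smul a) f hf]
  · have := hη.anti (fun j => a • K j) (fun j => (hK j).smul a)
      (fun i j hij => smul_set_mono (hanti hij))
    rwa [iInter_smul ha.ne'] at this

/-- The set of antitone vectors whose coordinates lie between prescribed bounds. -/
def chainBox {n : ℕ} (l u : Fin n → ℝ) : Set (Fin n → ℝ) := {t | Antitone t} ∩ Icc l u

theorem mem_chainBox {n : ℕ} {l u t : Fin n → ℝ} :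
    t ∈ chainBox l u ↔ Antitone t ∧ ∀ i, l i ≤ t i ∧ t i ≤ u i := by
  simp only [chainBox, mem_inter_iff, mem_ofPred_eq, mem_Icc, Pi.le_def, forall_and]

theorem isBody_image_chainBox {n : ℕ} (L : (Fin n → ℝ) →L[ℝ] V) (l u : Fin n → ℝ) :
    IsBody (L '' chainBox l u) := by
  constructor
  · refine IsCompact.image ?_ L.continuous
    refine isCompact_Icc.inter_left ?_
    simp only [Antitone, ofPred_forall]
    refine isClosed_iInter fun i => isClosed_iInter fun j => isClosed_iInter fun _ => ?_
    exact _root_.isClosed_le (continuous_apply _) (continuous_apply _)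
  · refine Convex.linear_image ?_ L.toLinearMap
    refine Convex.inter ?_ (convex_Icc _ _)
    intro s hs t ht a b ha hb _ i j hij
    simp only [Pi.add_apply, Pi.smul_apply, smul_eq_mul]
    exact add_le_add (mul_le_mul_of_nonneg_left (hs hij) ha)
      (mul_le_mul_of_nonneg_left (ht hij) hb)

theorem inner_scaledCoord {n : ℕ} {e : Fin n → V} (he : Orthonormal ℝ e) (a t : Fin n → ℝ)
    (i : Fin n) : inner ℝ (e i) (scaledCoord e a t) = t i * a i := by
  rw [scaledCoord_apply]
  simp only [smul_smul]
  exact he.inner_right_fintype _ i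

theorem image_inter_coord_le {n : ℕ} {e : Fin n → V} (he : Orthonormal ℝ e) {a : Fin n → ℝ}
    (ha : ∀ i, 0 < a i) (S : Set (Fin n → ℝ)) (i : Fin n) (c : ℝ) :
    scaledCoord e a '' S ∩ {x | ((a i)⁻¹ • innerSL ℝ (e i)) x ≤ c} =
      scaledCoord e a '' (S ∩ {t | t i ≤ c}) := by
  have h : ∀ t, ((a i)⁻¹ • innerSL ℝ (e i)) (scaledCoord e a t) = t i := by
    intro t
    rw [smul_apply, innerSL_apply_apply, inner_scaledCoord he, smul_eq_mul]
    field_simp [(ha i).ne']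
  have := image_inter_preimage (scaledCoord e a) S {x | ((a i)⁻¹ • innerSL ℝ (e i)) x ≤ c}
  rw [← this]
  congr 2
  ext t
  simp only [mem_preimage, mem_ofPred_eq, h]

theorem image_inter_coord_ge {n : ℕ} {e : Fin n → V} (he : Orthonormal ℝ e) {a : Fin n → ℝ}
    (ha : ∀ i, 0 < a i) (S : Set (Fin n → ℝ)) (i : Fin n) (c : ℝ) :
    scaledCoord e a '' S ∩ {x | c ≤ ((a i)⁻¹ • innerSL ℝ (e i)) x} =
      scaledCoord e a '' (S ∩ {t | c ≤ t i}) := by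
  have h : ∀ t, ((a i)⁻¹ • innerSL ℝ (e i)) (scaledCoord e a t) = t i := by
    intro t
    rw [smul_apply, innerSL_apply_apply, inner_scaledCoord he, smul_eq_mul]
    field_simp [(ha i).ne']
  have := image_inter_preimage (scaledCoord e a) S {x | c ≤ ((a i)⁻¹ • innerSL ℝ (e i)) x}
  rw [← this]
  congr 2
  ext t
  simp only [mem_preimage, mem_ofPred_eq, h]

/-- The part of the doubled chain simplex where the coordinates from the `i`-th on are at most `1`. -/
def slab (n i : ℕ) : Set (Fin n → ℝ) := chainBox 0 (fun j => if i ≤ j then 1 else 2)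

/-- The part of the doubled chain simplex where exactly the first `i` coordinates are at least
`1`. -/
def cell (n i : ℕ) : Set (Fin n → ℝ) :=
  chainBox (fun j => if (j : ℕ) < i then 1 else 0) (fun j => if (j : ℕ) < i then 2 else 1)

theorem isBody_image_slab {n : ℕ} (L : (Fin n → ℝ) →L[ℝ] V) (i : ℕ) : IsBody (L '' slab n i) :=
  isBody_image_chainBox L _ _

theorem slab_succ_inter_le {n : ℕ} (i : Fin n) : slab n (i + 1) ∩ {t | t i ≤ 1} = slab n i := by
  ext t
  simp only [slab, mem_inter_iff, mem_chainBox, mem_ofPred_eq, Pi.zero_apply]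
  constructor
  · rintro ⟨⟨h1, h2⟩, h3⟩
    refine ⟨h1, fun j => ⟨(h2 j).1, ?_⟩⟩
    split_ifs with hj
    · exact (h1 (Fin.le_def.2 hj)).trans h3
    · have := (h2 j).2
      rwa [if_neg (by omega)] at this
  · rintro ⟨h1, h2⟩
    refine ⟨⟨h1, fun j => ⟨(h2 j).1, ?_⟩⟩, by simpa using (h2 i).2⟩
    have := (h2 j).2
    split_ifs at this ⊢ <;> linarith

theorem slab_succ_inter_ge {n : ℕ} (i : Fin n) :
    slab n (i + 1) ∩ {t | 1 ≤ t i} = cell n (i + 1) := by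
  ext t
  simp only [slab, cell, mem_inter_iff, mem_chainBox, mem_ofPred_eq, Pi.zero_apply]
  constructor
  · rintro ⟨⟨h1, h2⟩, h3⟩
    refine ⟨h1, fun j => ?_⟩
    have := h2 j
    by_cases hj : (j : ℕ) < i + 1
    · rw [if_pos hj, if_pos hj]
      rw [if_neg (by omega)] at this
      exact ⟨h3.trans (h1 (Fin.le_def.2 (by omega))), this.2⟩
    · rw [if_neg hj, if_neg hj]
      rwa [if_pos (by omega)] at this
  · rintro ⟨h1, h2⟩
    refine ⟨⟨h1, fun j => ?_⟩, by simpa using (h2 i).1⟩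
    have := h2 j
    split_ifs at this ⊢ <;> first | omega | (constructor <;> linarith)

theorem slab_zero (n : ℕ) : slab n 0 = chainSimplex n := by
  ext t
  simp [slab, mem_chainBox, chainSimplex]

theorem slab_self (n : ℕ) : slab n n = (2 : ℝ) • chainSimplex n := by
  ext t
  rw [mem_smul_set_iff_inv_smul_mem₀ two_ne_zero]
  simp only [slab, mem_chainBox, chainSimplex, mem_ofPred_eq, Pi.zero_apply, Pi.smul_apply,
    smul_eq_mul, mem_Icc]
  refine and_congr ⟨fun h i j hij => ?_, fun h i j hij => ?_⟩ (forall_congr' fun i => ?_)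
  · exact mul_le_mul_of_nonneg_left (h hij) (by norm_num)
  · have := h hij
    simp only [Pi.smul_apply, smul_eq_mul] at this
    linarith
  · rw [if_neg (by omega)]
    constructor <;> rintro ⟨h1, h2⟩ <;> constructor <;> linarith

theorem cell_self (n : ℕ) : cell n n = {1} + chainSimplex n := by
  ext t
  rw [singleton_add, mem_image]
  simp only [cell, mem_chainBox, chainSimplex, mem_ofPred_eq, mem_Icc, Fin.is_lt, if_true]
  constructor
  · rintro ⟨h1, h2⟩
    refine ⟨t - 1, ⟨fun i j hij => ?_, fun i => ?_⟩, by abel⟩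
    · simpa using h1 hij
    · have := h2 i
      simp only [Pi.sub_apply, Pi.one_apply]
      constructor <;> linarith
  · rintro ⟨s, ⟨h1, h2⟩, rfl⟩
    refine ⟨fun i j hij => ?_, fun i => ?_⟩
    · simpa using h1 hij
    · have := h2 i
      simp only [Pi.add_apply, Pi.one_apply]
      constructor <;> linarith

/-- A cell is the sum of its projections to the first `i` and to the remaining coordinates. -/
theorem cell_eq_add (n i : ℕ) :
    cell n i = chainBox (fun j => if (j : ℕ) < i then 1 else 0) (fun j => if (j : ℕ) < i then 2 else 0)
      + ({-fun j : Fin n => if (j : ℕ) < i then 1 else 0} +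
        chainBox (fun j => if (j : ℕ) < i then 1 else 0) 1) := by
  ext t
  simp only [singleton_add, Set.mem_add, mem_image]
  constructor
  · intro ht
    rw [cell, mem_chainBox] at ht
    refine ⟨fun j => if (j : ℕ) < i then t j else 0, ?_, _,
      ⟨fun j => if (j : ℕ) < i then 1 else t j, ?_, rfl⟩, ?_⟩
    · refine mem_chainBox.2 ⟨fun j k hjk => ?_, fun j => ?_⟩
      · have h1 := ht.1 hjk
        have h2 := (ht.2 j).1
        have h3 : (j : ℕ) ≤ k := hjk
        simp only
        split_ifs at h2 ⊢ <;> first | omega | linarith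
      · have h2 := ht.2 j
        split_ifs at h2 ⊢ <;> constructor <;> linarith
    · refine mem_chainBox.2 ⟨fun j k hjk => ?_, fun j => ?_⟩
      · have h1 := ht.1 hjk
        have h2 := (ht.2 k).2
        have h3 : (j : ℕ) ≤ k := hjk
        simp only
        split_ifs at h2 ⊢ <;> first | omega | linarith
      · have h2 := ht.2 j
        simp only [Pi.one_apply]
        split_ifs at h2 ⊢ <;> constructor <;> linarith
    · ext j
      simp only [Pi.add_apply, Pi.neg_apply]
      split_ifs <;> ring
  · rintro ⟨s, hs, _, ⟨r, hr, rfl⟩, rfl⟩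
    rw [mem_chainBox] at hs hr
    refine mem_chainBox.2 ⟨fun j k hjk => ?_, fun j => ?_⟩
    · have h1 := hs.1 hjk
      have h2 := hr.1 hjk
      have h3 : (j : ℕ) ≤ k := hjk
      have h4 := hr.2 j
      have h5 := hr.2 k
      have h6 := hs.2 j
      have h7 := hs.2 k
      simp only [Pi.add_apply, Pi.neg_apply, Pi.one_apply] at *
      split_ifs at * <;> first | omega | linarith
    · have h4 := hr.2 j
      have h6 := hs.2 j
      simp only [Pi.add_apply, Pi.neg_apply, Pi.one_apply] at *
      split_ifs at * <;> constructor <;> linarith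

/-- Translation invariance on bodies. -/
def TranslationInvariant (η : Set V → ℝ) : Prop := ∀ (v : V) (K : Set V), IsBody K →
  η ({v} + K) = η K

/-- A functional that vanishes on sums of bodies in orthogonal proper subspaces. -/
def VanishesOnProducts (η : Set V → ℝ) : Prop :=
  ∀ F : Submodule ℝ V, F ≠ ⊥ → F ≠ ⊤ → ∀ A B : Set V, IsBody A → IsBody B → A ⊆ F →
    B ⊆ (Fᗮ : Submodule ℝ V) → η (A + B) = 0

/-- When the first `i` coordinates are at least 1 and the others at most 1, the chain condition
between the two groups is automatic, so the cell is a product along the span of the first `i` basis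
vectors and its complement. -/
theorem VanishesOnProducts.cell_eq_zero {η : Set V → ℝ} (h : VanishesOnProducts η) {n : ℕ}
    {e : Fin n → V} (he : Orthonormal ℝ e) (a : Fin n → ℝ) {i : ℕ} (hi0 : 0 < i) (hin : i < n) :
    η (scaledCoord e a '' cell n i) = 0 := by
  let F : Submodule ℝ V := Submodule.span ℝ (e '' {j | (j : ℕ) < i})
  have hF : F ≠ ⊥ := by
    rw [Submodule.ne_bot_iff]
    exact ⟨e ⟨0, by omega⟩, Submodule.subset_span ⟨_, hi0, rfl⟩, he.ne_zero _⟩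
  have hperp : ∀ x : V, (∀ j : Fin n, (j : ℕ) < i → inner ℝ (e j) x = (0 : ℝ)) → x ∈ Fᗮ := by
    intro x hx
    rw [Submodule.mem_orthogonal]
    intro y hy
    induction hy using Submodule.span_induction with
    | mem y hy => obtain ⟨j, hj, rfl⟩ := hy; exact hx j hj
    | zero => simp
    | add y z _ _ hy hz => rw [inner_add_left, hy, hz, add_zero]
    | smul c y _ hy => rw [inner_smul_left, hy, mul_zero]
  have hF' : F ≠ ⊤ := by
    intro htop
    have h1 : e ⟨i, hin⟩ ∈ Fᗮ := by
      refine hperp _ fun j hj => he.2 ?_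
      rintro rfl
      exact lt_irrefl _ hj
    rw [htop, Submodule.top_orthogonal_eq_bot, Submodule.mem_bot] at h1
    exact he.ne_zero _ h1
  rw [cell_eq_add, image_add, image_add, image_singleton]
  refine h F hF hF' _ _ (isBody_image_chainBox _ _ _)
    ((isBody_singleton _).add (isBody_image_chainBox _ _ _)) ?_ ?_
  · rintro _ ⟨t, ht, rfl⟩
    rw [scaledCoord_apply]
    refine Submodule.sum_mem _ fun j _ => ?_
    by_cases hj : (j : ℕ) < i
    · exact Submodule.smul_mem _ _ (Submodule.smul_mem _ _ (Submodule.subset_span ⟨j, hj, rfl⟩))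
    · have := (mem_chainBox.1 ht).2 j
      rw [if_neg hj, if_neg hj] at this
      rw [le_antisymm this.2 this.1, zero_smul]
      exact Submodule.zero_mem _
  · rw [singleton_add]
    rintro _ ⟨_, ⟨t, ht, rfl⟩, rfl⟩
    refine hperp _ fun j hj => ?_
    change inner ℝ (e j) (scaledCoord e a _ + scaledCoord e a t) = 0
    rw [← map_add, inner_scaledCoord he]
    have := (mem_chainBox.1 ht).2 j
    rw [if_pos hj, Pi.one_apply] at this
    simp [hj, le_antisymm this.2 this.1]

/-- Cutting the slab of index `i + 1` at height 1 of coordinate `i` leaves the slab of index `i` and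
a cell, which is a proper product as long as `i + 1 < n`. -/
theorem IsSimple.image_slab {η : Set V → ℝ} (hη : IsSimple η) (hprod : VanishesOnProducts η) {n : ℕ}
    {e : Fin n → V} (he : Orthonormal ℝ e) {a : Fin n → ℝ} (ha : ∀ i, 0 < a i) {i : ℕ}
    (hi : i < n) : η (scaledCoord e a '' slab n i) = η (scaledCoord e a '' chainSimplex n) := by
  have hcut : ∀ i : Fin n, η (scaledCoord e a '' slab n (i + 1)) =
      η (scaledCoord e a '' slab n i) + η (scaledCoord e a '' cell n (i + 1)) := by
    intro i
    have hf : (a i)⁻¹ • innerSL ℝ (e i) ≠ 0 := by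
      refine smul_ne_zero (inv_ne_zero (ha i).ne') fun h => he.ne_zero i ?_
      have := congrArg (fun g : V →L[ℝ] ℝ => g (e i)) h
      simpa using this
    rw [hη.cut _ (isBody_image_slab _ _) _ hf 1, image_inter_coord_le he ha,
      image_inter_coord_ge he ha, slab_succ_inter_le, slab_succ_inter_ge]
  induction i with
  | zero => rw [slab_zero]
  | succ i ih =>
    have := hcut ⟨i, by omega⟩
    simp only at this
    rw [this, ih (by omega), hprod.cell_eq_zero he a (Nat.succ_pos i) hi, add_zero]

/-- The doubled simplex is the slab of index `n`. The cut in the last coordinate splits off the cell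
where all coordinates are at least 1, a translate of the simplex; the other part has the value of
the simplex by `IsSimple.image_slab`. -/
theorem IsSimple.two_smul_chainSimplex {η : Set V → ℝ} (hη : IsSimple η)
    (htr : TranslationInvariant η) (hprod : VanishesOnProducts η) {n : ℕ} (hn : 0 < n)
    {e : Fin n → V} (he : Orthonormal ℝ e) {a : Fin n → ℝ} (ha : ∀ i, 0 < a i) :
    η ((2 : ℝ) • scaledCoord e a '' chainSimplex n) = 2 * η (scaledCoord e a '' chainSimplex n) := by
  obtain ⟨m, rfl⟩ : ∃ m, n = m + 1 := ⟨n - 1, by omega⟩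
  have hf : (a (Fin.last m))⁻¹ • innerSL ℝ (e (Fin.last m)) ≠ 0 := by
    refine smul_ne_zero (inv_ne_zero (ha _).ne') fun h => he.ne_zero (Fin.last m) ?_
    have := congrArg (fun g : V →L[ℝ] ℝ => g (e (Fin.last m))) h
    simpa using this
  have hb : IsBody (scaledCoord e a '' chainSimplex (m + 1)) := by
    rw [← slab_zero]; exact isBody_image_slab _ _
  have h1 := slab_succ_inter_le (Fin.last m)
  have h2 := slab_succ_inter_ge (Fin.last m)
  simp only [Fin.val_last] at h1 h2
  have h3 : (2 : ℝ) • scaledCoord e a '' chainSimplex (m + 1) =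
      scaledCoord e a '' slab (m + 1) (m + 1) := by
    rw [slab_self, image_smul_set]
  rw [h3, hη.cut _ (isBody_image_slab _ _) _ hf 1, image_inter_coord_le he ha,
      image_inter_coord_ge he ha, h1, h2, cell_self, image_add, image_singleton, htr _ _ hb,
    hη.image_slab hprod he ha (Nat.lt_succ_self m)]
  ring

/-- Both sides are simple functionals of `K`, so agreement on orthoschemes is enough. -/
theorem IsSimple.two_smul [FiniteDimensional ℝ V] [Nontrivial V] {η : Set V → ℝ} (hη : IsSimple η)
    (htr : TranslationInvariant η) (hprod : VanishesOnProducts η) {K : Set V} (hK : IsBody K) :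
    η ((2 : ℝ) • K) = 2 * η K := by
  have h : IsSimple (fun K => η ((2 : ℝ) • K) - 2 * η K) := (hη.smul two_pos).sub (hη.const_mul 2)
  refine sub_eq_zero.1 (IsSimple.eq_zero_of_orthoschemes _ rfl h (fun e a he ha => ?_) hK)
  exact sub_eq_zero.2 (hη.two_smul_chainSimplex htr hprod Module.finrank_pos he ha)

end BodyValuation

/-! ### Minkowski additivity of valuations with ν(2K) = 2ν(K) -/

namespace BodyValuation

variable {V : Type*} [NormedAddCommGroup V] [InnerProductSpace ℝ V]

/-- Translation invariant valuations on bodies, continuous along decreasing sequences. -/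
structure IsBodyVal (ν : Set V → ℝ) : Prop where
  empty : ν ∅ = 0
  union : ∀ K L, IsBody K → IsBody L → Convex ℝ (K ∪ L) → ν (K ∪ L) + ν (K ∩ L) = ν K + ν L
  trans : TranslationInvariant ν
  anti : AntitoneContinuous ν

theorem inter_le_union_inter_ge (K : Set V) (f : V →L[ℝ] ℝ) (c : ℝ) :
    K ∩ {x | f x ≤ c} ∪ K ∩ {x | c ≤ f x} = K := by
  rw [← inter_union_distrib_left]
  exact inter_eq_left.2 fun x _ => le_total (f x) c

theorem inter_le_inter_inter_ge (K : Set V) (f : V →L[ℝ] ℝ) (c : ℝ) :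
    K ∩ {x | f x ≤ c} ∩ (K ∩ {x | c ≤ f x}) = K ∩ {x | f x = c} := by
  ext x
  simp only [mem_inter_iff, mem_ofPred_eq, le_antisymm_iff]
  tauto

theorem IsBody.inter_eq {K : Set V} (hK : IsBody K) (f : V →L[ℝ] ℝ) (c : ℝ) :
    IsBody (K ∩ {x | f x = c}) := by
  rw [← inter_le_inter_inter_ge]
  exact (hK.inter_le f c).inter (hK.inter_ge f c)

theorem IsBodyVal.cut {ν : Set V → ℝ} (hν : IsBodyVal ν) {K : Set V} (hK : IsBody K)
    (f : V →L[ℝ] ℝ) (c : ℝ) :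
    ν K + ν (K ∩ {x | f x = c}) = ν (K ∩ {x | f x ≤ c}) + ν (K ∩ {x | c ≤ f x}) := by
  have := hν.union _ _ (hK.inter_le f c) (hK.inter_ge f c)
    (by rw [inter_le_union_inter_ge]; exact hK.convex)
  rwa [inter_le_union_inter_ge, inter_le_inter_inter_ge] at this

theorem exists_convex_comb_eq {a b c : ℝ} (ha : a ≤ c) (hb : c ≤ b) :
    ∃ s t : ℝ, 0 ≤ s ∧ 0 ≤ t ∧ s + t = 1 ∧ s * a + t * b = c := by
  rcases ha.eq_or_lt with rfl | ha
  · exact ⟨1, 0, by norm_num, by norm_num, by norm_num, by ring⟩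
  · have h : 0 < b - a := by linarith
    refine ⟨(b - c) / (b - a), (c - a) / (b - a), div_nonneg (by linarith) h.le,
      div_nonneg (by linarith) h.le, ?_, ?_⟩
    · field_simp; ring
    · field_simp; ring

/-- If `a + l = b + m` with `a`, `b` on different sides, the convex combination of the two
representations whose first part meets the hyperplane still represents the same point. -/
theorem inter_le_add_inter_inter_ge_add {K L : Set V} (hK : Convex ℝ K) (hL : Convex ℝ L)
    (f : V →L[ℝ] ℝ) (c : ℝ) :
    (K ∩ {x | f x ≤ c} + L) ∩ (K ∩ {x | c ≤ f x} + L) = K ∩ {x | f x = c} + L := by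
  refine Subset.antisymm ?_ ?_
  · rintro x ⟨⟨a, ⟨ha, hac⟩, l, hl, rfl⟩, ⟨b, ⟨hb, hbc⟩, m, hm, hx⟩⟩
    obtain ⟨s, t, hs, ht, hst, hc⟩ := exists_convex_comb_eq hac hbc
    refine ⟨s • a + t • b, ⟨hK ha hb hs ht hst, ?_⟩, s • l + t • m, hL hl hm hs ht hst, ?_⟩
    · simpa using hc
    · simp only at hx ⊢
      calc s • a + t • b + (s • l + t • m) = s • (a + l) + t • (b + m) := by
            simp only [smul_add]; abel
        _ = (s + t) • (a + l) := by rw [hx, add_smul]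
        _ = a + l := by rw [hst, one_smul]
  · refine subset_inter (add_subset_add_right ?_) (add_subset_add_right ?_)
    · exact fun x hx => ⟨hx.1, hx.2.le⟩
    · exact fun x hx => ⟨hx.1, hx.2.ge⟩

/-- The sets `K j ∩ (x - L)` are compact, decreasing and non-empty; a common point is the required
summand. -/
theorem iInter_add {K : ℕ → Set V} {L : Set V} (hK : ∀ j, IsBody (K j)) (hanti : Antitone K)
    (hL : IsBody L) : ⋂ j, (K j + L) = (⋂ j, K j) + L := by
  refine Subset.antisymm ?_ (subset_iInter fun j => add_subset_add_right (iInter_subset K j))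
  intro x hx
  rw [mem_iInter] at hx
  have hcomp : IsCompact ((fun l => x - l) '' L) :=
    hL.compact.image (continuous_const.sub continuous_id)
  have hne : (⋂ j, K j ∩ (fun l => x - l) '' L).Nonempty := by
    refine IsCompact.nonempty_iInter_of_sequence_nonempty_isCompact_isClosed _
      (fun i => inter_subset_inter_left _ (hanti (Nat.le_succ i))) (fun i => ?_)
      ((hK 0).compact.inter hcomp) (fun i => ((hK i).compact.inter hcomp).isClosed)
    obtain ⟨k, hk, l, hl, rfl⟩ := hx i
    exact ⟨k, hk, l, hl, by simp⟩
  obtain ⟨y, hy⟩ := hne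
  rw [mem_iInter] at hy
  obtain ⟨l, hl, hly⟩ := (hy 0).2
  refine ⟨y, mem_iInter.2 fun j => (hy j).1, l, hl, ?_⟩
  rw [← hly]
  exact sub_add_cancel x l

theorem iInter_image {W : Type*} [NormedAddCommGroup W] [InnerProductSpace ℝ W]
    {g : W →L[ℝ] V} (hg : Function.Injective g) (K : ℕ → Set W) :
    ⋂ j, g '' K j = g '' ⋂ j, K j :=
  (hg.injOn.image_iInter_eq (s := K)).symm

theorem exists_functional_extension [FiniteDimensional ℝ V] (F : Submodule ℝ V) (f : F →L[ℝ] ℝ) :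
    ∃ g : V →L[ℝ] ℝ, ∀ x : F, g x = f x :=
  ⟨f ∘L F.orthogonalProjectionOnto, fun x => by simp⟩

theorem image_inter_ofPred {X Y : Type*} (g : X → Y) (A : Set X) (p : Y → Prop) (q : X → Prop)
    (h : ∀ x, p (g x) ↔ q x) : g '' (A ∩ {x | q x}) = g '' A ∩ {x | p x} := by
  rw [← image_inter_preimage]
  congr 2
  ext x
  exact (h x).symm

theorem IsBody.exists_subtype_image [FiniteDimensional ℝ V] {G : Submodule ℝ V} {A : Set V}
    (hA : IsBody A) (hAG : A ⊆ G) : ∃ A' : Set G, IsBody A' ∧ G.subtypeL '' A' = A := by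
  refine ⟨G.subtypeL ⁻¹' A, ⟨?_, hA.convex.linear_preimage G.subtype⟩, ?_⟩
  · exact (Submodule.closed_of_finiteDimensional G).isClosedEmbedding_subtypeVal.isCompact_preimage
      hA.compact
  · rw [image_preimage_eq_inter_range]
    exact inter_eq_left.2 fun x hx => ⟨⟨x, hAG hx⟩, rfl⟩

section Defect

open Classical in
/-- The deviation of a functional from additivity with respect to the summand `L`. -/
noncomputable def defect (ν : Set V → ℝ) (L K : Set V) : ℝ :=
  ν (K + L) - ν K - if K.Nonempty then ν L else 0

theorem defect_empty {ν : Set V → ℝ} (h : ν ∅ = 0) (L : Set V) : defect ν L ∅ = 0 := by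
  simp [defect, h]

theorem defect_of_nonempty (ν : Set V → ℝ) (L : Set V) {K : Set V} (hK : K.Nonempty) :
    defect ν L K = ν (K + L) - ν K - ν L := by
  rw [defect, if_pos hK]

variable {ν : Set V → ℝ}

theorem IsBodyVal.defect_trans (hν : IsBodyVal ν) {L : Set V} (hL : IsBody L) :
    TranslationInvariant (defect ν L) := by
  intro v K hK
  rcases K.eq_empty_or_nonempty with rfl | hne
  · simp
  · rw [defect_of_nonempty _ _ hne, defect_of_nonempty _ _ ((singleton_nonempty v).add hne),
      add_assoc, hν.trans v _ (hK.add hL), hν.trans v _ hK]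

theorem IsBodyVal.defect_anti (hν : IsBodyVal ν) {L : Set V} (hL : IsBody L) :
    AntitoneContinuous (defect ν L) := by
  intro K hK hanti
  by_cases hne : ∀ j, (K j).Nonempty
  · have hne' : (⋂ j, K j).Nonempty :=
      IsCompact.nonempty_iInter_of_sequence_nonempty_isCompact_isClosed _
        (fun i => hanti (Nat.le_succ i)) hne (hK 0).compact (fun i => (hK i).compact.isClosed)
    simp only [defect_of_nonempty _ _ (hne _), defect_of_nonempty _ _ hne']
    rw [← iInter_add hK hanti hL]
    refine ((hν.anti _ (fun j => (hK j).add hL) ?_).sub (hν.anti K hK hanti)).sub tendsto_const_nhds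
    exact fun i j hij => add_subset_add_right (hanti hij)
  · push Not at hne
    obtain ⟨j, hj⟩ := hne
    have h1 : ⋂ j, K j = ∅ := subset_empty_iff.1 ((iInter_subset K j).trans hj.subset)
    refine tendsto_const_nhds.congr' ?_
    filter_upwards [eventually_ge_atTop j] with i hi
    rw [h1, subset_empty_iff.1 ((hanti hi).trans hj.subset)]

/-- Adding `L` to the two pieces of `K` gives bodies with union `K + L` and intersection (section) +
`L`. Hence the defect obeys the inclusion-exclusion of ν, and only the defect of the section stands
in the way of additivity. -/
theorem IsBodyVal.defect_cut (hν : IsBodyVal ν) {K L : Set V} (hK : IsBody K) (hL : IsBody L)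
    (f : V →L[ℝ] ℝ) (c : ℝ) (h : (K ∩ {x | f x = c}).Nonempty → defect ν L (K ∩ {x | f x = c}) = 0) :
    defect ν L K = defect ν L (K ∩ {x | f x ≤ c}) + defect ν L (K ∩ {x | c ≤ f x}) := by
  rcases (K ∩ {x | f x ≤ c}).eq_empty_or_nonempty with h1 | h1
  · have h2 := inter_le_union_inter_ge K f c
    rw [h1, empty_union] at h2
    rw [h1, h2, defect_empty hν.empty, zero_add]
  rcases (K ∩ {x | c ≤ f x}).eq_empty_or_nonempty with h2 | h2
  · have h3 := inter_le_union_inter_ge K f c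
    rw [h2, union_empty] at h3
    rw [h2, h3, defect_empty hν.empty, add_zero]
  have h3 : (K ∩ {x | f x = c}).Nonempty := by
    obtain ⟨a, ha, hac⟩ := h1
    obtain ⟨b, hb, hbc⟩ := h2
    obtain ⟨s, t, hs, ht, hst, hc⟩ := exists_convex_comb_eq hac hbc
    exact ⟨s • a + t • b, hK.convex ha hb hs ht hst, by simpa using hc⟩
  have h4 := h h3
  rw [defect_of_nonempty _ _ h3] at h4
  rw [defect_of_nonempty _ _ h1, defect_of_nonempty _ _ h2,
    defect_of_nonempty _ _ (h1.mono inter_subset_left)]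
  have e1 := hν.cut hK f c
  have e2 := hν.union (K ∩ {x | f x ≤ c} + L) (K ∩ {x | c ≤ f x} + L) ((hK.inter_le f c).add hL)
    ((hK.inter_ge f c).add hL)
    (by rw [← union_add, inter_le_union_inter_ge]; exact (hK.add hL).convex)
  rw [← union_add, inter_le_union_inter_ge, inter_le_add_inter_inter_ge_add hK.convex hL.convex]
    at e2
  linarith

end Defect

theorem iInter_smul_eq_zero {L : Set V} (hL : IsBody L) (h0 : (0 : V) ∈ L) :
    ⋂ m : ℕ, ((2 : ℝ) ^ m)⁻¹ • L = {0} := by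
  refine Subset.antisymm ?_ ?_
  · intro x hx
    rw [mem_iInter] at hx
    obtain ⟨R, hR⟩ := hL.compact.isBounded.exists_norm_le
    have h1 : ∀ m : ℕ, ‖x‖ ≤ ((2 : ℝ) ^ m)⁻¹ * R := by
      intro m
      obtain ⟨l, hl, rfl⟩ := hx m
      simp only
      rw [norm_smul, Real.norm_of_nonneg (by positivity)]
      exact mul_le_mul_of_nonneg_left (hR l hl) (by positivity)
    have h2 : Tendsto (fun m : ℕ => ((2 : ℝ) ^ m)⁻¹ * R) atTop (𝓝 (0 * R)) := by
      refine Tendsto.mul_const R ?_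
      exact tendsto_inv_atTop_zero.comp (tendsto_pow_atTop_atTop_of_one_lt one_lt_two)
    rw [zero_mul] at h2
    have h3 := ge_of_tendsto' h2 h1
    exact norm_le_zero_iff.1 h3
  · rw [singleton_subset_iff, mem_iInter]
    intro m
    exact ⟨0, h0, by simp⟩

theorem IsBody.smul_subset_smul {L : Set V} (hL : IsBody L) (h0 : (0 : V) ∈ L) {a b : ℝ}
    (ha : 0 ≤ a) (hab : a ≤ b) : a • L ⊆ b • L := by
  rintro _ ⟨l, hl, rfl⟩
  rcases (ha.trans hab).eq_or_lt with hb | hb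
  · have : a = b := by linarith
    exact ⟨l, hl, by simp [this]⟩
  · refine ⟨(a / b) • l, hL.convex.smul_mem_of_zero_mem h0 hl ⟨by positivity, ?_⟩, ?_⟩
    · exact div_le_one_of_le₀ hab hb.le
    · simp only
      rw [smul_smul, mul_div_cancel₀ _ hb.ne']

/-- Scaling turns a large `K` into a small `L`: the defect equals 2^{-m} times that of `2^m • K`,
which is ν(K + 2^{-m}L) - ν(K) - 2^{-m}ν(L). This tends to 0, as `0 ∈ L` makes 2^{-m}L decrease to
{0}. -/
theorem IsBodyVal.defect_eq_zero_of_two_smul {ν : Set V → ℝ} (hν : IsBodyVal ν)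
    (h2 : ∀ K, IsBody K → ν ((2 : ℝ) • K) = 2 * ν K) {K L : Set V} (hK : IsBody K)
    (hne : K.Nonempty) (hL : IsBody L) (h0 : (0 : V) ∈ L)
    (hd : ∀ m : ℕ, defect ν L ((2 : ℝ) ^ m • K) = 2 ^ m * defect ν L K) : defect ν L K = 0 := by
  have hpow : ∀ (m : ℕ) (K : Set V), IsBody K → ν ((2 : ℝ) ^ m • K) = 2 ^ m * ν K := by
    intro m K hK
    induction m with
    | zero => simp
    | succ m ih => rw [pow_succ', ← smul_smul, h2 _ (hK.smul _), ih]; ring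
  have h1 : ∀ m : ℕ, defect ν L K = ν (((2 : ℝ) ^ m)⁻¹ • L + K) - ν K - ((2 : ℝ) ^ m)⁻¹ * ν L := by
    intro m
    have hm : (2 : ℝ) ^ m ≠ 0 := by positivity
    have e : (2 : ℝ) ^ m • K + L = (2 : ℝ) ^ m • (((2 : ℝ) ^ m)⁻¹ • L + K) := by
      rw [smul_add, smul_inv_smul₀ hm, add_comm]
    have := hd m
    rw [defect_of_nonempty _ _ (hne.smul_set), e, hpow m _ ((hL.smul _).add hK), hpow m _ hK] at this
    have h3 : defect ν L K = ((2 : ℝ) ^ m)⁻¹ * (2 ^ m * defect ν L K) := by field_simp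
    rw [h3, ← this]
    field_simp
  have ht : Tendsto (fun m : ℕ => ν (((2 : ℝ) ^ m)⁻¹ • L + K) - ν K - ((2 : ℝ) ^ m)⁻¹ * ν L) atTop
      (𝓝 (ν K - ν K - 0 * ν L)) := by
    have hinv : Tendsto (fun m : ℕ => ((2 : ℝ) ^ m)⁻¹) atTop (𝓝 0) :=
      tendsto_inv_atTop_zero.comp (tendsto_pow_atTop_atTop_of_one_lt one_lt_two)
    have hLm : Antitone fun m : ℕ => ((2 : ℝ) ^ m)⁻¹ • L := by
      intro i j hij
      refine hL.smul_subset_smul h0 (by positivity) ?_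
      exact inv_anti₀ (by positivity) (pow_le_pow_right₀ one_le_two hij)
    refine ((Tendsto.sub_const ?_ _)).sub (hinv.mul_const _)
    have := hν.anti (fun m : ℕ => ((2 : ℝ) ^ m)⁻¹ • L + K) (fun m => (hL.smul _).add hK)
      (fun i j hij => add_subset_add_right (hLm hij))
    rw [iInter_add (fun m => hL.smul _) hLm hK, iInter_smul_eq_zero hL h0, singleton_zero,
      zero_add] at this
    exact this
  simp only [← h1] at ht
  have := tendsto_nhds_unique ht tendsto_const_nhds
  rw [← this]; ring

/-- Induction on the dimension of a subspace containing `K`, for all `L` at once. Sections have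
smaller dimension, so the defect is simple on `F`; it also vanishes on products, so it doubles under
`K ↦ 2 • K`, and the preceding limit argument applies. -/
theorem IsBodyVal.defect_eq_zero_aux [FiniteDimensional ℝ V] {ν : Set V → ℝ} (hν : IsBodyVal ν)
    (h2 : ∀ K, IsBody K → ν ((2 : ℝ) • K) = 2 * ν K) (j : ℕ) :
    ∀ F : Submodule ℝ V, Module.finrank ℝ F = j → ∀ K L : Set V, IsBody K → K.Nonempty → K ⊆ F →
      IsBody L → L.Nonempty → defect ν L K = 0 := by
  induction j using Nat.strong_induction_on with
  | _ j ih =>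
  intro F hF
  have main : ∀ K L : Set V, IsBody K → K.Nonempty → K ⊆ F → IsBody L → (0 : V) ∈ L →
      defect ν L K = 0 := by
    intro K L hK hne hKF hL h0
    have hLne : L.Nonempty := ⟨0, h0⟩
    rcases Nat.eq_zero_or_pos j with rfl | hj
    · rw [Submodule.finrank_eq_zero] at hF
      have hK0 : K = {0} := by
        refine hne.subset_singleton_iff.1 ?_
        rw [hF] at hKF
        simpa using hKF
      have h3 := h2 {0} (isBody_singleton 0)
      rw [smul_set_singleton, smul_zero] at h3
      rw [defect_of_nonempty _ _ hne, hK0, singleton_zero, zero_add, ← singleton_zero]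
      linarith
    -- From here on the defect is treated as a functional on the bodies of `F`, to which the
    -- doubling theorem applies.
    have : Nontrivial F := Module.nontrivial_of_finrank_pos (R := ℝ) (by omega)
    have hinj : Function.Injective F.subtypeL := Subtype.val_injective
    have hsimple : IsSimple fun A : Set F => defect ν L (F.subtypeL '' A) := by
      refine ⟨by rw [image_empty, defect_empty hν.empty], fun A hA f hf c => ?_, fun A hA hanti => ?_⟩
      · obtain ⟨g, hg⟩ := exists_functional_extension F f
        rw [image_inter_ofPred F.subtypeL A (fun x => g x ≤ c) (fun x => f x ≤ c)
            (fun x => by rw [← hg]; rfl),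
          image_inter_ofPred F.subtypeL A (fun x => c ≤ g x) (fun x => c ≤ f x)
            (fun x => by rw [← hg]; rfl)]
        refine hν.defect_cut (hA.image _) hL g c fun hne' => ?_
        -- The section lies in an affine hyperplane of `F`; translating one of its points to 0 puts
        -- it into the kernel of `f`, a linear subspace to which the induction hypothesis applies.
        obtain ⟨a, ⟨a', ha', haa⟩, hac⟩ := id hne'
        have hb := (hA.image F.subtypeL).inter_eq g c
        rw [← hν.defect_trans hL (-a) _ hb]
        refine ih (Module.finrank ℝ (LinearMap.ker f.toLinearMap)) ?_
          ((LinearMap.ker f.toLinearMap).map F.subtype) ?_ _ L ((isBody_singleton _).add hb)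
          ((singleton_nonempty _).add hne') ?_ hL hLne
        · rw [← hF]
          refine Submodule.finrank_lt fun htop => hf ?_
          ext x
          have : x ∈ LinearMap.ker f.toLinearMap := by rw [htop]; trivial
          simpa using this
        · exact Submodule.finrank_map_subtype_eq F _
        · rw [singleton_add]
          rintro _ ⟨_, ⟨⟨x, hx, rfl⟩, hxc⟩, rfl⟩
          refine ⟨x - a', ?_, ?_⟩
          · simp only [mem_ofPred_eq] at hxc hac
            have h3 : g (F.subtypeL x) = f x := hg x
            have h4 : g (F.subtypeL a') = f a' := hg a'
            rw [← haa, h4] at hac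
            rw [h3] at hxc
            simp [hxc, hac]
          · rw [← haa]
            simp [sub_eq_neg_add]
      · have := hν.defect_anti hL (fun j => F.subtypeL '' A j) (fun j => (hA j).image _)
          (fun i j hij => image_mono (hanti hij))
        rwa [iInter_image hinj] at this
    have htr : TranslationInvariant fun A : Set F => defect ν L (F.subtypeL '' A) := by
      intro v A hA
      simp only
      rw [image_add, image_singleton]
      exact hν.defect_trans hL _ _ (hA.image _)
    have hprod : VanishesOnProducts fun A : Set F => defect ν L (F.subtypeL '' A) := by
      intro G hG hG' A B hA hB hAG hBG
      simp only
      rcases A.eq_empty_or_nonempty with rfl | hAne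
      · rw [empty_add, image_empty, defect_empty hν.empty]
      rcases B.eq_empty_or_nonempty with rfl | hBne
      · rw [add_empty, image_empty, defect_empty hν.empty]
      have hdim : ∀ (G : Submodule ℝ F) (A : Set F), G ≠ ⊤ → IsBody A → A.Nonempty → A ⊆ G →
          ∀ L, IsBody L → L.Nonempty → defect ν L (F.subtypeL '' A) = 0 := by
        intro G A hG hA hAne hAG L hL hLne
        refine ih (Module.finrank ℝ G) ?_ (G.map F.subtype) (Submodule.finrank_map_subtype_eq F _)
          _ L (hA.image _) (hAne.image _) ?_ hL hLne
        · rw [← hF]; exact Submodule.finrank_lt hG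
        · rintro _ ⟨x, hx, rfl⟩
          exact ⟨x, hAG hx, rfl⟩
      have hBtop : (Gᗮ : Submodule ℝ F) ≠ ⊤ := by
        rw [Ne, Submodule.orthogonal_eq_top_iff]; exact hG
      rw [image_add]
      have hA' := hA.image F.subtypeL
      have hB' := hB.image F.subtypeL
      have hAne' := hAne.image F.subtypeL
      have hBne' := hBne.image F.subtypeL
      -- The defects satisfy D_L(A + B) = D_{B+L}(A) - D_B(A) + D_L(B), and all three on the right
      -- concern bodies in proper subspaces.
      have e1 := hdim G A hG' hA hAne hAG _ (hB'.add hL) (hBne'.add hLne)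
      have e2 := hdim G A hG' hA hAne hAG _ hB' hBne'
      have e3 := hdim Gᗮ B hBtop hB hBne hBG L hL hLne
      rw [defect_of_nonempty _ _ hAne'] at e1 e2
      rw [defect_of_nonempty _ _ hBne'] at e3
      rw [defect_of_nonempty _ _ (hAne'.add hBne'), add_assoc]
      linarith
    refine hν.defect_eq_zero_of_two_smul h2 hK hne hL h0 fun m => ?_
    obtain ⟨A, hA, rfl⟩ := hK.exists_subtype_image hKF
    rw [← image_smul_set]
    induction m with
    | zero => simp
    | succ m ihm =>
      have := hsimple.two_smul htr hprod (hA.smul (2 ^ m))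
      rw [pow_succ', ← smul_smul, this, ihm]
      ring
  intro K L hK hne hKF hL hLne
  obtain ⟨l, hl⟩ := hLne
  have hL' : IsBody ({-l} + L) := (isBody_singleton _).add hL
  have h1 := main K ({-l} + L) hK hne hKF hL' ⟨-l, rfl, l, hl, by simp⟩
  rw [defect_of_nonempty _ _ hne] at h1 ⊢
  rw [add_left_comm, hν.trans _ _ (hK.add hL), hν.trans _ _ hL] at h1
  exact h1

/-- A translation invariant valuation that is homogeneous of degree one is Minkowski additive. -/
theorem IsBodyVal.add [FiniteDimensional ℝ V] {ν : Set V → ℝ} (hν : IsBodyVal ν)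
    (h2 : ∀ K, IsBody K → ν ((2 : ℝ) • K) = 2 * ν K) {K L : Set V} (hK : IsBody K)
    (hKne : K.Nonempty) (hL : IsBody L) (hLne : L.Nonempty) : ν (K + L) = ν K + ν L := by
  have := hν.defect_eq_zero_aux h2 _ ⊤ rfl K L hK hKne (fun _ _ => trivial) hL hLne
  rw [defect_of_nonempty _ _ hKne] at this
  linarith

end BodyValuation

/-! ### Homogeneity for real factors, and support functions -/

namespace BodyValuation

variable {V : Type*} [NormedAddCommGroup V] [InnerProductSpace ℝ V]

section Homogeneity

variable {ν : Set V → ℝ}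

theorem IsBodyVal.singleton (hν : IsBodyVal ν)
    (h2 : ∀ K, IsBody K → ν ((2 : ℝ) • K) = 2 * ν K) (v : V) : ν {v} = 0 := by
  have h3 := h2 {0} (isBody_singleton 0)
  rw [smul_set_singleton, smul_zero] at h3
  have h4 := hν.trans v {0} (isBody_singleton 0)
  rw [singleton_add_singleton, add_zero] at h4
  linarith

theorem IsBodyVal.smul_add_smul [FiniteDimensional ℝ V] (hν : IsBodyVal ν)
    (h2 : ∀ K, IsBody K → ν ((2 : ℝ) • K) = 2 * ν K) {K : Set V} (hK : IsBody K)
    (hne : K.Nonempty) {a b : ℝ} (ha : 0 ≤ a) (hb : 0 ≤ b) :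
    ν ((a + b) • K) = ν (a • K) + ν (b • K) := by
  rw [hK.convex.add_smul ha hb]
  exact hν.add h2 (hK.smul a) hne.smul_set (hK.smul b) hne.smul_set

theorem IsBodyVal.nat_mul_smul [FiniteDimensional ℝ V] (hν : IsBodyVal ν)
    (h2 : ∀ K, IsBody K → ν ((2 : ℝ) • K) = 2 * ν K) {K : Set V} (hK : IsBody K)
    (hne : K.Nonempty) {a : ℝ} (ha : 0 ≤ a) (n : ℕ) : ν ((n * a) • K) = n * ν (a • K) := by
  induction n with
  | zero =>
    rw [Nat.cast_zero, zero_mul, zero_mul, zero_smul_set hne]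
    exact hν.singleton h2 0
  | succ n ih =>
    rw [Nat.cast_succ, add_mul, one_mul, hν.smul_add_smul h2 hK hne (by positivity) ha, ih]
    ring

/-- The dyadic approximation of `a` from above. -/
noncomputable def dyadicCeil (a : ℝ) (m : ℕ) : ℝ := (⌈2 ^ m * a⌉₊ : ℝ) * (2 ^ m)⁻¹

theorem le_dyadicCeil (a : ℝ) (m : ℕ) : a ≤ dyadicCeil a m := by
  rw [dyadicCeil, ← div_eq_mul_inv, le_div_iff₀ (by positivity), mul_comm]
  exact Nat.le_ceil _

theorem antitone_dyadicCeil (a : ℝ) : Antitone (dyadicCeil a) := by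
  refine antitone_nat_of_succ_le fun m => ?_
  rw [dyadicCeil, dyadicCeil, pow_succ, mul_inv, ← mul_assoc, mul_right_comm]
  refine mul_le_mul_of_nonneg_right ?_ (by positivity)
  rw [← div_eq_mul_inv, div_le_iff₀ two_pos]
  have : ⌈2 ^ m * 2 * a⌉₊ ≤ ⌈2 ^ m * a⌉₊ * 2 := by
    refine Nat.ceil_le.2 ?_
    push_cast
    nlinarith [Nat.le_ceil (2 ^ m * a)]
  exact_mod_cast this

theorem tendsto_dyadicCeil {a : ℝ} (ha : 0 ≤ a) : Tendsto (dyadicCeil a) atTop (𝓝 a) := by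
  have h : Tendsto (fun m : ℕ => a + ((2 : ℝ) ^ m)⁻¹) atTop (𝓝 (a + 0)) :=
    tendsto_const_nhds.add
      (tendsto_inv_atTop_zero.comp (tendsto_pow_atTop_atTop_of_one_lt one_lt_two))
  rw [add_zero] at h
  refine tendsto_of_tendsto_of_tendsto_of_le_of_le tendsto_const_nhds h (le_dyadicCeil a) fun m => ?_
  have h1 : (⌈2 ^ m * a⌉₊ : ℝ) < 2 ^ m * a + 1 := Nat.ceil_lt_add_one (by positivity)
  have h2 : (0 : ℝ) < 2 ^ m := by positivity
  calc dyadicCeil a m ≤ (2 ^ m * a + 1) * (2 ^ m)⁻¹ :=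
        mul_le_mul_of_nonneg_right h1.le (by positivity)
    _ = a + (2 ^ m)⁻¹ := by field_simp

theorem iInter_smul_of_tendsto {K : Set V} (hK : IsBody K) (h0 : (0 : V) ∈ K) {a : ℝ} (ha : 0 < a)
    {b : ℕ → ℝ} (hab : ∀ m, a ≤ b m) (hb : Tendsto b atTop (𝓝 a)) : ⋂ m, b m • K = a • K := by
  refine Subset.antisymm (fun x hx => ?_)
    (subset_iInter fun m => hK.smul_subset_smul h0 ha.le (hab m))
  rw [mem_iInter] at hx
  rw [mem_smul_set_iff_inv_smul_mem₀ ha.ne']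
  refine hK.compact.isClosed.mem_of_tendsto ((hb.inv₀ ha.ne').smul_const x)
    (Eventually.of_forall fun m => ?_)
  exact (mem_smul_set_iff_inv_smul_mem₀ (ha.trans_le (hab m)).ne' _ _).1 (hx m)

/-- Additivity gives integer, hence dyadic, factors. A real factor is approximated by dyadic ones
from above, so that the dilates of a translate containing 0 decrease. -/
theorem IsBodyVal.smul [FiniteDimensional ℝ V] (hν : IsBodyVal ν)
    (h2 : ∀ K, IsBody K → ν ((2 : ℝ) • K) = 2 * ν K) {K : Set V} (hK : IsBody K)
    (hne : K.Nonempty) {a : ℝ} (ha : 0 ≤ a) : ν (a • K) = a * ν K := by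
  rcases ha.eq_or_lt with rfl | ha
  · rw [zero_smul_set hne, zero_mul]
    exact hν.singleton h2 0
  obtain ⟨k, hk⟩ := hne
  have hL : IsBody ({-k} + K) := (isBody_singleton _).add hK
  have h0 : (0 : V) ∈ {-k} + K := ⟨-k, rfl, k, hk, by simp⟩
  have key : ν (a • ({-k} + K)) = a * ν ({-k} + K) := by
    set L := {-k} + K
    have hLne : L.Nonempty := ⟨0, h0⟩
    have h1 : ∀ m : ℕ, ν (dyadicCeil a m • L) = dyadicCeil a m * ν L := by
      intro m
      have h3 := hν.nat_mul_smul h2 hL hLne (a := ((2 : ℝ) ^ m)⁻¹) (by positivity) (2 ^ m)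
      push_cast at h3
      rw [mul_inv_cancel₀ (by positivity), one_smul] at h3
      rw [dyadicCeil, hν.nat_mul_smul h2 hL hLne (by positivity), h3]
      field_simp
    have h3 := hν.anti (fun m => dyadicCeil a m • L) (fun m => hL.smul _)
      (fun i j hij => hL.smul_subset_smul h0 (ha.le.trans (le_dyadicCeil a j))
        (antitone_dyadicCeil a hij))
    rw [iInter_smul_of_tendsto hL h0 ha (le_dyadicCeil a) (tendsto_dyadicCeil ha.le)] at h3
    simp only [h1] at h3
    exact tendsto_nhds_unique h3 ((tendsto_dyadicCeil ha.le).mul_const _)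
  rwa [smul_add, smul_set_singleton, hν.trans _ _ (hK.smul a), hν.trans _ _ hK] at key

end Homogeneity

/-- The support function. -/
noncomputable def supp (K : Set V) (u : V) : ℝ := sSup ((fun x => inner ℝ u x) '' K)

section Support

theorem isCompact_image_inner {K : Set V} (hK : IsCompact K) (u : V) :
    IsCompact ((fun x => inner ℝ u x : V → ℝ) '' K) := hK.image (by fun_prop)

theorem le_supp {K : Set V} (hK : IsCompact K) (u : V) {x : V} (hx : x ∈ K) :
    inner ℝ u x ≤ supp K u :=
  le_csSup (isCompact_image_inner hK u).bddAbove ⟨x, hx, rfl⟩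

theorem supp_le {K : Set V} (hne : K.Nonempty) {u : V} {c : ℝ} (h : ∀ x ∈ K, inner ℝ u x ≤ c) :
    supp K u ≤ c := by
  refine csSup_le (hne.image _) ?_
  rintro _ ⟨x, hx, rfl⟩
  exact h x hx

theorem exists_supp_eq {K : Set V} (hK : IsCompact K) (hne : K.Nonempty) (u : V) :
    ∃ x ∈ K, inner ℝ u x = supp K u := by
  obtain ⟨x, hx, h⟩ := (isCompact_image_inner hK u).sSup_mem (hne.image _)
  exact ⟨x, hx, h⟩

theorem supp_add {K L : Set V} (hK : IsCompact K) (hKne : K.Nonempty) (hL : IsCompact L)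
    (hLne : L.Nonempty) (u : V) : supp (K + L) u = supp K u + supp L u := by
  refine le_antisymm (supp_le (hKne.add hLne) ?_) ?_
  · rintro _ ⟨x, hx, y, hy, rfl⟩
    rw [inner_add_right]
    exact add_le_add (le_supp hK u hx) (le_supp hL u hy)
  · obtain ⟨x, hx, hxu⟩ := exists_supp_eq hK hKne u
    obtain ⟨y, hy, hyu⟩ := exists_supp_eq hL hLne u
    rw [← hxu, ← hyu, ← inner_add_right]
    exact le_supp (hK.add hL) u ⟨x, hx, y, hy, rfl⟩

theorem supp_smul {K : Set V} (hK : IsCompact K) (hne : K.Nonempty) {a : ℝ} (ha : 0 ≤ a) (u : V) :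
    supp (a • K) u = a * supp K u := by
  refine le_antisymm (supp_le hne.smul_set ?_) ?_
  · rintro _ ⟨x, hx, rfl⟩
    simp only
    rw [inner_smul_right]
    exact mul_le_mul_of_nonneg_left (le_supp hK u hx) ha
  · obtain ⟨x, hx, hxu⟩ := exists_supp_eq hK hne u
    rw [← hxu, ← inner_smul_right]
    exact le_supp (hK.smul a) u ⟨x, hx, rfl⟩

theorem supp_image (g : V ≃ₗᵢ[ℝ] V) (K : Set V) (u : V) : supp (g '' K) (g u) = supp K u := by
  rw [supp, supp, image_image]
  simp only [LinearIsometryEquiv.inner_map_map]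

theorem mem_of_forall_inner_le_supp [FiniteDimensional ℝ V] {K : Set V} (hK : IsBody K)
    (hne : K.Nonempty) {x : V} (h : ∀ u : V, ‖u‖ = 1 → inner ℝ u x ≤ supp K u) : x ∈ K := by
  by_contra hx
  have : CompleteSpace V := FiniteDimensional.complete ℝ V
  obtain ⟨f, c, hfc, hcx⟩ := geometric_hahn_banach_closed_point hK.convex hK.compact.isClosed hx
  obtain ⟨w, rfl⟩ := (InnerProductSpace.toDual ℝ V).surjective f
  simp only [InnerProductSpace.toDual_apply_apply] at hfc hcx
  have hw : w ≠ 0 := by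
    rintro rfl
    obtain ⟨k, hk⟩ := hne
    have := hfc k hk
    rw [inner_zero_left] at this hcx
    linarith
  have hw' : 0 < ‖w‖ := norm_pos_iff.2 hw
  have h1 := h (‖w‖⁻¹ • w) (norm_smul_inv_norm (𝕜 := ℝ) hw)
  have h2 : supp K (‖w‖⁻¹ • w) ≤ ‖w‖⁻¹ * c := by
    refine supp_le hne fun k hk => ?_
    rw [real_inner_smul_left]
    exact mul_le_mul_of_nonneg_left (hfc k hk).le (by positivity)
  rw [real_inner_smul_left] at h1
  have h3 := h1.trans h2
  rw [mul_le_mul_iff_right₀ (by positivity)] at h3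
  linarith

theorem subset_of_supp_le [FiniteDimensional ℝ V] {K L : Set V} (hK : IsCompact K) (hL : IsBody L)
    (hLne : L.Nonempty) (h : ∀ u : V, ‖u‖ = 1 → supp K u ≤ supp L u) : K ⊆ L :=
  fun _ hx => mem_of_forall_inner_le_supp hL hLne fun u hu => (le_supp hK u hx).trans (h u hu)

theorem continuous_supp {K : Set V} (hK : IsCompact K) : Continuous (supp K) :=
  hK.continuous_sSup (f := fun u x => inner ℝ u x) continuous_inner

end Support

end BodyValuation

/-! ### The orthogonal group and its Haar measure -/

namespace QuasiConcaveVal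

instance isProbabilityMeasure_haarO (N : ℕ) : IsProbabilityMeasure (haarO N) := by
  refine ⟨?_⟩
  have h := Measure.haarMeasure_self (K₀ := (⊤ : TopologicalSpace.PositiveCompacts
    (Matrix.orthogonalGroup (Fin N) ℝ)))
  simpa [haarO] using h

instance isMulLeftInvariant_haarO (N : ℕ) : (haarO N).IsMulLeftInvariant := by
  unfold haarO; infer_instance

instance isOpenPosMeasure_haarO (N : ℕ) : (haarO N).IsOpenPosMeasure := by
  unfold haarO; infer_instance

/-- The orthogonal matrices are the linear isometries of Euclidean space. -/
noncomputable def orthogonalEquiv (N : ℕ) :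
    Matrix.orthogonalGroup (Fin N) ℝ ≃* (E N ≃ₗᵢ[ℝ] E N) :=
  (Unitary.mapEquiv
    { (Matrix.toEuclideanCLM (𝕜 := ℝ) (n := Fin N)).toMulEquiv with
      map_star' := map_star (Matrix.toEuclideanCLM (𝕜 := ℝ) (n := Fin N)) }).toMulEquiv.trans
    Unitary.linearIsometryEquiv

theorem orthogonalEquiv_apply {N : ℕ} (g : Matrix.orthogonalGroup (Fin N) ℝ) (x : E N) (i : Fin N) :
    orthogonalEquiv N g x i = ∑ j, g.1 i j * x j := by
  change (Matrix.toEuclideanCLM (𝕜 := ℝ) (n := Fin N) g.1 x) i = _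
  rfl

theorem continuous_orthogonalEquiv (N : ℕ) : Continuous fun p : Matrix.orthogonalGroup (Fin N) ℝ × E N =>
    orthogonalEquiv N p.1 p.2 := by
  have h1 : Continuous fun p : Matrix.orthogonalGroup (Fin N) ℝ × E N => p.1.1 :=
    continuous_subtype_val.comp continuous_fst
  have h2 : Continuous fun p : Matrix.orthogonalGroup (Fin N) ℝ × E N =>
      (fun i => ∑ j, p.1.1 i j * p.2 j : Fin N → ℝ) :=
    continuous_pi fun i => continuous_finsetSum _ fun j _ => (h1.matrix_elem i j).mul (by fun_prop)
  refine ((PiLp.continuous_toLp 2 _).comp h2).congr fun p => ?_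
  ext i
  rw [orthogonalEquiv_apply]
  rfl

attribute [irreducible] orthogonalEquiv

end QuasiConcaveVal

/-! ### Averaging a body over rotations -/

namespace BodyValuation

/-- Invariance under linear isometries, on bodies. -/
def RotationInvariant {V : Type*} [NormedAddCommGroup V] [InnerProductSpace ℝ V]
    (ν : Set V → ℝ) : Prop := ∀ (g : V ≃ₗᵢ[ℝ] V) (K : Set V), IsBody K → ν (g '' K) = ν K

theorem IsBody.image_isometry {V W : Type*} [NormedAddCommGroup V] [InnerProductSpace ℝ V]
    [NormedAddCommGroup W] [InnerProductSpace ℝ W] {K : Set V} (hK : IsBody K) (g : V ≃ₗᵢ[ℝ] W) :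
    IsBody (g '' K) :=
  hK.image g.toContinuousLinearEquiv.toContinuousLinearMap

open QuasiConcaveVal

variable {N : ℕ}

/-- The mean of the support function over all rotations. -/
noncomputable def meanSupp (K : Set (E N)) (u : E N) : ℝ :=
  ∫ g, supp K (orthogonalEquiv N g⁻¹ u) ∂(haarO N)

theorem meanSupp_orthogonal (K : Set (E N)) (u : E N) (g₀ : Matrix.orthogonalGroup (Fin N) ℝ) :
    meanSupp K (orthogonalEquiv N g₀ u) = meanSupp K u := by
  have h := integral_mul_left_eq_self (μ := haarO N)
    (fun g => supp K (orthogonalEquiv N g⁻¹ u)) g₀⁻¹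
  rw [meanSupp, meanSupp, ← h]
  refine integral_congr_ae (Eventually.of_forall fun g => ?_)
  simp only [mul_inv_rev, inv_inv, map_mul]
  rfl

/-- A reflection interchanges two vectors of equal norm, so the rotation mean is the support
function of a ball. -/
theorem meanSupp_eq (K : Set (E N)) {u v : E N} (h : ‖u‖ = ‖v‖) : meanSupp K u = meanSupp K v := by
  obtain ⟨g, hg⟩ := (orthogonalEquiv N).surjective (Submodule.span ℝ {v - u})ᗮ.reflection
  rw [← Submodule.reflection_sub h.symm, ← hg, meanSupp_orthogonal]

theorem meanSupp_smul {K : Set (E N)} (hK : IsCompact K) (hne : K.Nonempty) {a : ℝ} (ha : 0 ≤ a)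
    (u : E N) : meanSupp (a • K) u = a * meanSupp K u := by
  simp only [meanSupp, supp_smul hK hne ha]
  exact integral_const_mul _ _

theorem continuous_supp_orthogonal {K : Set (E N)} (hK : IsCompact K) :
    Continuous fun p : Matrix.orthogonalGroup (Fin N) ℝ × E N =>
      supp K (orthogonalEquiv N p.1⁻¹ p.2) :=
  (continuous_supp hK).comp ((continuous_orthogonalEquiv N).comp
    ((continuous_fst.inv).prodMk continuous_snd))

theorem le_meanSupp {K : Set (E N)} (hK : IsCompact K) {c : ℝ} {u : E N} (hu : ‖u‖ = 1)
    (h : ∀ u : E N, ‖u‖ = 1 → c ≤ supp K u) : c ≤ meanSupp K u := by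
  have hint : Integrable (fun g => supp K (orthogonalEquiv N g⁻¹ u)) (haarO N) := by
    have hc : Continuous fun g : Matrix.orthogonalGroup (Fin N) ℝ => (g, u) := by fun_prop
    have hc' := (continuous_supp_orthogonal hK).comp hc
    exact hc'.integrable_of_hasCompactSupport (HasCompactSupport.of_compactSpace _)
  calc c = ∫ _, c ∂(haarO N) := by simp
    _ ≤ meanSupp K u := by
      refine integral_mono (integrable_const c) hint fun g => h _ ?_
      rw [LinearIsometryEquiv.norm_map, hu]

/-- Minkowski additivity and homogeneity make the set `A` of support functions of bodies with the
same value of ν convex. It contains those of all rotated copies, so their Haar mean lies in its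
closure in C(S). -/
theorem exists_supp_near_meanSupp {ν : Set (E N) → ℝ} (hν : IsBodyVal ν)
    (h2 : ∀ K, IsBody K → ν ((2 : ℝ) • K) = 2 * ν K) (hrot : RotationInvariant ν)
    {K : Set (E N)} (hK : IsBody K) (hne : K.Nonempty) {δ : ℝ} (hδ : 0 < δ) :
    ∃ M : Set (E N), IsBody M ∧ M.Nonempty ∧ ν M = ν K ∧
      ∀ u : E N, ‖u‖ = 1 → |supp M u - meanSupp K u| < δ := by
  let S := Metric.sphere (0 : E N) 1
  have hc : Continuous fun p : Matrix.orthogonalGroup (Fin N) ℝ × S => (p.1, (p.2 : E N)) := by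
    fun_prop
  have hc' := (continuous_supp_orthogonal hK.compact).comp hc
  let H : C(Matrix.orthogonalGroup (Fin N) ℝ, C(S, ℝ)) := ContinuousMap.curry
    ⟨fun p => supp K (orthogonalEquiv N p.1⁻¹ p.2), hc'⟩
  let A : Set C(S, ℝ) := {h | ∃ M : Set (E N), IsBody M ∧ M.Nonempty ∧ ν M = ν K ∧
    ∀ u : S, supp M u = h u}
  have hA : Convex ℝ A := by
    rintro h ⟨M, hM, hMne, hMν, hMh⟩ h' ⟨M', hM', hMne', hMν', hMh'⟩ a b ha hb hab
    refine ⟨a • M + b • M', (hM.smul a).add (hM'.smul b), hMne.smul_set.add hMne'.smul_set, ?_, ?_⟩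
    · rw [hν.add h2 (hM.smul a) hMne.smul_set (hM'.smul b) hMne'.smul_set, hν.smul h2 hM hMne ha,
        hν.smul h2 hM' hMne' hb, hMν, hMν', ← add_mul, hab, one_mul]
    · intro u
      rw [supp_add (hM.smul a).compact hMne.smul_set (hM'.smul b).compact hMne'.smul_set,
        supp_smul hM.compact hMne ha, supp_smul hM'.compact hMne' hb, hMh, hMh']
      rfl
  have hHA : ∀ g, H g ∈ A := by
    intro g
    refine ⟨orthogonalEquiv N g '' K, hK.image_isometry _, hne.image _, hrot _ _ hK, fun u => ?_⟩
    have : (u : E N) = orthogonalEquiv N g (orthogonalEquiv N g⁻¹ u) := by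
      rw [map_inv]
      exact ((orthogonalEquiv N g).apply_symm_apply _).symm
    rw [this, supp_image]
    rfl
  have hint : Integrable H (haarO N) :=
    H.continuous.integrable_of_hasCompactSupport (HasCompactSupport.of_compactSpace _)
  have hmem : ∫ g, H g ∂(haarO N) ∈ closure A :=
    hA.closure.integral_mem isClosed_closure
      (Eventually.of_forall fun g => subset_closure (hHA g)) hint
  obtain ⟨h, ⟨M, hM, hMne, hMν, hMh⟩, hdist⟩ := Metric.mem_closure_iff.1 hmem δ hδ
  refine ⟨M, hM, hMne, hMν, fun u hu => ?_⟩
  have hu' : u ∈ S := by simpa [S] using hu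
  have h3 := (ContinuousMap.dist_apply_le_dist (⟨u, hu'⟩ : S)).trans_lt hdist
  rw [ContinuousMap.integral_apply hint, dist_comm, Real.dist_eq, ← hMh] at h3
  exact h3

/-- The approximating bodies converge to the ball but need not decrease. Adding a multiple of `C`
costs nothing, as ν(C) = 0, and since `C` contains the unit ball it can absorb the errors and force
a decreasing sequence. -/
theorem eq_of_meanSupp {ν : Set (E N) → ℝ} (hν : IsBodyVal ν)
    (h2 : ∀ K, IsBody K → ν ((2 : ℝ) • K) = 2 * ν K) (hrot : RotationInvariant ν)
    {C : Set (E N)} (hC : IsBody C) (hCne : C.Nonempty) (hC0 : ν C = 0)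
    (hC1 : ∀ u : E N, ‖u‖ = 1 → 1 ≤ supp C u) {K : Set (E N)} (hK : IsBody K) (hne : K.Nonempty)
    {r : ℝ} (hr : ∀ u : E N, ‖u‖ = 1 → meanSupp K u = r) :
    ν K = ν {x | ∀ u : E N, ‖u‖ = 1 → inner ℝ u x ≤ r} := by
  -- With h ≥ 1 the support function of `C`, monotonicity requires δ + δ/4 + (δ/2)h ≤ 2δh, which
  -- holds at this ratio; the ratio 1/2 would be too slow.
  let δ : ℕ → ℝ := fun j => (1 / 4) ^ j
  have hδ : ∀ j, 0 < δ j := fun j => by positivity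
  have hδs : ∀ j, δ (j + 1) = δ j / 4 := fun j => by simp only [δ, pow_succ]; ring
  have hδ0 : Tendsto δ atTop (𝓝 0) :=
    tendsto_pow_atTop_nhds_zero_of_lt_one (by norm_num) (by norm_num)
  choose M hM hMne hMν hMr using fun j => exists_supp_near_meanSupp hν h2 hrot hK hne (hδ j)
  let X : ℕ → Set (E N) := fun j => M j + (2 * δ j) • C
  have hX : ∀ j, IsBody (X j) := fun j => (hM j).add (hC.smul _)
  have hXne : ∀ j, (X j).Nonempty := fun j => (hMne j).add hCne.smul_set
  have hXsupp : ∀ j u, supp (X j) u = supp (M j) u + 2 * δ j * supp C u := by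
    intro j u
    rw [supp_add (hM j).compact (hMne j) (hC.smul _).compact hCne.smul_set,
      supp_smul hC.compact hCne (by have := hδ j; positivity)]
  have hXν : ∀ j, ν (X j) = ν K := by
    intro j
    rw [hν.add h2 (hM j) (hMne j) (hC.smul _) hCne.smul_set,
      hν.smul h2 hC hCne (by have := hδ j; positivity), hC0, mul_zero, add_zero, hMν]
  have hXanti : Antitone X := by
    refine antitone_nat_of_succ_le fun j => subset_of_supp_le (hX _).compact (hX j) (hXne j) ?_
    intro u hu
    have h3 := abs_lt.1 (hMr j u hu)
    have h4 := abs_lt.1 (hMr (j + 1) u hu)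
    rw [hr u hu] at h3 h4
    rw [hXsupp, hXsupp, hδs]
    rw [hδs] at h4
    have h5 := hC1 u hu
    have h6 := hδ j
    nlinarith
  have hXi : ⋂ j, X j = {x | ∀ u : E N, ‖u‖ = 1 → inner ℝ u x ≤ r} := by
    ext x
    rw [mem_iInter, mem_ofPred_eq]
    constructor
    · intro hx u hu
      have h3 : Tendsto (fun j => r + δ j + 2 * δ j * supp C u) atTop
          (𝓝 (r + 0 + 2 * 0 * supp C u)) :=
        (tendsto_const_nhds.add hδ0).add ((hδ0.const_mul 2).mul_const _)
      rw [add_zero, mul_zero, zero_mul, add_zero] at h3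
      refine ge_of_tendsto' h3 fun j => (le_supp (hX j).compact u (hx j)).trans ?_
      have h4 := abs_lt.1 (hMr j u hu)
      rw [hr u hu] at h4
      rw [hXsupp]
      linarith
    · intro hx j
      refine mem_of_forall_inner_le_supp (hX j) (hXne j) fun u hu => (hx u hu).trans ?_
      have h4 := abs_lt.1 (hMr j u hu)
      rw [hr u hu] at h4
      rw [hXsupp]
      have h5 := hC1 u hu
      have h6 := hδ j
      nlinarith
  have h3 := hν.anti X hX hXanti
  rw [hXi] at h3
  simp only [hXν] at h3
  exact tendsto_nhds_unique tendsto_const_nhds h3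

/-- A body `K` containing 0 and the multiple of `C` with the same mean support are both compared
with the same ball, and every multiple of `C` has value 0. -/
theorem eq_zero_of_two_smul_of_rotation [Nontrivial (E N)] {ν : Set (E N) → ℝ} (hν : IsBodyVal ν)
    (h2 : ∀ K, IsBody K → ν ((2 : ℝ) • K) = 2 * ν K) (hrot : RotationInvariant ν)
    {C : Set (E N)} (hC : IsBody C) (hCne : C.Nonempty) (hC0 : ν C = 0)
    (hC1 : ∀ u : E N, ‖u‖ = 1 → 1 ≤ supp C u) {K : Set (E N)} (hK : IsBody K) : ν K = 0 := by
  rcases K.eq_empty_or_nonempty with rfl | ⟨k, hk⟩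
  · exact hν.empty
  obtain ⟨u₀, hu₀⟩ := exists_norm_eq (E N) zero_le_one
  rw [← hν.trans (-k) K hK]
  have hL : IsBody ({-k} + K) := (isBody_singleton _).add hK
  have h0 : (0 : E N) ∈ {-k} + K := ⟨-k, rfl, k, hk, by simp⟩
  set L := {-k} + K
  have hrL : 0 ≤ meanSupp L u₀ := le_meanSupp hL.compact hu₀ fun u _ => by
    simpa using le_supp hL.compact u h0
  have hrC : 1 ≤ meanSupp C u₀ := le_meanSupp hC.compact hu₀ hC1
  have ha : 0 ≤ meanSupp L u₀ / meanSupp C u₀ := by positivity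
  rw [eq_of_meanSupp hν h2 hrot hC hCne hC0 hC1 hL ⟨0, h0⟩ (r := meanSupp L u₀)
    (fun u hu => meanSupp_eq L (hu.trans hu₀.symm)),
    ← eq_of_meanSupp hν h2 hrot hC hCne hC0 hC1 (hC.smul (meanSupp L u₀ / meanSupp C u₀))
      hCne.smul_set (r := meanSupp L u₀), hν.smul h2 hC hCne ha, hC0, mul_zero]
  intro u hu
  rw [meanSupp_smul hC.compact hCne ha, meanSupp_eq C (hu.trans hu₀.symm), div_mul_cancel₀]
  linarith

end BodyValuation

/-! ### The volume theorem -/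

namespace BodyValuation

variable {V : Type*} [NormedAddCommGroup V] [InnerProductSpace ℝ V]

/-- A functional that vanishes on bodies in hyperplanes. -/
def VanishesOnHyperplanes (ν : Set V → ℝ) : Prop :=
  ∀ K, IsBody K → ∀ f : V →L[ℝ] ℝ, f ≠ 0 → ∀ c, (∀ x ∈ K, f x = c) → ν K = 0

theorem IsBodyVal.isSimple {ν : Set V → ℝ} (hν : IsBodyVal ν) (h : VanishesOnHyperplanes ν) :
    IsSimple ν := by
  refine ⟨hν.empty, fun K hK f hf c => ?_, hν.anti⟩
  rw [← hν.cut hK f c, h _ (hK.inter_eq f c) f hf c (fun x hx => hx.2), add_zero]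

theorem IsBodyVal.comp_image {W : Type*} [NormedAddCommGroup W] [InnerProductSpace ℝ W]
    {ν : Set V → ℝ} (hν : IsBodyVal ν) {g : W →L[ℝ] V} (hg : Function.Injective g) :
    IsBodyVal fun A : Set W => ν (g '' A) := by
  refine ⟨by simp [hν.empty], fun K L hK hL hKL => ?_, fun v K hK => ?_, fun K hK hanti => ?_⟩
  · rw [image_union, image_inter hg]
    refine hν.union _ _ (hK.image g) (hL.image g) ?_
    rw [← image_union]
    exact hKL.linear_image g.toLinearMap
  · rw [image_add, image_singleton]
    exact hν.trans _ _ (hK.image g)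
  · have := hν.anti (fun j => g '' K j) (fun j => (hK j).image g)
      (fun i j hij => image_mono (hanti hij))
    rwa [iInter_image hg] at this

theorem RotationInvariant.comp_isometry {W : Type*} [NormedAddCommGroup W] [InnerProductSpace ℝ W]
    {ν : Set V → ℝ} (hν : RotationInvariant ν) (L : W ≃ₗᵢ[ℝ] V) :
    RotationInvariant fun A : Set W => ν (L '' A) := by
  intro g K hK
  have := hν ((L.symm.trans g).trans L) (L '' K) (hK.image_isometry L)
  simp only
  rw [← this, image_image, image_image]
  simp

/-- The unit cube spanned by a family of vectors. -/
def cube {ι : Type*} [Fintype ι] (e : ι → V) : Set V :=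
  {x | ∃ t : ι → ℝ, (∀ i, t i ∈ Icc (0 : ℝ) 1) ∧ x = ∑ i, t i • e i}

theorem isBody_cube {ι : Type*} [Fintype ι] (e : ι → V) : IsBody (cube e) := by
  have h : cube e = (∑ i, (ContinuousLinearMap.proj i : (ι → ℝ) →L[ℝ] ℝ).smulRight (e i) :
      (ι → ℝ) →L[ℝ] V) '' Icc 0 1 := by
    ext x
    simp only [cube, mem_ofPred_eq, mem_image, mem_Icc, Pi.le_def, Pi.zero_apply, Pi.one_apply,
      forall_and, sum_apply, ContinuousLinearMap.smulRight_apply,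
      ContinuousLinearMap.proj_apply, eq_comm]
  rw [h]
  exact ⟨isCompact_Icc.image (ContinuousLinearMap.continuous _),
    (convex_Icc _ _).linear_image (ContinuousLinearMap.toLinearMap _)⟩

theorem cube_nonempty {ι : Type*} [Fintype ι] (e : ι → V) : (cube e).Nonempty :=
  ⟨0, 0, fun _ => by simp, by simp⟩

theorem image_cube {W : Type*} [NormedAddCommGroup W] [InnerProductSpace ℝ W] {ι : Type*}
    [Fintype ι] (g : V →L[ℝ] W) (e : ι → V) : g '' cube e = cube (fun i => g (e i)) := by
  ext x
  constructor
  · rintro ⟨_, ⟨t, ht, rfl⟩, rfl⟩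
    exact ⟨t, ht, by simp⟩
  · rintro ⟨t, ht, rfl⟩
    exact ⟨_, ⟨t, ht, rfl⟩, by simp⟩

theorem cube_sumElim {ι κ : Type*} [Fintype ι] [Fintype κ] (e : ι → V) (e' : κ → V) :
    cube (Sum.elim e e') = cube e + cube e' := by
  ext x
  constructor
  · rintro ⟨t, ht, rfl⟩
    refine ⟨_, ⟨fun i => t (Sum.inl i), fun i => ht _, rfl⟩, _,
      ⟨fun i => t (Sum.inr i), fun i => ht _, rfl⟩, ?_⟩
    simp
  · rintro ⟨_, ⟨t, ht, rfl⟩, _, ⟨s, hs, rfl⟩, rfl⟩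
    refine ⟨Sum.elim t s, ?_, by simp⟩
    rintro (i | i)
    · exact ht i
    · exact hs i

/-- A functional that vanishes on the unit cubes of full dimension. -/
def VanishesOnCubes (ν : Set V → ℝ) : Prop :=
  ∀ (ι : Type) [Fintype ι] (e : ι → V), Orthonormal ℝ e → Fintype.card ι = Module.finrank ℝ V →
    ν (cube e) = 0

section AddOrthogonal

theorem orthogonalProjectionOnto_add {F : Submodule ℝ V} [F.HasOrthogonalProjection] (a : F) {d : V}
    (hd : d ∈ Fᗮ) : F.orthogonalProjectionOnto (a + d) = a := by
  rw [map_add, F.orthogonalProjectionOnto_mem_subspace_eq_self,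
    Submodule.orthogonalProjectionOnto_apply_of_mem_orthogonal hd, add_zero]

variable [FiniteDimensional ℝ V] {F : Submodule ℝ V} {D : Set V}

theorem image_inter_add (hD : D ⊆ (Fᗮ : Submodule ℝ V)) (A B : Set F) :
    F.subtypeL '' (A ∩ B) + D = (F.subtypeL '' A + D) ∩ (F.subtypeL '' B + D) := by
  refine Subset.antisymm (subset_inter (add_subset_add_right (image_mono inter_subset_left))
    (add_subset_add_right (image_mono inter_subset_right))) ?_
  rintro _ ⟨⟨_, ⟨a, ha, rfl⟩, d, hd, rfl⟩, ⟨_, ⟨b, hb, rfl⟩, d', hd', h⟩⟩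
  have h1 : F.orthogonalProjectionOnto ((a : V) + d) = F.orthogonalProjectionOnto ((b : V) + d') :=
    congrArg F.orthogonalProjectionOnto h.symm
  rw [orthogonalProjectionOnto_add a (hD hd), orthogonalProjectionOnto_add b (hD hd')] at h1
  exact ⟨_, ⟨a, ⟨ha, h1 ▸ hb⟩, rfl⟩, d, hd, rfl⟩

/-- Freezing one factor of an orthogonal product leaves a valuation in the other; intersections
survive because the projection onto `F` recovers the summand in `F`. This feeds the induction on the
dimension. -/
theorem IsBodyVal.add_orthogonal {ν : Set V → ℝ} (hν : IsBodyVal ν) (hD : IsBody D)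
    (hDF : D ⊆ (Fᗮ : Submodule ℝ V)) : IsBodyVal fun A : Set F => ν (F.subtypeL '' A + D) := by
  refine ⟨by simp [hν.empty], fun K L hK hL hKL => ?_, fun v K hK => ?_, fun K hK hanti => ?_⟩
  · rw [image_inter_add hDF, image_union, union_add]
    refine hν.union _ _ ((hK.image _).add hD) ((hL.image _).add hD) ?_
    rw [← union_add, ← image_union]
    exact (hKL.linear_image F.subtype).add hD.convex
  · rw [image_add, image_singleton, add_assoc]
    exact hν.trans _ _ ((hK.image _).add hD)
  · have := hν.anti (fun j => F.subtypeL '' K j + D) (fun j => ((hK j).image _).add hD)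
      (fun i j hij => add_subset_add_right (image_mono (hanti hij)))
    rwa [iInter_add (fun j => (hK j).image _) (fun i j hij => image_mono (hanti hij)) hD,
      iInter_image Subtype.val_injective] at this

theorem VanishesOnHyperplanes.add_orthogonal {ν : Set V → ℝ} (hν : VanishesOnHyperplanes ν)
    (hD : IsBody D) (hDF : D ⊆ (Fᗮ : Submodule ℝ V)) :
    VanishesOnHyperplanes fun A : Set F => ν (F.subtypeL '' A + D) := by
  intro K hK f hf c hc
  refine hν _ ((hK.image _).add hD) (f ∘L F.orthogonalProjectionOnto) ?_ c ?_
  · intro h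
    refine hf (ContinuousLinearMap.ext fun x => ?_)
    have := congrArg (fun g : V →L[ℝ] ℝ => g x) h
    simpa using this
  · rintro _ ⟨_, ⟨a, ha, rfl⟩, d, hd, rfl⟩
    have : F.orthogonalProjectionOnto ((a : V) + d) = a := orthogonalProjectionOnto_add a (hDF hd)
    change f (F.orthogonalProjectionOnto ((a : V) + d)) = c
    rw [this, hc a ha]

/-- The extension of an isometry of a subspace by the identity of its orthogonal complement. -/
theorem exists_isometry_extension (g : F ≃ₗᵢ[ℝ] F) :
    ∃ T : V ≃ₗᵢ[ℝ] V, (∀ a : F, T a = g a) ∧ ∀ d ∈ Fᗮ, T d = d := by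
  let T₀ : V →ₗ[ℝ] V :=
    F.subtype ∘ₗ g.toLinearEquiv.toLinearMap ∘ₗ F.orthogonalProjectionOnto.toLinearMap +
      Fᗮ.subtype ∘ₗ Fᗮ.orthogonalProjectionOnto.toLinearMap
  have hT₀ : ∀ x, T₀ x = g (F.orthogonalProjectionOnto x) + Fᗮ.orthogonalProjectionOnto x :=
    fun x => rfl
  have hnorm : ∀ x, ‖T₀ x‖ = ‖x‖ := by
    intro x
    have h1 := F.norm_sq_eq_add_norm_sq_projection x
    have h2 : ‖T₀ x‖ * ‖T₀ x‖ = ‖(g (F.orthogonalProjectionOnto x) : V)‖ *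
        ‖(g (F.orthogonalProjectionOnto x) : V)‖ +
        ‖(Fᗮ.orthogonalProjectionOnto x : V)‖ * ‖(Fᗮ.orthogonalProjectionOnto x : V)‖ := by
      rw [hT₀]
      exact norm_add_sq_eq_norm_sq_add_norm_sq_of_inner_eq_zero _ _
        ((Fᗮ.orthogonalProjectionOnto x).2 _ (g (F.orthogonalProjectionOnto x)).2)
    have h3 : ‖(g (F.orthogonalProjectionOnto x) : V)‖ = ‖F.orthogonalProjectionOnto x‖ :=
      g.norm_map _
    rw [h3] at h2
    have h4 : ‖T₀ x‖ ^ 2 = ‖x‖ ^ 2 := by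
      rw [h1, sq, h2]
      simp only [sq]
      rfl
    exact (sq_eq_sq₀ (norm_nonneg _) (norm_nonneg _)).1 h4
  refine ⟨LinearIsometry.toLinearIsometryEquiv ⟨T₀, hnorm⟩ rfl, fun a => ?_, fun d hd => ?_⟩
  · change T₀ a = _
    rw [hT₀, F.orthogonalProjectionOnto_mem_subspace_eq_self,
      Submodule.orthogonalProjectionOnto_apply_of_mem_orthogonal
        (Submodule.le_orthogonal_orthogonal F a.2)]
    simp
  · change T₀ d = _
    rw [hT₀, Submodule.orthogonalProjectionOnto_apply_of_mem_orthogonal hd, map_zero]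
    have := Fᗮ.orthogonalProjectionOnto_mem_subspace_eq_self ⟨d, hd⟩
    simp only at this
    rw [this]
    simp

theorem RotationInvariant.add_orthogonal {ν : Set V → ℝ} (hν : RotationInvariant ν)
    (hD : IsBody D) (hDF : D ⊆ (Fᗮ : Submodule ℝ V)) :
    RotationInvariant fun A : Set F => ν (F.subtypeL '' A + D) := by
  intro g K hK
  obtain ⟨T, hT, hT'⟩ := exists_isometry_extension g
  have := hν T (F.subtypeL '' K + D) ((hK.image _).add hD)
  simp only
  rw [← this, image_add]
  congr 2
  · rw [image_image, image_image]
    exact image_congr fun a _ => (hT a).symm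
  · conv_lhs => rw [← image_id D]
    exact image_congr fun d hd => (hT' d (hDF hd)).symm

end AddOrthogonal

theorem orthonormal_sumElim {ι κ : Type*} {F : Submodule ℝ V} {e : ι → F} {e' : κ → Fᗮ}
    (he : Orthonormal ℝ e) (he' : Orthonormal ℝ e') :
    Orthonormal ℝ (Sum.elim (fun i => (e i : V)) fun i => (e' i : V)) := by
  constructor
  · rintro (i | i)
    · exact he.1 i
    · exact he'.1 i
  · rintro (i | i) (j | j) hij
    · exact he.2 fun h => hij (by rw [h])
    · exact (e' j).2 _ (e i).2
    · simp only [Sum.elim_inl, Sum.elim_inr]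
      rw [real_inner_comm]
      exact (e' i).2 _ (e j).2
    · exact he'.2 fun h => hij (by rw [h])

/-- The volume theorem: a simple rigid motion invariant valuation that vanishes on the unit cubes
vanishes. -/
theorem IsBodyVal.eq_zero_of_cubes (n : ℕ) :
    ∀ {V : Type*} [NormedAddCommGroup V] [InnerProductSpace ℝ V] [FiniteDimensional ℝ V]
      (_ : Module.finrank ℝ V = n) {ν : Set V → ℝ} (_ : IsBodyVal ν) (_ : RotationInvariant ν)
      (_ : VanishesOnHyperplanes ν) (_ : VanishesOnCubes ν) {K : Set V}, IsBody K → ν K = 0 := by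
  induction n using Nat.strong_induction_on with
  | _ n ih =>
  intro V _ _ _ hn ν hν hrot hsimple hcube K hK
  rcases Nat.eq_zero_or_pos n with rfl | hpos
  · have hsub : Subsingleton V := Module.finrank_zero_iff.1 hn
    rcases K.eq_empty_or_nonempty with rfl | hne
    · exact hν.empty
    · have h := hcube (Fin 0) (fun i => i.elim0) ⟨fun i => i.elim0, fun i => i.elim0⟩
        (by rw [hn]; rfl)
      rw [Subsingleton.eq_univ_of_nonempty hne]
      rwa [Subsingleton.eq_univ_of_nonempty (cube_nonempty _)] at h
  have hnt : Nontrivial V := Module.nontrivial_of_finrank_pos (R := ℝ) (by omega)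
  -- The induction hypothesis is used twice: with `A` frozen it suffices to treat a cube in place of
  -- `B`, with that cube frozen a cube in place of `A`; and a product of two cubes is a cube of full
  -- dimension.
  have hprod : VanishesOnProducts ν := by
    intro F hF hF' A B hA hB hAF hBF
    have hlt : Module.finrank ℝ F < n := by rw [← hn]; exact Submodule.finrank_lt hF'
    have hFo : (Fᗮ : Submodule ℝ V) ≠ ⊤ := by rw [Ne, Submodule.orthogonal_eq_top_iff]; exact hF
    have hlt' : Module.finrank ℝ (Fᗮ : Submodule ℝ V) < n := by
      rw [← hn]; exact Submodule.finrank_lt hFo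
    obtain ⟨A', hA', rfl⟩ := hA.exists_subtype_image hAF
    obtain ⟨B', hB', rfl⟩ := hB.exists_subtype_image hBF
    have hAF' : F.subtypeL '' A' ⊆ (Fᗮᗮ : Submodule ℝ V) :=
      hAF.trans (Submodule.le_orthogonal_orthogonal F)
    rw [add_comm]
    refine ih _ hlt' rfl (hν.add_orthogonal (F := Fᗮ) hA hAF') (hrot.add_orthogonal hA hAF')
      (hsimple.add_orthogonal hA hAF') ?_ hB'
    intro κ _ e' he' hκ
    have hC : Fᗮ.subtypeL '' cube e' ⊆ (Fᗮ : Submodule ℝ V) := by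
      rintro _ ⟨x, _, rfl⟩
      exact x.2
    have hCb : IsBody (Fᗮ.subtypeL '' cube e') := (isBody_cube e').image _
    simp only
    rw [add_comm]
    refine ih _ hlt rfl (hν.add_orthogonal hCb hC) (hrot.add_orthogonal hCb hC)
      (hsimple.add_orthogonal hCb hC) ?_ hA'
    intro ι _ e he hι
    simp only
    rw [image_cube, image_cube, ← cube_sumElim]
    refine hcube _ _ (orthonormal_sumElim he he') ?_
    rw [Fintype.card_sum, hι, hκ]
    exact F.finrank_add_finrank_orthogonal
  have h2 : ∀ K, IsBody K → ν ((2 : ℝ) • K) = 2 * ν K :=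
    fun K hK => (hν.isSimple hsimple).two_smul hν.trans hprod hK
  subst hn
  let L : QuasiConcaveVal.E (Module.finrank ℝ V) ≃ₗᵢ[ℝ] V := (stdOrthonormalBasis ℝ V).repr.symm
  have : Nontrivial (QuasiConcaveVal.E (Module.finrank ℝ V)) := L.toEquiv.nontrivial
  have hν' : IsBodyVal fun A => ν (L '' A) :=
    hν.comp_image (g := L.toContinuousLinearEquiv.toContinuousLinearMap) L.injective
  have h2' : ∀ A, IsBody A → ν (L '' ((2 : ℝ) • A)) = 2 * ν (L '' A) := by
    intro A hA
    rw [← h2 _ (hA.image_isometry L), image_smul_set]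
  let e : Fin (Module.finrank ℝ V) → QuasiConcaveVal.E (Module.finrank ℝ V) :=
    fun i => EuclideanSpace.single i 1
  -- The cube [-1, 1]^n: it contains the unit ball, and its value is twice that of the unit cube,
  -- hence 0.
  let C : Set (QuasiConcaveVal.E (Module.finrank ℝ V)) := {-∑ i, e i} + (2 : ℝ) • cube e
  have hC : IsBody C := (isBody_singleton _).add ((isBody_cube e).smul 2)
  have hCne : C.Nonempty := (singleton_nonempty _).add (cube_nonempty e).smul_set
  have hC0 : ν (L '' C) = 0 := by
    have h3 := hν'.trans (-∑ i, e i) _ ((isBody_cube e).smul 2)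
    rw [h3, h2' _ (isBody_cube e)]
    have h4 : L '' cube e = cube fun i => L (e i) :=
      image_cube L.toContinuousLinearEquiv.toContinuousLinearMap e
    rw [h4, hcube _ _ _ (Fintype.card_fin _), mul_zero]
    exact ((EuclideanSpace.orthonormal_single).comp_linearIsometryEquiv L)
  have hC1 : ∀ u, ‖u‖ = 1 → 1 ≤ supp C u := by
    intro u hu
    have huC : u ∈ C := by
      refine ⟨_, rfl, _, ⟨_, ⟨fun i => (1 + u i) / 2, fun i => ?_, rfl⟩, rfl⟩, ?_⟩
      · have h3 := (PiLp.norm_apply_le u i).trans hu.le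
        rw [Real.norm_eq_abs, abs_le] at h3
        constructor <;> linarith
      · ext j
        simp [e, Finset.smul_sum, Pi.single_apply]
        ring
    have h3 := le_supp hC.compact u huC
    rwa [real_inner_self_eq_norm_sq, hu, one_pow] at h3
  have hfin := eq_zero_of_two_smul_of_rotation hν' h2' (hrot.comp_isometry L) hC hCne hC0 hC1
    (hK.image_isometry L.symm)
  simp only [image_image, LinearIsometryEquiv.apply_symm_apply, image_id'] at hfin
  exact hfin

end BodyValuation

/-! ### Homogeneous valuations of arbitrary degree -/

namespace BodyValuation

variable {V : Type*} [NormedAddCommGroup V] [InnerProductSpace ℝ V]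

/-- The box with edges `a i • e i`. -/
def box {ι : Type*} [Fintype ι] (e : ι → V) (a : ι → ℝ) : Set V :=
  {x | ∃ t : ι → ℝ, (∀ i, t i ∈ Icc (0 : ℝ) (a i)) ∧ x = ∑ i, t i • e i}

theorem isBody_box {ι : Type*} [Fintype ι] (e : ι → V) (a : ι → ℝ) : IsBody (box e a) := by
  have h : box e a = (∑ i, (ContinuousLinearMap.proj i : (ι → ℝ) →L[ℝ] ℝ).smulRight (e i) :
      (ι → ℝ) →L[ℝ] V) '' Icc 0 a := by
    ext x
    simp only [box, mem_ofPred_eq, mem_image, mem_Icc, Pi.le_def, Pi.zero_apply,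
      forall_and, sum_apply, ContinuousLinearMap.smulRight_apply,
      ContinuousLinearMap.proj_apply, eq_comm]
  rw [h]
  exact ⟨isCompact_Icc.image (ContinuousLinearMap.continuous _),
    (convex_Icc _ _).linear_image (ContinuousLinearMap.toLinearMap _)⟩

theorem two_smul_cube {ι : Type*} [Fintype ι] (e : ι → V) :
    (2 : ℝ) • cube e = box e fun _ => 2 := by
  ext x
  rw [mem_smul_set]
  constructor
  · rintro ⟨_, ⟨t, ht, rfl⟩, rfl⟩
    refine ⟨fun i => 2 * t i, fun i => ⟨by linarith [(ht i).1], by linarith [(ht i).2]⟩, ?_⟩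
    simp [Finset.smul_sum, mul_smul]
  · rintro ⟨t, ht, rfl⟩
    refine ⟨_, ⟨fun i => t i / 2, fun i => ⟨by linarith [(ht i).1], by linarith [(ht i).2]⟩, rfl⟩, ?_⟩
    rw [Finset.smul_sum]
    refine Finset.sum_congr rfl fun i _ => ?_
    rw [smul_smul]
    congr 1
    ring

/-- The hyperplane at height 1 cuts an edge of length 2 into two, and the two pieces are translates
of each other. -/
theorem IsSimple.box_update {ι : Type*} [Fintype ι] [DecidableEq ι] {η : Set V → ℝ}
    (hη : IsSimple η) (htr : TranslationInvariant η) {e : ι → V} (he : Orthonormal ℝ e) (a : ι → ℝ)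
    (i : ι) : η (box e (Function.update a i 2)) = 2 * η (box e (Function.update a i 1)) := by
  have hf : innerSL ℝ (e i) ≠ 0 := by
    intro h
    have := congrArg (fun g : V →L[ℝ] ℝ => g (e i)) h
    simp only [innerSL_apply_apply, real_inner_self_eq_norm_sq, he.1 i] at this
    norm_num at this
  have hcoord : ∀ t : ι → ℝ, innerSL ℝ (e i) (∑ j, t j • e j) = t i := by
    intro t
    rw [innerSL_apply_apply]
    exact he.inner_right_fintype t i
  have h1 : box e (Function.update a i 2) ∩ {x | innerSL ℝ (e i) x ≤ 1} =
      box e (Function.update a i 1) := by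
    ext x
    constructor
    · rintro ⟨⟨t, ht, rfl⟩, hx⟩
      rw [mem_ofPred_eq, hcoord] at hx
      refine ⟨t, fun j => ?_, rfl⟩
      have := ht j
      rcases eq_or_ne j i with rfl | hj
      · simp only [Function.update_self] at this ⊢
        exact ⟨this.1, hx⟩
      · simpa [hj] using this
    · rintro ⟨t, ht, rfl⟩
      refine ⟨⟨t, fun j => ?_, rfl⟩, ?_⟩
      · have := ht j
        rcases eq_or_ne j i with rfl | hj
        · simp only [Function.update_self] at this ⊢
          exact ⟨this.1, by linarith [this.2]⟩
        · simpa [hj] using this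
      · rw [mem_ofPred_eq, hcoord]
        simpa using (ht i).2
  have h2 : box e (Function.update a i 2) ∩ {x | 1 ≤ innerSL ℝ (e i) x} =
      {e i} + box e (Function.update a i 1) := by
    have hsum : ∀ (t : ι → ℝ) (c : ℝ), ∑ j, (t + Pi.single i c : ι → ℝ) j • e j =
        ∑ j, t j • e j + c • e i := by
      intro t c
      simp [add_smul, Finset.sum_add_distrib, Pi.single_apply, ite_smul]
    ext x
    rw [singleton_add]
    constructor
    · rintro ⟨⟨t, ht, rfl⟩, hx⟩
      rw [mem_ofPred_eq, hcoord] at hx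
      refine ⟨_, ⟨t + Pi.single i (-1), fun j => ?_, rfl⟩, ?_⟩
      · have := ht j
        rcases eq_or_ne j i with rfl | hj
        · simp only [Function.update_self, Pi.add_apply, Pi.single_eq_same] at this ⊢
          exact ⟨by linarith, by linarith [this.2]⟩
        · simpa [hj] using this
      · simp only [hsum]
        rw [neg_one_smul]
        abel
    · rintro ⟨_, ⟨t, ht, rfl⟩, rfl⟩
      have hx : e i + ∑ j, t j • e j = ∑ j, (t + Pi.single i 1 : ι → ℝ) j • e j := by
        rw [hsum, one_smul, add_comm]
      simp only
      rw [hx]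
      refine ⟨⟨_, fun j => ?_, rfl⟩, ?_⟩
      · have := ht j
        rcases eq_or_ne j i with rfl | hj
        · simp only [Function.update_self, Pi.add_apply, Pi.single_eq_same] at this ⊢
          exact ⟨by linarith [this.1], by linarith [this.2]⟩
        · simpa [hj] using this
      · rw [mem_ofPred_eq, hcoord]
        simpa using (ht i).1
  rw [hη.cut _ (isBody_box _ _) _ hf 1, h1, h2, htr _ _ (isBody_box _ _)]
  ring

theorem IsSimple.two_smul_cube {ι : Type*} [Fintype ι] {η : Set V → ℝ}
    (hη : IsSimple η) (htr : TranslationInvariant η) {e : ι → V} (he : Orthonormal ℝ e) :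
    η ((2 : ℝ) • cube e) = 2 ^ Fintype.card ι * η (cube e) := by
  classical
  have key : ∀ s : Finset ι, η (box e fun i => if i ∈ s then 2 else 1) = 2 ^ s.card * η (cube e) := by
    intro s
    induction s using Finset.induction_on with
    | empty => simp [box, cube]
    | insert i s hi ih =>
      have e1 : (fun j => if j ∈ insert i s then (2 : ℝ) else 1) =
          Function.update (fun j => if j ∈ s then 2 else 1) i 2 := by
        ext j
        rcases eq_or_ne j i with rfl | hj
        · simp
        · simp [hj]
      have e2 : Function.update (fun j => if j ∈ s then (2 : ℝ) else 1) i 1 =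
          fun j => if j ∈ s then 2 else 1 := by
        rw [Function.update_eq_self_iff]
        simp [hi]
      rw [e1, hη.box_update htr he, e2, ih, Finset.card_insert_of_notMem hi, pow_succ]
      ring
  have := key Finset.univ
  simp only [Finset.mem_univ, if_true] at this
  rw [BodyValuation.two_smul_cube, this, Finset.card_univ]

/-- A rigid motion invariant valuation, homogeneous of degree `k`, that vanishes on the
`k`-dimensional unit cubes vanishes. -/
theorem IsBodyVal.eq_zero_of_homogeneous [FiniteDimensional ℝ V] {k : ℕ} {ρ : Set V → ℝ}
    (hρ : IsBodyVal ρ) (hrot : RotationInvariant ρ)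
    (hhom : ∀ K, IsBody K → ρ ((2 : ℝ) • K) = 2 ^ k * ρ K)
    (hcube : ∀ (ι : Type) [Fintype ι] (e : ι → V), Orthonormal ℝ e → Fintype.card ι = k →
      ρ (cube e) = 0) {K : Set V} (hK : IsBody K) : ρ K = 0 := by
  -- Vanishing in smaller dimensions makes ρ simple on `F`, so the volume theorem applies there once
  -- the `j`-cubes are handled. The summand `{0}` only serves to reuse the lemmas on orthogonal
  -- sums.
  have key : ∀ (j : ℕ) (F : Submodule ℝ V), Module.finrank ℝ F = j → ∀ A : Set F, IsBody A →
      ρ (F.subtypeL '' A + {0}) = 0 := by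
    intro j
    induction j using Nat.strong_induction_on with
    | _ j ih =>
    intro F hF A hA
    have h0 : IsBody ({0} : Set V) := isBody_singleton 0
    have h0' : ({0} : Set V) ⊆ (Fᗮ : Submodule ℝ V) := by
      rw [singleton_subset_iff]
      exact Submodule.zero_mem _
    have hval := hρ.add_orthogonal (F := F) h0 h0'
    have hsimple : VanishesOnHyperplanes fun A : Set F => ρ (F.subtypeL '' A + {0}) := by
      intro B hB f hf c hc
      rcases B.eq_empty_or_nonempty with rfl | ⟨b, hb⟩
      · exact hval.empty
      rw [← hval.trans (-b) B hB]
      have hlt : Module.finrank ℝ ((LinearMap.ker f.toLinearMap).map F.subtype) < j := by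
        rw [Submodule.finrank_map_subtype_eq, ← hF]
        refine Submodule.finrank_lt fun htop => hf ?_
        ext x
        have : x ∈ LinearMap.ker f.toLinearMap := by rw [htop]; trivial
        simpa using this
      have hB' := ((isBody_singleton (-b)).add hB).image F.subtypeL
      have hsub : F.subtypeL '' ({-b} + B) ⊆ ((LinearMap.ker f.toLinearMap).map F.subtype :
          Submodule ℝ V) := by
        rw [singleton_add]
        rintro _ ⟨_, ⟨x, hx, rfl⟩, rfl⟩
        refine ⟨-b + x, ?_, rfl⟩
        simp [hc x hx, hc b hb]
      obtain ⟨A', hA', hAA'⟩ := hB'.exists_subtype_image hsub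
      change ρ (F.subtypeL '' ({-b} + B) + {0}) = 0
      rw [← hAA']
      exact ih _ hlt _ rfl A' hA'
    refine hval.eq_zero_of_cubes j hF (hrot.add_orthogonal h0 h0') hsimple ?_ hA
    intro ι _ e he hι
    have heV : Orthonormal ℝ fun i => F.subtypeL (e i) := he.comp_linearIsometry F.subtypeₗᵢ
    by_cases hjk : j = k
    · simp only
      rw [image_cube, singleton_zero, add_zero]
      exact hcube ι _ heV (by rw [hι, hF, hjk])
    -- For `j ≠ k`, subdivision scales the value of a `j`-cube by 2^j while homogeneity scales it by
    -- 2^k, so the value is 0.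
    · have h1 := (hval.isSimple hsimple).two_smul_cube hval.trans he
      simp only [singleton_zero, add_zero, image_smul_set] at h1 ⊢
      rw [hhom _ ((isBody_cube e).image _), hι, hF] at h1
      have h2 : ((2 : ℝ) ^ k - 2 ^ j) * ρ (F.subtypeL '' cube e) = 0 := by rw [sub_mul, h1, sub_self]
      refine (mul_eq_zero.1 h2).resolve_left fun h3 => hjk ?_
      exact (pow_right_injective₀ (two_pos (α := ℝ)) (by norm_num) (sub_eq_zero.1 h3)).symm
  obtain ⟨A, hA, rfl⟩ := hK.exists_subtype_image (G := ⊤) (fun _ _ => trivial)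
  simpa using key _ ⊤ rfl A hA

end BodyValuation

/-! ### Intrinsic volumes as means of projected volumes -/

namespace QuasiConcaveVal

open BodyValuation

variable {N k : ℕ} (hk : k ≤ N)

/-- The projection `proj hk g` as a continuous linear map. -/
noncomputable def projL (g : Matrix.orthogonalGroup (Fin N) ℝ) : E N →L[ℝ] E k :=
  LinearMap.toContinuousLinearMap
    { toFun := proj hk g
      map_add' := fun x y => by
        ext i
        simp [proj, mul_add, Finset.sum_add_distrib]
      map_smul' := fun c x => by
        ext i
        simp [proj, Finset.mul_sum, mul_left_comm] }

theorem coe_projL (g : Matrix.orthogonalGroup (Fin N) ℝ) : ⇑(projL hk g) = proj hk g := rfl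

theorem continuous_proj : Continuous fun p : Matrix.orthogonalGroup (Fin N) ℝ × E N =>
    proj hk p.1 p.2 := by
  have h1 : Continuous fun p : Matrix.orthogonalGroup (Fin N) ℝ × E N => p.1.1 :=
    continuous_subtype_val.comp continuous_fst
  have h2 : Continuous fun p : Matrix.orthogonalGroup (Fin N) ℝ × E N =>
      (fun i => ∑ j, p.1.1 j (Fin.castLE hk i) * p.2 j : Fin k → ℝ) :=
    continuous_pi fun i => continuous_finsetSum _ fun j _ => (h1.matrix_elem _ _).mul (by fun_prop)
  exact (PiLp.continuous_toLp 2 _).comp h2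

/-- Converts a rotation of the body into a left translation on the group, so that Haar invariance
yields rotation invariance. -/
theorem proj_orthogonal (g R : Matrix.orthogonalGroup (Fin N) ℝ) (x : E N) :
    proj hk g (orthogonalEquiv N R x) = proj hk (R⁻¹ * g) x := by
  ext i
  simp only [proj, orthogonalEquiv_apply]
  have h : (R⁻¹ * g).1 = star R.1 * g.1 := rfl
  rw [h]
  simp only [Matrix.mul_apply, Finset.mul_sum, Finset.sum_mul, Matrix.star_apply, star_trivial]
  rw [Finset.sum_comm]
  refine Finset.sum_congr rfl fun j _ => Finset.sum_congr rfl fun l _ => ?_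
  ring

/-- The volume of a projection. -/
noncomputable def projVol (g : Matrix.orthogonalGroup (Fin N) ℝ) (K : Set (E N)) : ENNReal :=
  volume (proj hk g '' K)

theorem exists_projVol_le {K : Set (E N)} (hK : IsCompact K) :
    ∃ C : ENNReal, C ≠ ⊤ ∧ ∀ g, projVol hk g K ≤ C := by
  have hc : IsCompact ((fun p : Matrix.orthogonalGroup (Fin N) ℝ × E N => proj hk p.1 p.2) ''
      (univ ×ˢ K)) := (isCompact_univ.prod hK).image (continuous_proj hk)
  refine ⟨_, hc.measure_lt_top.ne, fun g => measure_mono ?_⟩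
  rintro _ ⟨x, hx, rfl⟩
  exact ⟨(g, x), ⟨trivial, hx⟩, rfl⟩

/-- The projections are the sections of one compact subset of the product of the group and ℝ^k. -/
theorem measurable_projVol {K : Set (E N)} (hK : IsCompact K) :
    Measurable fun g => projVol hk g K := by
  have hc : IsCompact ((fun p : Matrix.orthogonalGroup (Fin N) ℝ × E N =>
      (p.1, proj hk p.1 p.2)) '' (univ ×ˢ K)) :=
    (isCompact_univ.prod hK).image (continuous_fst.prodMk (continuous_proj hk))
  have hm := measurable_measure_prodMk_left (ν := (volume : Measure (E k))) hc.measurableSet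
  convert hm using 1
  funext g
  rw [projVol]
  congr 1
  ext y
  simp only [mem_image, mem_preimage, mem_prod, mem_univ, true_and, Prod.exists, Prod.mk.injEq]
  constructor
  · rintro ⟨x, hx, rfl⟩; exact ⟨g, x, hx, rfl, rfl⟩
  · rintro ⟨_, x, hx, rfl, rfl⟩; exact ⟨x, hx, rfl⟩

theorem lintegral_projVol_ne_top {K : Set (E N)} (hK : IsCompact K) :
    ∫⁻ g, projVol hk g K ∂(haarO N) ≠ ⊤ := by
  obtain ⟨C, hC, h⟩ := exists_projVol_le hk hK
  refine ne_top_of_le_ne_top hC ((lintegral_mono h).trans ?_)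
  simp

end QuasiConcaveVal

namespace BodyValuation

/-- A segment joining points of `K` and `L` with the same image is mapped to one point, lies in `K ∪
L`, and by connectedness meets `K ∩ L`. This makes the projected volume a valuation. -/
theorem image_inter_of_convex_union {V W : Type*} [NormedAddCommGroup V] [InnerProductSpace ℝ V]
    [NormedAddCommGroup W] [InnerProductSpace ℝ W] {K L : Set V} (hK : IsBody K) (hL : IsBody L)
    (h : Convex ℝ (K ∪ L)) (g : V →L[ℝ] W) : g '' (K ∩ L) = g '' K ∩ g '' L := by
  refine Subset.antisymm (image_inter_subset _ _ _) ?_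
  rintro _ ⟨⟨a, ha, rfl⟩, ⟨b, hb, hab⟩⟩
  have hconn : IsPreconnected (segment ℝ a b) := (convex_segment a b).isPreconnected
  obtain ⟨x, hx, hxK, hxL⟩ := isPreconnected_closed_iff.1 hconn K L hK.compact.isClosed
    hL.compact.isClosed (h.segment_subset (Or.inl ha) (Or.inr hb))
    ⟨a, left_mem_segment ℝ a b, ha⟩ ⟨b, right_mem_segment ℝ a b, hb⟩
  obtain ⟨s, t, hs, ht, hst, rfl⟩ := hx
  refine ⟨_, ⟨hxK, hxL⟩, ?_⟩
  rw [map_add, map_smul, map_smul, hab, ← add_smul, hst, one_smul]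

theorem iInter_image_of_antitone {V W : Type*} [NormedAddCommGroup V] [InnerProductSpace ℝ V]
    [NormedAddCommGroup W] [InnerProductSpace ℝ W] {K : ℕ → Set V} (hK : ∀ j, IsBody (K j))
    (hanti : Antitone K) (g : V →L[ℝ] W) : ⋂ j, g '' K j = g '' ⋂ j, K j := by
  refine Subset.antisymm ?_ (image_iInter_subset _ _)
  intro y hy
  rw [mem_iInter] at hy
  have hcl : IsClosed (g ⁻¹' {y}) := isClosed_singleton.preimage g.continuous
  have hne : (⋂ j, K j ∩ g ⁻¹' {y}).Nonempty := by
    refine IsCompact.nonempty_iInter_of_sequence_nonempty_isCompact_isClosed _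
      (fun i => inter_subset_inter_left _ (hanti (Nat.le_succ i))) (fun i => ?_)
      ((hK 0).compact.inter_right hcl) (fun i => (hK i).compact.isClosed.inter hcl)
    obtain ⟨x, hx, hxy⟩ := hy i
    exact ⟨x, hx, hxy⟩
  obtain ⟨x, hx⟩ := hne
  rw [mem_iInter] at hx
  exact ⟨x, mem_iInter.2 fun j => (hx j).1, (hx 0).2⟩

end BodyValuation

namespace QuasiConcaveVal

open BodyValuation

variable {N k : ℕ} (hk : k ≤ N)

theorem projVol_union {K L : Set (E N)} (hK : IsBody K) (hL : IsBody L) (h : Convex ℝ (K ∪ L))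
    (g : Matrix.orthogonalGroup (Fin N) ℝ) :
    projVol hk g (K ∪ L) + projVol hk g (K ∩ L) = projVol hk g K + projVol hk g L := by
  have h1 := image_inter_of_convex_union hK hL h (projL hk g)
  have h2 : MeasurableSet (projL hk g '' L) := (hL.image (projL hk g)).compact.measurableSet
  rw [coe_projL] at h1 h2
  rw [projVol, projVol, projVol, projVol, h1, image_union, measure_union_add_inter _ h2]

theorem projVol_singleton_add (v : E N) (K : Set (E N)) (g : Matrix.orthogonalGroup (Fin N) ℝ) :
    projVol hk g ({v} + K) = projVol hk g K := by
  have h := image_add (projL hk g) (s := {v}) (t := K)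
  rw [coe_projL] at h
  rw [projVol, projVol, h, image_singleton, singleton_add, image_add_left, measure_preimage_add]

theorem projVol_smul {a : ℝ} (ha : 0 ≤ a) (K : Set (E N)) (g : Matrix.orthogonalGroup (Fin N) ℝ) :
    projVol hk g (a • K) = ENNReal.ofReal (a ^ k) * projVol hk g K := by
  have h := image_smul_set (projL hk g) a K
  rw [coe_projL] at h
  rw [projVol, projVol, h, Measure.addHaar_smul, finrank_euclideanSpace_fin, abs_of_nonneg]
  positivity

theorem projVol_orthogonal (K : Set (E N)) (g R : Matrix.orthogonalGroup (Fin N) ℝ) :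
    projVol hk g (orthogonalEquiv N R '' K) = projVol hk (R⁻¹ * g) K := by
  rw [projVol, projVol, image_image]
  simp only [proj_orthogonal]

theorem tendsto_projVol {K : ℕ → Set (E N)} (hK : ∀ j, IsBody (K j)) (hanti : Antitone K)
    (g : Matrix.orthogonalGroup (Fin N) ℝ) :
    Tendsto (fun j => projVol hk g (K j)) atTop (𝓝 (projVol hk g (⋂ j, K j))) := by
  have h1 := iInter_image_of_antitone hK hanti (projL hk g)
  have h2 : ∀ j, IsCompact (projL hk g '' K j) := fun j => ((hK j).image (projL hk g)).compact
  rw [coe_projL] at h1 h2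
  rw [projVol, ← h1]
  exact tendsto_measure_iInter_atTop (fun j => (h2 j).measurableSet.nullMeasurableSet)
    (fun i j hij => image_mono (hanti hij)) ⟨0, (h2 0).measure_lt_top.ne⟩

/-- The normalization constant of the intrinsic volume. -/
noncomputable def intrinsicConst (N k : ℕ) : ℝ :=
  (N.choose k : ℝ) * kappa N / (kappa k * kappa (N - k))

theorem kappa_pos (n : ℕ) : 0 < kappa n :=
  ENNReal.toReal_pos (Metric.measure_ball_pos volume _ one_pos).ne' measure_ball_lt_top.ne

theorem intrinsicConst_pos {N k : ℕ} (hk : k ≤ N) : 0 < intrinsicConst N k := by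
  have h1 := kappa_pos N
  have h2 := kappa_pos k
  have h3 := kappa_pos (N - k)
  have h4 : (0 : ℝ) < N.choose k := by exact_mod_cast Nat.choose_pos hk
  unfold intrinsicConst
  positivity

theorem intrinsicVolume_eq (K : Set (E N)) : intrinsicVolume hk K =
    intrinsicConst N k * (∫⁻ g, projVol hk g K ∂(haarO N)).toReal := rfl

theorem intrinsicVolume_nonneg (K : Set (E N)) : 0 ≤ intrinsicVolume hk K :=
  mul_nonneg (intrinsicConst_pos hk).le ENNReal.toReal_nonneg

theorem intrinsicVolume_mono {K L : Set (E N)} (hL : IsCompact L) (h : K ⊆ L) :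
    intrinsicVolume hk K ≤ intrinsicVolume hk L := by
  refine mul_le_mul_of_nonneg_left ?_ (intrinsicConst_pos hk).le
  refine ENNReal.toReal_mono (lintegral_projVol_ne_top hk hL) (lintegral_mono fun g => ?_)
  exact measure_mono (image_mono h)

theorem isBodyVal_intrinsicVolume : IsBodyVal (intrinsicVolume hk : Set (E N) → ℝ) := by
  refine ⟨?_, fun K L hK hL h => ?_, fun v K hK => ?_, fun K hK hanti => ?_⟩
  · simp [intrinsicVolume_eq, projVol]
  · have hU : IsCompact (K ∪ L) := hK.compact.union hL.compact
    have hI : IsCompact (K ∩ L) := (hK.inter hL).compact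
    simp only [intrinsicVolume_eq]
    rw [← mul_add, ← mul_add, ← ENNReal.toReal_add (lintegral_projVol_ne_top hk hU)
      (lintegral_projVol_ne_top hk hI), ← ENNReal.toReal_add
      (lintegral_projVol_ne_top hk hK.compact) (lintegral_projVol_ne_top hk hL.compact),
      ← lintegral_add_left (measurable_projVol hk hU),
      ← lintegral_add_left (measurable_projVol hk hK.compact)]
    simp only [projVol_union hk hK hL h]
  · simp only [intrinsicVolume_eq, projVol_singleton_add]
  · simp only [intrinsicVolume_eq]
    refine Tendsto.const_mul _ ((ENNReal.tendsto_toReal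
      (lintegral_projVol_ne_top hk (IsBody.iInter hK).compact)).comp ?_)
    exact tendsto_lintegral_of_dominated_convergence (fun g => projVol hk g (K 0))
      (fun j => measurable_projVol hk (hK j).compact)
      (fun j => Eventually.of_forall fun g => measure_mono (image_mono (hanti (Nat.zero_le j))))
      (lintegral_projVol_ne_top hk (hK 0).compact)
      (Eventually.of_forall fun g => tendsto_projVol hk hK hanti g)

theorem intrinsicVolume_smul {a : ℝ} (ha : 0 ≤ a) (K : Set (E N)) :
    intrinsicVolume hk (a • K) = a ^ k * intrinsicVolume hk K := by
  simp only [intrinsicVolume_eq, projVol_smul hk ha]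
  rw [lintegral_const_mul' _ _ ENNReal.ofReal_ne_top, ENNReal.toReal_mul,
    ENNReal.toReal_ofReal (by positivity)]
  ring

theorem rotationInvariant_intrinsicVolume :
    RotationInvariant (intrinsicVolume hk : Set (E N) → ℝ) := by
  intro T K hK
  obtain ⟨R, rfl⟩ := (orthogonalEquiv N).surjective T
  simp only [intrinsicVolume_eq, projVol_orthogonal]
  rw [lintegral_mul_left_eq_self (μ := haarO N) (fun g => projVol hk g K) R⁻¹]

/-- The matrix of `t ↦ proj hk g (∑ t i • e i)`. -/
noncomputable def projMatrix (e : Fin k → E N) (g : Matrix.orthogonalGroup (Fin N) ℝ) :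
    Matrix (Fin k) (Fin k) ℝ := Matrix.of fun i j => proj hk g (e j) i

theorem proj_sum (e : Fin k → E N) (g : Matrix.orthogonalGroup (Fin N) ℝ) (t : Fin k → ℝ) :
    proj hk g (∑ j, t j • e j) = Matrix.toLpLin 2 2 (projMatrix hk e g) (WithLp.toLp 2 t) := by
  have h : proj hk g (∑ j, t j • e j) = ∑ j, t j • proj hk g (e j) := by
    simp only [← coe_projL, map_sum, map_smul]
  rw [h]
  ext i
  simp [projMatrix, Matrix.mulVec, dotProduct, mul_comm]

theorem projVol_cube_pos {e : Fin k → E N} {g : Matrix.orthogonalGroup (Fin N) ℝ}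
    (h : (projMatrix hk e g).det ≠ 0) : 0 < projVol hk g (cube e) := by
  have h1 : proj hk g '' cube e = Matrix.toLpLin 2 2 (projMatrix hk e g) ''
      (cube fun i => EuclideanSpace.single i (1 : ℝ)) := by
    have hs : ∀ t : Fin k → ℝ, ∑ i, t i • EuclideanSpace.single i (1 : ℝ) = WithLp.toLp 2 t := by
      intro t
      ext j
      simp [Pi.single_apply]
    ext y
    constructor
    · rintro ⟨_, ⟨t, ht, rfl⟩, rfl⟩
      exact ⟨_, ⟨t, ht, rfl⟩, by rw [hs, proj_sum]⟩
    · rintro ⟨_, ⟨t, ht, rfl⟩, rfl⟩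
      exact ⟨_, ⟨t, ht, rfl⟩, by rw [hs, proj_sum]⟩
  rw [projVol, h1, Measure.addHaar_image_linearMap, Matrix.toLpLin_eq_toLin,
    LinearMap.det_toLin]
  refine ENNReal.mul_pos (by simpa using h) ?_
  have hopen : IsOpen {x : E k | ∀ i, x i ∈ Ioo (0 : ℝ) 1} := by
    simp only [ofPred_forall]
    refine isOpen_iInter_of_finite fun i => ?_
    exact isOpen_Ioo.preimage (by fun_prop)
  have hne : {x : E k | ∀ i, x i ∈ Ioo (0 : ℝ) 1}.Nonempty :=
    ⟨WithLp.toLp 2 fun _ => 1 / 2, fun i => by norm_num⟩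
  have hsub : {x : E k | ∀ i, x i ∈ Ioo (0 : ℝ) 1} ⊆
      cube fun i => EuclideanSpace.single i (1 : ℝ) := by
    refine fun x hx => ⟨x, fun i => Ioo_subset_Icc_self (hx i), ?_⟩
    ext j
    simp [Pi.single_apply]
  exact ((hopen.measure_pos volume hne).trans_le (measure_mono hsub)).ne'

theorem exists_orthonormalBasis_castLE {e : Fin k → E N} (he : Orthonormal ℝ e) :
    ∃ b : OrthonormalBasis (Fin N) ℝ (E N), ∀ i : Fin k, b (Fin.castLE hk i) = e i := by
  classical
  let v : Fin N → E N := fun i => if h : (i : ℕ) < k then e ⟨i, h⟩ else 0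
  have hv : Orthonormal ℝ (({i | (i : ℕ) < k} : Set (Fin N)).domRestrict v) := by
    have : ({i | (i : ℕ) < k} : Set (Fin N)).domRestrict v =
        e ∘ fun i : ({i | (i : ℕ) < k} : Set (Fin N)) => ⟨i.1, i.2⟩ := by
      ext1 i
      have : ((i : Fin N) : ℕ) < k := i.2
      simp [v, Set.domRestrict, this]
    rw [this]
    refine he.comp _ fun i j hij => ?_
    have := congrArg Fin.val hij
    exact Subtype.ext (Fin.ext this)
  obtain ⟨b, hb⟩ := hv.exists_orthonormalBasis_extension_of_card_eq (by simp)
  refine ⟨b, fun i => ?_⟩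
  rw [hb _ (by simp)]
  simp [v]

theorem exists_projMatrix_eq_one {e : Fin k → E N} (he : Orthonormal ℝ e) :
    ∃ g, projMatrix hk e g = 1 := by
  obtain ⟨b, hbe⟩ := exists_orthonormalBasis_castLE hk he
  let M : Matrix (Fin N) (Fin N) ℝ := Matrix.of fun i j => b j i
  have hM : M ∈ Matrix.orthogonalGroup (Fin N) ℝ := by
    rw [Matrix.mem_orthogonalGroup_iff']
    ext i j
    have := orthonormal_iff_ite.1 b.orthonormal i j
    rw [PiLp.inner_apply] at this
    simp only [Matrix.mul_apply, M, Matrix.of_apply, Matrix.one_apply]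
    rw [← this]
    simp [mul_comm]
  refine ⟨⟨M, hM⟩, ?_⟩
  ext i j
  have := orthonormal_iff_ite.1 b.orthonormal (Fin.castLE hk i) (Fin.castLE hk j)
  rw [PiLp.inner_apply] at this
  simp only [projMatrix, proj, M, Matrix.of_apply, Matrix.one_apply]
  rw [← hbe j]
  simpa [mul_comm] using this

theorem cube_comp_equiv {ι κ : Type*} [Fintype ι] [Fintype κ] (e : ι → E N) (σ : κ ≃ ι) :
    cube (e ∘ σ) = cube e := by
  ext x
  constructor
  · rintro ⟨t, ht, rfl⟩
    refine ⟨t ∘ σ.symm, fun i => ht _, ?_⟩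
    rw [← σ.sum_comp]
    simp
  · rintro ⟨t, ht, rfl⟩
    exact ⟨t ∘ σ, fun i => ht _, (σ.sum_comp fun i => t i • e i).symm⟩

/-- The projection of the cube has positive volume on the open set of rotations where a determinant
is non-zero. That set is non-empty, since some rotation turns the frame into the standard one, and
Haar measure charges open sets. -/
theorem intrinsicVolume_cube_pos {ι : Type} [Fintype ι] {e : ι → E N} (he : Orthonormal ℝ e)
    (hι : Fintype.card ι = k) : 0 < intrinsicVolume hk (cube e) := by
  let σ : Fin k ≃ ι := (Fintype.equivFinOfCardEq hι).symm
  have he' : Orthonormal ℝ (e ∘ σ) := he.comp _ σ.injective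
  rw [← cube_comp_equiv e σ, intrinsicVolume_eq]
  refine mul_pos (intrinsicConst_pos hk) (ENNReal.toReal_pos ?_
    (lintegral_projVol_ne_top hk (isBody_cube _).compact))
  have hcont : Continuous fun g => (projMatrix hk (e ∘ σ) g).det := by
    refine Continuous.matrix_det (continuous_matrix fun i j => ?_)
    have hc : Continuous fun g : Matrix.orthogonalGroup (Fin N) ℝ => (g, (e ∘ σ) j) := by fun_prop
    have hp := (continuous_proj hk).comp hc
    exact (continuous_apply i).comp ((PiLp.continuous_ofLp 2 _).comp hp)
  obtain ⟨g₀, hg₀⟩ := exists_projMatrix_eq_one hk he'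
  have hopen : IsOpen {g | (projMatrix hk (e ∘ σ) g).det ≠ 0} := isOpen_ne.preimage hcont
  have hpos : 0 < haarO N {g | (projMatrix hk (e ∘ σ) g).det ≠ 0} :=
    hopen.measure_pos _ ⟨g₀, by simp [hg₀]⟩
  refine ((lintegral_pos_iff_support (measurable_projVol hk (isBody_cube _).compact)).2
    (hpos.trans_le (measure_mono fun g hg => ?_))).ne'
  exact (projVol_cube_pos hk hg).ne'

end QuasiConcaveVal

/-! ### The level measure: existence, uniqueness, distribution function -/

namespace QuasiConcaveVal

open BodyValuation

variable {N k : ℕ} (hk : k ≤ N)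

theorem isBody_levelSet (f : QC N) {t : ℝ} (ht : 0 < t) : IsBody (levelSet f t) :=
  ⟨(f.2.2 t ht).1, (f.2.2 t ht).2⟩

theorem levelSet_anti (f : E N → ℝ) {s t : ℝ} (h : s ≤ t) : levelSet f t ⊆ levelSet f s :=
  fun _ hx => h.trans hx

theorem exists_levelSet_eq_empty (f : QC N) : ∃ T : ℝ, 0 < T ∧ ∀ t, T ≤ t → levelSet f t = ∅ := by
  by_contra! h
  have h1 : ∀ n : ℕ, (levelSet f ((n : ℝ) + 1)).Nonempty := by
    intro n
    obtain ⟨t, ht, hne⟩ := h (n + 1) (by positivity)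
    exact hne.mono (levelSet_anti f ht)
  obtain ⟨x, hx⟩ := IsCompact.nonempty_iInter_of_sequence_nonempty_isCompact_isClosed
    (fun n : ℕ => levelSet f ((n : ℝ) + 1)) (fun n => levelSet_anti f (by push_cast; linarith)) h1
    (isBody_levelSet f (by positivity)).compact
    (fun n => (isBody_levelSet f (by positivity)).compact.isClosed)
  rw [mem_iInter] at hx
  obtain ⟨n, hn⟩ := exists_nat_gt (f x)
  have : (n : ℝ) + 1 ≤ f x := hx n
  linarith

/-- The function `u_k(t) = V_k(L_t(f))`. -/
noncomputable def levelVol (f : QC N) (t : ℝ) : ℝ := intrinsicVolume hk (levelSet f t)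

theorem levelVol_nonneg (f : QC N) (t : ℝ) : 0 ≤ levelVol hk f t := intrinsicVolume_nonneg hk _

theorem levelVol_anti (f : QC N) {s t : ℝ} (hs : 0 < s) (h : s ≤ t) :
    levelVol hk f t ≤ levelVol hk f s :=
  intrinsicVolume_mono hk (isBody_levelSet f hs).compact (levelSet_anti f h)

theorem levelVol_eq_zero (f : QC N) {t : ℝ} (h : levelSet f t = ∅) : levelVol hk f t = 0 := by
  rw [levelVol, h]; exact (isBodyVal_intrinsicVolume hk).empty

theorem tendsto_levelVol (f : QC N) {s : ℕ → ℝ} {t : ℝ} (hs0 : ∀ n, 0 < s n) (hs : Monotone s)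
    (hst : ∀ n, s n ≤ t) (h : Tendsto s atTop (𝓝 t)) :
    Tendsto (fun n => levelVol hk f (s n)) atTop (𝓝 (levelVol hk f t)) := by
  have h1 : ⋂ n, levelSet f (s n) = levelSet f t := by
    refine Subset.antisymm (fun x hx => ?_) (subset_iInter fun n => levelSet_anti f (hst n))
    rw [mem_iInter] at hx
    exact le_of_tendsto' h hx
  have h2 := (isBodyVal_intrinsicVolume hk).anti (fun n => levelSet f (s n))
    (fun n => isBody_levelSet f (hs0 n)) (fun i j hij => levelSet_anti f (hs hij))
  rwa [h1] at h2

/-- The Stieltjes function `s ↦ V_k(L_{e^{-s}}(f))`. -/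
noncomputable def levelStieltjes (f : QC N) : StieltjesFunction ℝ where
  toFun s := levelVol hk f (Real.exp (-s))
  mono' := fun s t hst =>
    levelVol_anti hk f (Real.exp_pos _) (Real.exp_le_exp.2 (neg_le_neg hst))
  -- The substitution t = e^{-s} reverses the order, so this is left-continuity of u_k: level sets
  -- decrease to `levelSet f t` as the level increases to `t`.
  right_continuous' := by
    intro x
    have hmono : Monotone fun s => levelVol hk f (Real.exp (-s)) := fun s t hst =>
      levelVol_anti hk f (Real.exp_pos _) (Real.exp_le_exp.2 (neg_le_neg hst))
    have hinv : Tendsto (fun n : ℕ => x + 1 / ((n : ℝ) + 1)) atTop (𝓝 (x + 0)) :=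
      tendsto_const_nhds.add tendsto_one_div_add_atTop_nhds_zero_nat
    rw [add_zero] at hinv
    have hlim : Tendsto (fun n : ℕ => levelVol hk f (Real.exp (-(x + 1 / ((n : ℝ) + 1))))) atTop
        (𝓝 (levelVol hk f (Real.exp (-x)))) := by
      refine tendsto_levelVol hk f (fun n => Real.exp_pos _) (fun i j hij => ?_) (fun n => ?_) ?_
      · have : 1 / ((j : ℝ) + 1) ≤ 1 / ((i : ℝ) + 1) :=
          one_div_le_one_div_of_le (by positivity) (by gcongr)
        exact Real.exp_le_exp.2 (by linarith)
      · have : 0 ≤ 1 / ((n : ℝ) + 1) := by positivity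
        exact Real.exp_le_exp.2 (by linarith)
      · exact (Real.continuous_exp.tendsto _).comp hinv.neg
    rw [ContinuousWithinAt, tendsto_order]
    refine ⟨fun a ha => ?_, fun a ha => ?_⟩
    · filter_upwards [self_mem_nhdsWithin] with y hy
      exact ha.trans_le (hmono hy)
    · obtain ⟨n, hn⟩ := (hlim.eventually_lt_const ha).exists
      have h1 : x < x + 1 / ((n : ℝ) + 1) := lt_add_of_pos_right x (by positivity)
      filter_upwards [nhdsWithin_le_nhds (Iio_mem_nhds h1)] with y hy
      exact (hmono (le_of_lt hy)).trans_lt hn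

/-- The measure with distribution function `V_k(L_t(f))`. -/
noncomputable def stieltjesLevelMeasure (f : QC N) : Measure ℝ :=
  (levelStieltjes hk f).measure.map fun s => Real.exp (-s)

theorem stieltjesLevelMeasure_Ici (f : QC N) {t : ℝ} (ht : 0 < t) :
    stieltjesLevelMeasure hk f (Ici t) = ENNReal.ofReal (levelVol hk f t) := by
  rw [stieltjesLevelMeasure, Measure.map_apply (by fun_prop) measurableSet_Ici]
  have h1 : (fun s => Real.exp (-s)) ⁻¹' Ici t = Iic (-Real.log t) := by
    ext s
    rw [mem_preimage, mem_Ici, mem_Iic, ← Real.log_le_iff_le_exp ht]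
    exact le_neg
  have h2 : Tendsto (levelStieltjes hk f) atBot (𝓝 0) := by
    obtain ⟨T, hT0, hT⟩ := exists_levelSet_eq_empty f
    refine tendsto_const_nhds.congr' ?_
    filter_upwards [eventually_le_atBot (-Real.log T)] with s hs
    refine (levelVol_eq_zero hk f (hT _ ?_)).symm
    rw [← Real.log_le_iff_le_exp hT0]
    linarith
  rw [h1, StieltjesFunction.measure_Iic _ h2, sub_zero]
  change ENNReal.ofReal (levelVol hk f (Real.exp (- -Real.log t))) = _
  rw [neg_neg, Real.exp_log ht]

theorem stieltjesLevelMeasure_Iic (f : QC N) : stieltjesLevelMeasure hk f (Iic 0) = 0 := by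
  rw [stieltjesLevelMeasure, Measure.map_apply (by fun_prop) measurableSet_Iic]
  have h1 : (fun s => Real.exp (-s)) ⁻¹' Iic 0 = ∅ := by
    ext s
    simp [Real.exp_pos]
  rw [h1, measure_empty]

theorem exists_Ioo_of_compact {K : Set ℝ} (hK : IsCompact K) (h : K ⊆ Ioi 0) :
    ∃ a b : ℝ, 0 < a ∧ a < b ∧ K ⊆ Ioo a b := by
  rcases K.eq_empty_or_nonempty with rfl | hne
  · exact ⟨1, 2, by norm_num, by norm_num, empty_subset _⟩
  obtain ⟨m, hm, hmK⟩ := hK.exists_isLeast hne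
  obtain ⟨M, hM, hMK⟩ := hK.exists_isGreatest hne
  have hm0 : 0 < m := h hm
  have hmM : m ≤ M := hmK hM
  refine ⟨m / 2, M + 1, by positivity, by linarith, fun x hx => ⟨?_, ?_⟩⟩
  · linarith [hmK hx]
  · linarith [hMK hx]

/-- The defining properties of the level measure follow from its distribution function. -/
theorem isLevelMeasure_of_Ici {f : QC N} {S : Measure ℝ} (h0 : S (Iic 0) = 0)
    (hS : ∀ t, 0 < t → S (Ici t) = ENNReal.ofReal (levelVol hk f t)) : IsLevelMeasure hk f S := by
  refine ⟨h0, fun K hK hK0 => ?_, fun ψ hψ hψc hψ0 => ?_⟩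
  · obtain ⟨a, b, ha, _, hab⟩ := exists_Ioo_of_compact hK hK0
    refine (measure_mono (hab.trans fun x hx => (mem_Ici.2 hx.1.le))).trans_lt ?_
    rw [hS a ha]
    exact ENNReal.ofReal_lt_top
  obtain ⟨a, b, ha, hab, hsub⟩ := exists_Ioo_of_compact hψc hψ0
  have hfin : IsFiniteMeasure (S.restrict (Ici a)) :=
    ⟨by rw [Measure.restrict_apply_univ, hS a ha]; exact ENNReal.ofReal_lt_top⟩
  have hψz : ∀ x, x ∉ Ioo a b → ψ x = 0 := fun x hx => image_eq_zero_of_notMem_tsupport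
    fun hx' => hx (hsub hx')
  have hdz : ∀ x, x ∉ Ioo a b → deriv ψ x = 0 := fun x hx => by
    by_contra h
    exact hx (hsub (support_deriv_subset h))
  have hdc : Continuous (deriv ψ) := hψ.continuous_deriv (by simp)
  have hdiff : Differentiable ℝ ψ := hψ.differentiable (by simp)
  -- The claim is Fubini for ψ'(t)·1_{t ≤ x}: integrating in `t` gives ψ(x), integrating in `x`
  -- gives ψ'(t)·S([t, ∞)).
  have hcut : ∀ x, a ≤ x → ∫ t in Icc a b, deriv ψ t * (Iic x).indicator 1 t = ψ x := by
    intro x hx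
    have e1 : ∀ t, deriv ψ t * (Iic x).indicator 1 t = (Iic x).indicator (deriv ψ) t := by
      intro t
      by_cases ht : t ∈ Iic x <;> simp [ht]
    simp only [e1]
    rw [setIntegral_indicator measurableSet_Iic]
    have e2 : Icc a b ∩ Iic x = Icc a (min b x) := by
      ext t; simp only [mem_inter_iff, mem_Icc, mem_Iic, le_min_iff]; tauto
    rw [e2, integral_Icc_eq_integral_Ioc, ← intervalIntegral.integral_of_le (le_min hab.le hx),
      intervalIntegral.integral_deriv_eq_sub (fun y _ => hdiff y) (hdc.intervalIntegrable _ _),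
      hψz a (by simp), sub_zero]
    rcases le_total b x with h | h
    · rw [min_eq_left h, hψz b (by simp), hψz x (by simp [h])]
    · rw [min_eq_right h]
  have hu : ∀ t, a ≤ t → ∫ x in Ici a, (Iic x).indicator (1 : ℝ → ℝ) t ∂S = levelVol hk f t := by
    intro t ht
    have e1 : ∀ x, (Iic x).indicator (1 : ℝ → ℝ) t = (Ici t).indicator 1 x := by
      intro x
      simp only [indicator_apply, mem_Iic, mem_Ici, Pi.one_apply]
    simp only [e1]
    rw [integral_indicator_one measurableSet_Ici, measureReal_restrict_apply measurableSet_Ici,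
      Ici_inter_Ici, max_eq_left ht, Measure.real, hS t (ha.trans_le ht),
      ENNReal.toReal_ofReal (levelVol_nonneg hk f t)]
  have hL : ∫ t in Ioi (0 : ℝ), deriv ψ t * intrinsicVolume hk (levelSet f t) =
      ∫ t in Icc a b, ∫ x in Ici a, deriv ψ t * (Iic x).indicator 1 t ∂S := by
    have e1 : ∫ t in Ioi (0 : ℝ), deriv ψ t * intrinsicVolume hk (levelSet f t) =
        ∫ t in Icc a b, deriv ψ t * intrinsicVolume hk (levelSet f t) := by
      refine setIntegral_eq_of_subset_of_forall_sdiff_eq_zero measurableSet_Ioi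
        (fun t ht => ha.trans_le ht.1) fun t ht => ?_
      rw [hdz t fun h => ht.2 (Ioo_subset_Icc_self h), zero_mul]
    rw [e1]
    refine setIntegral_congr_fun measurableSet_Icc fun t ht => ?_
    rw [integral_const_mul, hu t ht.1]
    rfl
  have hR : ∫ t in Ioi (0 : ℝ), ψ t ∂S =
      ∫ x in Ici a, (∫ t in Icc a b, deriv ψ t * (Iic x).indicator 1 t) ∂S := by
    have e1 : ∫ t in Ioi (0 : ℝ), ψ t ∂S = ∫ t in Ici a, ψ t ∂S :=
      setIntegral_eq_of_subset_of_forall_sdiff_eq_zero measurableSet_Ioi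
        (fun t ht => ha.trans_le ht) fun t ht => hψz t fun h => ht.2 h.1.le
    rw [e1]
    exact setIntegral_congr_fun measurableSet_Ici fun x hx => (hcut x hx).symm
  rw [hL, hR]
  refine integral_integral_swap ?_
  obtain ⟨C, hC⟩ := hdc.bounded_above_of_compact_support hψc.deriv
  have hmeas : Measurable (Function.uncurry fun t x : ℝ => deriv ψ t * (Iic x).indicator 1 t) := by
    have e1 : (Function.uncurry fun t x : ℝ => deriv ψ t * (Iic x).indicator (1 : ℝ → ℝ) t) =
        fun p => deriv ψ p.1 * {p : ℝ × ℝ | p.1 ≤ p.2}.indicator 1 p := by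
      ext ⟨t, x⟩
      simp [Function.uncurry, indicator_apply]
    rw [e1]
    exact (hdc.measurable.comp measurable_fst).mul
      (measurable_one.indicator (measurableSet_le measurable_fst measurable_snd))
  refine (integrable_const C).mono' hmeas.aestronglyMeasurable (Eventually.of_forall ?_)
  rintro ⟨t, x⟩
  simp only [Function.uncurry, norm_mul]
  calc ‖deriv ψ t‖ * ‖(Iic x).indicator (1 : ℝ → ℝ) t‖ ≤ ‖deriv ψ t‖ * 1 := by
        refine mul_le_mul_of_nonneg_left ?_ (norm_nonneg _)
        rw [indicator_apply]
        split_ifs <;> simp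
    _ ≤ C := by rw [mul_one]; exact hC t

theorem IsLevelMeasure.measure_Ioo_eq {f : QC N} {S S' : Measure ℝ} (hS : IsLevelMeasure hk f S)
    (hS' : IsLevelMeasure hk f S') {a : ℝ} (b : ℝ) (ha : 0 < a) : S (Ioo a b) = S' (Ioo a b) := by
  obtain ⟨g, hg, hgc, hg01⟩ := (isOpen_Ioo (a := a) (b := b)).exists_contDiff_support_eq (n := ⊤)
  -- Since `g` is positive exactly on the interval, these test functions converge pointwise to its
  -- indicator.
  let ψ : ℕ → ℝ → ℝ := fun n x => Real.smoothTransition (n * g x)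
  have hψ : ∀ n, ContDiff ℝ ∞ (ψ n) := fun n =>
    Real.smoothTransition.contDiff.comp (contDiff_const.mul hgc)
  have hψz : ∀ n x, x ∉ Ioo a b → ψ n x = 0 := by
    intro n x hx
    rw [← hg, Function.notMem_support] at hx
    simp [ψ, hx, Real.smoothTransition.zero]
  have hsupp : ∀ n, tsupport (ψ n) ⊆ Icc a b := fun n =>
    closure_minimal (fun x hx => by
      by_contra h
      exact hx (hψz n x fun h' => h (Ioo_subset_Icc_self h'))) isClosed_Icc
  have hsub0 : Icc a b ⊆ Ioi 0 := fun x hx => ha.trans_le hx.1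
  have hlim : ∀ {S : Measure ℝ}, IsLevelMeasure hk f S →
      Tendsto (fun n => ∫ t in Ioi (0 : ℝ), ψ n t ∂S) atTop (𝓝 (S.real (Ioo a b))) := by
    intro S hS
    have hfin : S (Icc a b) < ⊤ := hS.finite _ isCompact_Icc hsub0
    have e1 : S.real (Ioo a b) = ∫ t in Ioi (0 : ℝ), (Ioo a b).indicator 1 t ∂S := by
      rw [integral_indicator_one measurableSet_Ioo, measureReal_restrict_apply measurableSet_Ioo,
        inter_eq_left.2 (Ioo_subset_Icc_self.trans hsub0)]
    rw [e1]
    refine tendsto_integral_of_dominated_convergence ((Icc a b).indicator 1)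
      (fun n => (hψ n).continuous.aestronglyMeasurable) ?_ (fun n => Eventually.of_forall fun x => ?_)
      (Eventually.of_forall fun x => ?_)
    · refine Integrable.mono_measure ?_ Measure.restrict_le_self
      rw [integrable_indicator_iff measurableSet_Icc]
      exact integrableOn_const hfin.ne
    · by_cases hx : x ∈ Ioo a b
      · rw [indicator_of_mem (Ioo_subset_Icc_self hx), Real.norm_of_nonneg
          (Real.smoothTransition.nonneg _)]
        exact Real.smoothTransition.le_one _
      · rw [hψz n x hx, norm_zero]
        exact indicator_nonneg (fun _ _ => zero_le_one) _
    · by_cases hx : x ∈ Ioo a b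
      · rw [indicator_of_mem hx]
        have hgx : 0 < g x := by
          refine lt_of_le_of_ne (hg01 (mem_range_self x)).1 (Ne.symm ?_)
          rwa [← Function.mem_support, hg]
        refine tendsto_const_nhds.congr' ?_
        obtain ⟨n, hn⟩ := exists_nat_gt (1 / g x)
        filter_upwards [eventually_ge_atTop n] with m hm
        symm
        refine Real.smoothTransition.one_of_one_le ?_
        rw [div_lt_iff₀ hgx] at hn
        refine hn.le.trans ?_
        have : (n : ℝ) ≤ m := by exact_mod_cast hm
        exact mul_le_mul_of_nonneg_right this hgx.le
      · rw [indicator_of_notMem hx]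
        simp only [hψz _ x hx]
        exact tendsto_const_nhds
  have heq : S.real (Ioo a b) = S'.real (Ioo a b) := by
    refine tendsto_nhds_unique (hlim hS) ((hlim hS').congr fun n => ?_)
    have hc : HasCompactSupport (ψ n) := isCompact_Icc.of_isClosed_subset (isClosed_tsupport _) (hsupp n)
    rw [← hS.deriv_eq _ (hψ n) hc ((hsupp n).trans hsub0),
      ← hS'.deriv_eq _ (hψ n) hc ((hsupp n).trans hsub0)]
  refine (ENNReal.toReal_eq_toReal_iff' ?_ ?_).1 heq
  · exact ((measure_mono Ioo_subset_Icc_self).trans_lt (hS.finite _ isCompact_Icc hsub0)).ne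
  · exact ((measure_mono Ioo_subset_Icc_self).trans_lt (hS'.finite _ isCompact_Icc hsub0)).ne

/-- The measures may have infinite mass near 0, so they are compared on the rays (1/(n+1), ∞), where
they are locally finite, and then on the union. -/
theorem IsLevelMeasure.unique {f : QC N} {S S' : Measure ℝ} (hS : IsLevelMeasure hk f S)
    (hS' : IsLevelMeasure hk f S') : S = S' := by
  have h1 : ∀ n : ℕ, S.restrict (Ioi (1 / ((n : ℝ) + 1))) = S'.restrict (Ioi (1 / ((n : ℝ) + 1))) := by
    intro n
    set ε : ℝ := 1 / ((n : ℝ) + 1) with hε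
    have hε0 : 0 < ε := by positivity
    have : IsLocallyFiniteMeasure (S.restrict (Ioi ε)) := by
      refine ⟨fun x => ⟨Iio (x + 1), Iio_mem_nhds (by linarith), ?_⟩⟩
      rw [Measure.restrict_apply measurableSet_Iio]
      refine (measure_mono ?_).trans_lt
        (hS.finite (Icc ε (x + 1)) isCompact_Icc fun y hy => hε0.trans_le hy.1)
      rintro y ⟨hy1, hy2⟩
      exact ⟨le_of_lt hy2, le_of_lt hy1⟩
    refine Real.measure_ext_Ioo_rat fun p q => ?_
    rw [Measure.restrict_apply measurableSet_Ioo, Measure.restrict_apply measurableSet_Ioo,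
      Ioo_inter_Ioi]
    exact hS.measure_Ioo_eq hk hS' _ (hε0.trans_le (le_max_right _ _))
  have h2 : ⋃ n : ℕ, Ioi (1 / ((n : ℝ) + 1)) = Ioi (0 : ℝ) := by
    ext x
    rw [mem_iUnion]
    constructor
    · rintro ⟨n, hn⟩
      have h0 : (0 : ℝ) < 1 / ((n : ℝ) + 1) := by positivity
      exact mem_Ioi.2 (h0.trans hn)
    · intro hx
      exact exists_nat_one_div_lt (mem_Ioi.1 hx)
  have h3 := Measure.restrict_iUnion_congr.2 h1
  rw [h2] at h3
  have h4 : ∀ {S : Measure ℝ}, IsLevelMeasure hk f S → S.restrict (Ioi 0) = S := by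
    intro S hS
    refine Measure.restrict_eq_self_of_ae_mem ?_
    rw [ae_iff]
    convert hS.null using 2
    ext x
    simp
  rw [← h4 hS, h3, h4 hS']

theorem levelMeasure_eq (f : QC N) : levelMeasure hk f = stieltjesLevelMeasure hk f := by
  have h : IsLevelMeasure hk f (stieltjesLevelMeasure hk f) :=
    isLevelMeasure_of_Ici hk (stieltjesLevelMeasure_Iic hk f)
      fun t ht => stieltjesLevelMeasure_Ici hk f ht
  exact (Classical.epsilon_spec (p := IsLevelMeasure hk f) ⟨_, h⟩).unique hk h

theorem levelMeasure_Ici (f : QC N) {t : ℝ} (ht : 0 < t) :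
    levelMeasure hk f (Ici t) = ENNReal.ofReal (levelVol hk f t) := by
  rw [levelMeasure_eq, stieltjesLevelMeasure_Ici hk f ht]

end QuasiConcaveVal

/-! ### Step functions, the density φ, and staircases -/

namespace QuasiConcaveVal

open BodyValuation

variable {N k : ℕ}

theorem isQC_indicator {K : Set (E N)} (hK : IsBody K) {t : ℝ} (ht : 0 ≤ t) :
    IsQC (K.indicator fun _ => t) := by
  refine ⟨fun x => indicator_nonneg (fun _ _ => ht) x, fun s hs => ?_⟩
  by_cases h : s ≤ t
  · have e : levelSet (K.indicator fun _ => t) s = K := by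
      ext x
      by_cases hx : x ∈ K <;> simp [levelSet, hx, h, hs]
    rw [e]; exact ⟨hK.compact, hK.convex⟩
  · have e : levelSet (K.indicator fun _ => t) s = ∅ := by
      ext x
      by_cases hx : x ∈ K <;> simp [levelSet, hx, h, hs]
    rw [e]; exact ⟨isCompact_empty, convex_empty⟩

open Classical in
/-- The function with value `max t 0` on the body `K` and `0` elsewhere. -/
noncomputable def step (t : ℝ) (K : Set (E N)) : QC N :=
  if h : IsBody K then ⟨_, isQC_indicator h (le_max_right t 0)⟩ else QC.zero N

theorem coe_step (t : ℝ) {K : Set (E N)} (hK : IsBody K) :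
    (step t K : E N → ℝ) = K.indicator fun _ => max t 0 := by
  rw [step, dif_pos hK]

theorem step_apply (t : ℝ) {K : Set (E N)} (hK : IsBody K) (x : E N) [Decidable (x ∈ K)] :
    (step t K : E N → ℝ) x = if x ∈ K then max t 0 else 0 := by
  rw [coe_step t hK, indicator_apply]

theorem step_of_nonpos {t : ℝ} (ht : t ≤ 0) (K : Set (E N)) : step t K = QC.zero N := by
  classical
  by_cases hK : IsBody K
  · refine Subtype.ext (funext fun x => ?_)
    rw [step_apply t hK, max_eq_right ht, ite_self]
    rfl
  · rw [step, dif_neg hK]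

theorem step_empty (t : ℝ) : step t (∅ : Set (E N)) = QC.zero N := by
  refine Subtype.ext ?_
  rw [coe_step t isBody_empty, indicator_empty]
  rfl

/-- Maxima and minima of steps of one height correspond to unions and intersections, and decreasing
bodies to pointwise decreasing functions. -/
theorem isBodyVal_step {μ : QC N → ℝ} (hμ : IsVal k μ) (t : ℝ) :
    IsBodyVal fun K : Set (E N) => μ (step t K) := by
  classical
  refine ⟨?_, fun K L hK hL hKL => ?_, fun v K hK => ?_, fun K hK hanti => ?_⟩
  · rw [step_empty]; exact hμ.valuation.1
  · have hU : IsBody (K ∪ L) := ⟨hK.compact.union hL.compact, hKL⟩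
    have e1 : (step t (K ∪ L) : E N → ℝ) = fun x => max ((step t K).1 x) ((step t L).1 x) := by
      ext x
      rw [step_apply t hU, step_apply t hK, step_apply t hL]
      by_cases h1 : x ∈ K <;> by_cases h2 : x ∈ L <;> simp [h1, h2]
    have hq : IsQC fun x => max ((step t K).1 x) ((step t L).1 x) := e1 ▸ (step t (K ∪ L)).2
    have e2 : step t (K ∩ L) = QC.inf (step t K) (step t L) := by
      refine Subtype.ext (funext fun x => ?_)
      change _ = min ((step t K).1 x) ((step t L).1 x)
      rw [step_apply t (hK.inter hL), step_apply t hK, step_apply t hL]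
      by_cases h1 : x ∈ K <;> by_cases h2 : x ∈ L <;> simp [h1, h2]
    have e3 : step t (K ∪ L) = ⟨_, hq⟩ := Subtype.ext e1
    change μ (step t (K ∪ L)) + μ (step t (K ∩ L)) = μ (step t K) + μ (step t L)
    rw [e2, e3, hμ.valuation.2 _ _ hq]
  · have hvK : IsBody ({v} + K) := (isBody_singleton v).add hK
    have e : step t ({v} + K) = (step t K).translate (-v) := by
      refine Subtype.ext (funext fun x => ?_)
      change _ = (step t K).1 (x + -v)
      rw [step_apply t hvK, step_apply t hK]
      refine if_congr ?_ rfl rfl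
      rw [singleton_add, mem_image]
      constructor
      · rintro ⟨y, hy, rfl⟩
        simpa using hy
      · intro h
        exact ⟨_, h, by abel⟩
    change μ (step t ({v} + K)) = _
    rw [e, hμ.translation]
  · have hI : IsBody (⋂ j, K j) := IsBody.iInter hK
    refine hμ.continuous _ _ (fun x => ?_) (Or.inr fun x i j hij => ?_)
    · simp only [step_apply t (hK _), step_apply t hI]
      by_cases hx : x ∈ ⋂ j, K j
      · rw [if_pos hx]
        refine tendsto_const_nhds.congr fun j => ?_
        rw [if_pos (mem_iInter.1 hx j)]
      · rw [if_neg hx]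
        rw [mem_iInter, not_forall] at hx
        obtain ⟨i, hi⟩ := hx
        refine tendsto_const_nhds.congr' ?_
        filter_upwards [eventually_ge_atTop i] with j hj
        rw [if_neg fun h => hi (hanti hj h)]
    · simp only [step_apply t (hK _)]
      by_cases hx : x ∈ K j
      · rw [if_pos hx, if_pos (hanti hij hx)]
      · rw [if_neg hx]
        split_ifs
        exacts [le_max_right _ _, le_rfl]

theorem rotationInvariant_step {μ : QC N → ℝ} (hrot : IsRotationInvariant μ) (t : ℝ) :
    RotationInvariant fun K : Set (E N) => μ (step t K) := by
  classical
  intro g K hK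
  have e : step t (g '' K) = (step t K).rotate g.symm := by
    refine Subtype.ext (funext fun x => ?_)
    change _ = (step t K).1 (g.symm x)
    rw [step_apply t (hK.image_isometry g), step_apply t hK]
    refine if_congr ?_ rfl rfl
    constructor
    · rintro ⟨y, hy, rfl⟩
      simpa using hy
    · intro h
      exact ⟨_, h, by simp⟩
  change μ (step t (g '' K)) = _
  rw [e, hrot]

theorem step_smul {μ : QC N → ℝ} (hμ : IsVal k μ) (t : ℝ) {l : ℝ} (hl : 0 < l) {K : Set (E N)}
    (hK : IsBody K) : μ (step t (l • K)) = l ^ k * μ (step t K) := by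
  classical
  have e : step t (l • K) = (step t K).dilate l hl := by
    refine Subtype.ext (funext fun x => ?_)
    change _ = (step t K).1 (l⁻¹ • x)
    rw [step_apply t (hK.smul l), step_apply t hK]
    exact if_congr (mem_smul_set_iff_inv_smul_mem₀ hl.ne' _ _) rfl rfl
  rw [e, hμ.homogeneous]

/-- The first `k` standard basis vectors. -/
noncomputable def stdFrame (hk : k ≤ N) (i : Fin k) : E N := EuclideanSpace.basisFun (Fin N) ℝ (Fin.castLE hk i)

theorem orthonormal_stdFrame (hk : k ≤ N) : Orthonormal ℝ (stdFrame hk) :=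
  (EuclideanSpace.basisFun (Fin N) ℝ).orthonormal.comp _ (Fin.castLE_injective hk)

theorem exists_isometry_cube_eq (hk : k ≤ N) {ι : Type} [Fintype ι] {e : ι → E N}
    (he : Orthonormal ℝ e) (hι : Fintype.card ι = k) :
    ∃ R : E N ≃ₗᵢ[ℝ] E N, cube e = R '' cube (stdFrame hk) := by
  let σ : Fin k ≃ ι := (Fintype.equivFinOfCardEq hι).symm
  obtain ⟨b, hb⟩ := exists_orthonormalBasis_castLE hk (he.comp _ σ.injective)
  let R := (EuclideanSpace.basisFun (Fin N) ℝ).equiv b (Equiv.refl _)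
  refine ⟨R, ?_⟩
  rw [← cube_comp_equiv e σ]
  refine Eq.trans ?_ (image_cube R.toContinuousLinearEquiv.toContinuousLinearMap _).symm
  congr 1
  ext1 i
  rw [← hb i]
  symm
  exact (EuclideanSpace.basisFun (Fin N) ℝ).equiv_apply_basis b (Equiv.refl _) _

/-- The function `φ` with `μ(t 1_K) = φ(t) V_k(K)`. -/
noncomputable def density (hk : k ≤ N) (μ : QC N → ℝ) (t : ℝ) : ℝ :=
  μ (step t (cube (stdFrame hk))) / intrinsicVolume hk (cube (stdFrame hk))

theorem intrinsicVolume_cube_stdFrame_pos (hk : k ≤ N) :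
    0 < intrinsicVolume hk (cube (stdFrame hk)) :=
  intrinsicVolume_cube_pos hk (orthonormal_stdFrame hk) (Fintype.card_fin k)

theorem IsVal.step_eq (hk : k ≤ N) {μ : QC N → ℝ} (hμ : IsVal k μ) (hrot : IsRotationInvariant μ)
    (t : ℝ) {K : Set (E N)} (hK : IsBody K) :
    μ (step t K) = density hk μ t * intrinsicVolume hk K := by
  set C : Set (E N) := cube (stdFrame hk)
  set c : ℝ := intrinsicVolume hk C
  have hc : 0 < c := intrinsicVolume_cube_stdFrame_pos hk
  have hC : IsBody C := isBody_cube _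
  have h1 := isBodyVal_step hμ t
  have h2 := isBodyVal_intrinsicVolume (N := N) hk
  have r1 := rotationInvariant_step hrot t
  have r2 := rotationInvariant_intrinsicVolume (N := N) hk
  -- Chosen to vanish on `C`, hence on every `k`-dimensional unit cube by rotation invariance.
  set ρ : Set (E N) → ℝ := fun K => c * μ (step t K) - μ (step t C) * intrinsicVolume hk K with hρ
  have hρV : IsBodyVal ρ := by
    refine ⟨by simp only [hρ]; rw [h1.empty, h2.empty]; ring, fun K L hK hL hKL => ?_,
      fun v K hK => ?_, fun K hK hanti => ?_⟩
    · simp only [hρ]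
      linear_combination c * h1.union K L hK hL hKL - μ (step t C) * h2.union K L hK hL hKL
    · simp only [hρ]
      linear_combination c * h1.trans v K hK - μ (step t C) * h2.trans v K hK
    · exact ((h1.anti K hK hanti).const_mul c).sub ((h2.anti K hK hanti).const_mul _)
  have hρr : RotationInvariant ρ := by
    intro g K hK
    simp only [hρ]
    linear_combination c * r1 g K hK - μ (step t C) * r2 g K hK
  have hzero : ρ K = 0 := by
    refine hρV.eq_zero_of_homogeneous (k := k) hρr (fun K hK => ?_) (fun ι _ e he hι => ?_) hK
    · simp only [hρ]
      rw [step_smul hμ t two_pos hK, intrinsicVolume_smul hk zero_le_two]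
      ring
    · obtain ⟨R, hR⟩ := exists_isometry_cube_eq hk he hι
      rw [hR, hρr R C hC]
      simp only [hρ]
      exact sub_eq_zero.2 (mul_comm _ _)
  simp only [hρ] at hzero
  rw [density, div_mul_eq_mul_div, eq_div_iff hc.ne']
  linarith

theorem density_of_nonpos (hk : k ≤ N) {μ : QC N → ℝ} (hμ : IsVal k μ) {t : ℝ} (ht : t ≤ 0) :
    density hk μ t = 0 := by
  rw [density, step_of_nonpos ht, hμ.valuation.1, zero_div]

theorem exists_monotone_or_antitone_subseq (u : ℕ → ℝ) :
    ∃ g : ℕ → ℕ, StrictMono g ∧ (Monotone (u ∘ g) ∨ Antitone (u ∘ g)) := by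
  obtain ⟨g, hg⟩ := exists_increasing_or_nonincreasing_subseq (· ≤ ·) u
  refine ⟨g, g.strictMono, hg.imp (fun h m n hmn => ?_) fun h m n hmn => ?_⟩
  · rcases hmn.eq_or_lt with rfl | hlt
    exacts [le_rfl, h m n hlt]
  · rcases hmn.eq_or_lt with rfl | hlt
    exacts [le_rfl, (not_le.1 (h m n hlt)).le]

/-- Continuity of μ is available only along monotone sequences; every convergent sequence of heights
has a subsequence with a monotone sub-subsequence, and this suffices. -/
theorem continuous_density (hk : k ≤ N) {μ : QC N → ℝ} (hμ : IsVal k μ) :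
    Continuous (density hk μ) := by
  classical
  refine Continuous.div_const ?_ _
  rw [continuous_iff_continuousAt]
  intro t
  refine tendsto_of_seq_tendsto fun s hs => tendsto_of_subseq_tendsto fun ns hns => ?_
  obtain ⟨g, hg, hmono⟩ := exists_monotone_or_antitone_subseq (s ∘ ns)
  refine ⟨g, ?_⟩
  have hlim : Tendsto (fun n => s (ns (g n))) atTop (𝓝 t) :=
    hs.comp (hns.comp hg.tendsto_atTop)
  have hC : IsBody (cube (stdFrame hk)) := isBody_cube _
  refine hμ.continuous (fun n => step (s (ns (g n))) _) _ (fun x => ?_) ?_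
  · simp only [step_apply _ hC]
    split_ifs
    · exact hlim.max tendsto_const_nhds
    · exact tendsto_const_nhds
  · refine hmono.imp (fun h x i j hij => ?_) fun h x i j hij => ?_ <;>
    · simp only [step_apply _ hC]
      split_ifs
      · exact max_le_max (h hij) le_rfl
      · exact le_rfl

/-- The staircase function `x ↦ max_{j ≤ n} t_j 1_{K_j}(x)`. -/
noncomputable def stair (t : ℕ → ℝ) (K : ℕ → Set (E N)) : ℕ → E N → ℝ
  | 0 => (K 0).indicator fun _ => t 0
  | n + 1 => fun x => max (stair t K n x) ((K (n + 1)).indicator (fun _ => t (n + 1)) x)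

section Stair

variable {t : ℕ → ℝ} {K : ℕ → Set (E N)}

theorem stair_nonneg (ht0 : ∀ n, 0 ≤ t n) (n : ℕ) (x : E N) : 0 ≤ stair t K n x := by
  induction n with
  | zero => exact indicator_nonneg (fun _ _ => ht0 0) x
  | succ n ih => exact ih.trans (le_max_left _ _)

theorem monotone_stair (x : E N) : Monotone fun n => stair t K n x :=
  monotone_nat_of_le_succ fun _ => le_max_left _ _

theorem le_stair {n j : ℕ} (hj : j ≤ n) {x : E N} (hx : x ∈ K j) : t j ≤ stair t K n x := by
  refine le_trans ?_ (monotone_stair x hj)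
  cases j with
  | zero => simp [stair, hx]
  | succ j => simp [stair, hx]

theorem stair_le {n : ℕ} {c : ℝ} (hc : 0 ≤ c) {x : E N} (h : ∀ j ≤ n, x ∈ K j → t j ≤ c) :
    stair t K n x ≤ c := by
  have h1 : ∀ j ≤ n, (K j).indicator (fun _ => t j) x ≤ c := fun j hj => by
    by_cases hx : x ∈ K j
    · rw [indicator_of_mem hx]; exact h j hj hx
    · rwa [indicator_of_notMem hx]
  induction n with
  | zero => exact h1 0 le_rfl
  | succ n ih =>
    exact max_le (ih (fun j hj => h j (hj.trans n.le_succ)) fun j hj => h1 j (hj.trans n.le_succ))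
      (h1 _ le_rfl)

theorem stair_of_notMem (ht0 : ∀ n, 0 ≤ t n) (hK : Monotone K) {n : ℕ} {x : E N} (hx : x ∉ K n) :
    stair t K n x = 0 :=
  le_antisymm (stair_le le_rfl fun _ hj h => absurd (hK hj h) hx) (stair_nonneg ht0 n x)

theorem isQC_stair (ht0 : ∀ n, 0 ≤ t n) (hK : Monotone K) {n : ℕ}
    (hKb : ∀ j ≤ n, IsBody (K j)) : IsQC (stair t K n) := by
  induction n with
  | zero => exact isQC_indicator (hKb 0 le_rfl) (ht0 0)
  | succ n ih =>
    refine ⟨fun x => stair_nonneg ht0 _ x, fun s hs => ?_⟩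
    by_cases h : s ≤ t (n + 1)
    · have e : levelSet (stair t K (n + 1)) s = K (n + 1) := by
        ext x
        refine ⟨fun hx => ?_, fun hx => h.trans (le_stair le_rfl hx)⟩
        by_contra hx'
        have : s ≤ stair t K (n + 1) x := hx
        rw [stair_of_notMem ht0 hK hx'] at this
        linarith
      rw [e]
      exact ⟨(hKb _ le_rfl).compact, (hKb _ le_rfl).convex⟩
    · have e : levelSet (stair t K (n + 1)) s = levelSet (stair t K n) s := by
        ext x
        change s ≤ max _ _ ↔ s ≤ _
        rw [le_max_iff, or_iff_left]
        rw [not_le] at h ⊢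
        exact (indicator_le' (f := fun _ => t (n + 1)) (g := fun _ => t (n + 1))
          (fun _ _ => le_rfl) (fun _ _ => ht0 _) x).trans_lt h
      rw [e]
      exact (ih fun j hj => hKb j (hj.trans n.le_succ)).2 s hs

/-- The next staircase is the maximum with the step on the larger body `K (n + 1)` at the lower
height `t (n + 1)`. The minimum is the step of that height on `K n`, because the staircase is at
least `t n` there and 0 elsewhere. -/
theorem IsVal.stair_succ (hk : k ≤ N) {μ : QC N → ℝ} (hμ : IsVal k μ) (hrot : IsRotationInvariant μ)
    (ht0 : ∀ n, 0 ≤ t n) (ht : Antitone t) (hK : Monotone K) {n : ℕ} (h : IsQC (stair t K n))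
    (h' : IsQC (stair t K (n + 1))) (hKn : IsBody (K n)) (hKn' : IsBody (K (n + 1))) :
    μ ⟨_, h'⟩ = μ ⟨_, h⟩ + density hk μ (t (n + 1)) *
      (intrinsicVolume hk (K (n + 1)) - intrinsicVolume hk (K n)) := by
  classical
  have e1 : stair t K (n + 1) = fun x => max (stair t K n x) ((step (t (n + 1)) (K (n + 1))).1 x) := by
    ext x
    rw [coe_step _ hKn', max_eq_left (ht0 _)]
    rfl
  have hq : IsQC fun x => max (stair t K n x) ((step (t (n + 1)) (K (n + 1))).1 x) := e1 ▸ h'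
  have e2 : QC.inf ⟨_, h⟩ (step (t (n + 1)) (K (n + 1))) = step (t (n + 1)) (K n) := by
    refine Subtype.ext (funext fun x => ?_)
    change min (stair t K n x) ((step (t (n + 1)) (K (n + 1))).1 x) = _
    rw [step_apply _ hKn, step_apply _ hKn', max_eq_left (ht0 _)]
    by_cases hx : x ∈ K n
    · rw [if_pos hx, if_pos (hK n.le_succ hx)]
      exact min_eq_right ((ht n.le_succ).trans (le_stair le_rfl hx))
    · rw [if_neg hx, stair_of_notMem ht0 hK hx]
      refine min_eq_left ?_
      split_ifs
      exacts [ht0 _, le_rfl]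
  have e3 : (⟨_, h'⟩ : QC N) = ⟨_, hq⟩ := Subtype.ext e1
  have := hμ.valuation.2 ⟨_, h⟩ (step (t (n + 1)) (K (n + 1))) hq
  rw [e2, ← e3, hμ.step_eq hk hrot _ hKn, hμ.step_eq hk hrot _ hKn'] at this
  linarith

end Stair

/-- Otherwise φ(t_n) ≠ 0 for some t_n strictly decreasing to 0. Cubes whose intrinsic volume grows
by 1/|φ(t_n)| at stage n give staircases that increase to a function of the class while μ jumps by
±1 each time, against continuity. -/
theorem density_eventually_zero (hk : k ≤ N) (hk1 : 1 ≤ k) {μ : QC N → ℝ} (hμ : IsVal k μ)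
    (hrot : IsRotationInvariant μ) : ∃ δ : ℝ, 0 < δ ∧ ∀ t ∈ Icc 0 δ, density hk μ t = 0 := by
  set φ := density hk μ
  by_contra! hcon
  set A : Set ℝ := {t | 0 < t ∧ φ t ≠ 0} with hA
  have hA' : ∀ ε > 0, ∃ t ∈ A, t ≤ ε := by
    intro ε hε
    obtain ⟨t, ht, hne⟩ := hcon ε hε
    refine ⟨t, ⟨ht.1.lt_of_ne fun h => hne ?_, hne⟩, ht.2⟩
    exact density_of_nonpos hk hμ h.ge
  have hglb : IsGLB A 0 := by
    refine ⟨fun t ht => ht.1.le, fun b hb => ?_⟩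
    by_contra! hb0
    obtain ⟨t, ht, hle⟩ := hA' (b / 2) (by linarith)
    have := hb ht
    linarith
  obtain ⟨t, htanti, ht0, htlim, htA⟩ := hglb.exists_seq_strictAnti_tendsto_of_notMem
    (fun h => lt_irrefl _ h.1) (let ⟨t, ht, _⟩ := hA' 1 one_pos; ⟨t, ht⟩)
  set C : Set (E N) := cube (stdFrame hk)
  set c : ℝ := intrinsicVolume hk C
  have hc : 0 < c := intrinsicVolume_cube_stdFrame_pos hk
  have hC : IsBody C := isBody_cube _
  have h0C : (0 : E N) ∈ C := ⟨0, fun i => by simp, by simp⟩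
  set a : ℕ → ℝ := fun n => ∑ j ∈ Finset.range (n + 1), 1 / (|φ (t j)| * c) with ha
  have hterm : ∀ j, 0 < 1 / (|φ (t j)| * c) := fun j => by
    have := abs_pos.2 (htA j).2
    positivity
  have ha0 : ∀ n, 0 < a n := fun n => Finset.sum_pos (fun j _ => hterm j) (by simp)
  have hamono : Monotone a := monotone_nat_of_le_succ fun n => by
    simp only [ha]
    rw [Finset.sum_range_succ _ (n + 1)]
    linarith [hterm (n + 1)]
  -- Here `k ≥ 1` enters: dilating a cube realizes any prescribed positive V_k.
  set l : ℕ → ℝ := fun n => a n ^ ((k : ℝ)⁻¹)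
  have hlk : ∀ n, l n ^ k = a n := fun n => Real.rpow_inv_natCast_pow (ha0 n).le (by omega)
  have hl0 : ∀ n, 0 ≤ l n := fun n => Real.rpow_nonneg (ha0 n).le _
  have hlmono : Monotone l := fun m n hmn => Real.rpow_le_rpow (ha0 m).le (hamono hmn) (by positivity)
  set K : ℕ → Set (E N) := fun n => l n • C
  have hKb : ∀ n, IsBody (K n) := fun n => hC.smul _
  have hK : Monotone K := fun m n hmn => hC.smul_subset_smul h0C (hl0 m) (hlmono hmn)
  have hV : ∀ n, intrinsicVolume hk (K n) = a n * c := fun n => by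
    rw [intrinsicVolume_smul hk (hl0 n), hlk]
  have ht0' : ∀ n, 0 ≤ t n := fun n => (ht0 n).le
  have hq : ∀ n, IsQC (stair t K n) := fun n =>
    isQC_stair ht0' hK fun j _ => hKb j
  -- All later steps have height at most `t (n + 1)`, so above this level the supremum has the level
  -- sets of a finite staircase and belongs to the class.
  have hbdd : ∀ x n j, stair t K j x ≤ max (stair t K n x) (t (n + 1)) := by
    intro x n j
    refine stair_le ((stair_nonneg ht0' n x).trans (le_max_left _ _)) fun i _ hx => ?_
    rcases le_or_gt i n with h | h
    · exact (le_stair h hx).trans (le_max_left _ _)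
    · exact (htanti.antitone h).trans (le_max_right _ _)
  have hBdd : ∀ x, BddAbove (range fun n => stair t K n x) := fun x =>
    ⟨_, forall_mem_range.2 fun j => hbdd x 0 j⟩
  have hf : IsQC fun x => ⨆ n, stair t K n x := by
    refine ⟨fun x => (stair_nonneg ht0' 0 x).trans (le_ciSup (hBdd x) 0), fun s hs => ?_⟩
    obtain ⟨n, hn⟩ := ((htlim.comp (tendsto_add_atTop_nat 1)).eventually_lt_const hs).exists
    have e : levelSet (fun x => ⨆ n, stair t K n x) s = levelSet (stair t K n) s := by
      ext x
      refine ⟨fun hx => ?_, fun hx => le_trans hx (le_ciSup (hBdd x) n)⟩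
      have h1 : s ≤ max (stair t K n x) (t (n + 1)) := le_trans hx (ciSup_le fun j => hbdd x n j)
      exact (le_max_iff.1 h1).resolve_right (not_le.2 hn)
    rw [e]
    exact (hq n).2 s hs
  have hlim := hμ.continuous (fun n => ⟨_, hq n⟩) ⟨_, hf⟩
    (fun x => tendsto_atTop_ciSup (monotone_stair x) (hBdd x)) (Or.inl fun x => monotone_stair x)
  have hdiff : ∀ n, |μ ⟨_, hq (n + 1)⟩ - μ ⟨_, hq n⟩| = 1 := by
    intro n
    rw [hμ.stair_succ hk hrot ht0' htanti.antitone hK (hq n) (hq (n + 1)) (hKb n) (hKb (n + 1)),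
      hV, hV, add_sub_cancel_left, ← sub_mul]
    simp only [ha]
    rw [Finset.sum_range_succ _ (n + 1), add_sub_cancel_left, abs_mul, abs_mul,
      abs_of_pos (hterm _), abs_of_pos hc]
    have := abs_pos.2 (htA (n + 1)).2
    change |φ (t (n + 1))| * _ = 1
    field_simp
  have hzero := ((hlim.comp (tendsto_add_atTop_nat 1)).sub hlim).abs
  rw [sub_self, abs_zero] at hzero
  have hone : Tendsto (fun _ : ℕ => (1 : ℝ)) atTop (𝓝 0) := hzero.congr hdiff
  exact one_ne_zero (tendsto_nhds_unique tendsto_const_nhds hone)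

end QuasiConcaveVal

/-! ### Dyadic approximation, the integral formula, and uniqueness of the Klain function -/

namespace QuasiConcaveVal

open BodyValuation

variable {N k : ℕ} (hk : k ≤ N)

/-- Homogeneity of degree 0 with factor 0 collapses a non-empty body to the origin. Thus V_0 is
bounded, and S_0 is a finite measure. -/
theorem intrinsicVolume_zero_le (h0 : 0 ≤ N) {K : Set (E N)} (hK : IsBody K) :
    intrinsicVolume h0 K ≤ intrinsicVolume h0 ({0} : Set (E N)) := by
  rcases K.eq_empty_or_nonempty with rfl | hne
  · rw [(isBodyVal_intrinsicVolume h0).empty]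
    exact intrinsicVolume_nonneg h0 _
  · have h := intrinsicVolume_smul h0 le_rfl K
    rw [pow_zero, one_mul, zero_smul_set hne] at h
    exact h.ge

theorem levelMeasure_Ioi_lt_top (h0 : 0 ≤ N) (f : QC N) : levelMeasure h0 f (Ioi 0) < ⊤ := by
  have hU : ⋃ n : ℕ, Ici (1 / ((n : ℝ) + 1)) = Ioi (0 : ℝ) := by
    ext x
    rw [mem_iUnion]
    constructor
    · rintro ⟨n, hn⟩
      have h0 : (0 : ℝ) < 1 / ((n : ℝ) + 1) := by positivity
      exact mem_Ioi.2 (h0.trans_le hn)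
    · intro hx
      obtain ⟨n, hn⟩ := exists_nat_one_div_lt (mem_Ioi.1 hx)
      exact ⟨n, hn.le⟩
  have hmono : Monotone fun n : ℕ => Ici (1 / ((n : ℝ) + 1)) := fun m n hmn =>
    Ici_subset_Ici.2 (one_div_le_one_div_of_le (by positivity) (by gcongr))
  have hlim := tendsto_measure_iUnion_atTop (μ := levelMeasure h0 f) hmono
  rw [hU] at hlim
  refine (le_of_tendsto' hlim fun n => ?_).trans_lt
    (ENNReal.ofReal_lt_top (r := intrinsicVolume h0 ({0} : Set (E N))))
  have hn : (0 : ℝ) < 1 / ((n : ℝ) + 1) := by positivity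
  change levelMeasure h0 f (Ici _) ≤ _
  rw [levelMeasure_Ici h0 f hn]
  exact ENNReal.ofReal_le_ofReal (intrinsicVolume_zero_le h0 (isBody_levelSet f hn))

/-- A set of finite measure that carries `φ`, also after decreasing its argument. -/
theorem exists_carrier {μ : QC N → ℝ} (hμ : IsVal k μ) (hrot : IsRotationInvariant μ) (f : QC N) :
    ∃ U : Set ℝ, MeasurableSet U ∧ levelMeasure hk f U < ⊤ ∧
      ∀ s t, s ≤ t → 0 < t → t ∉ U → density hk μ s = 0 := by
  rcases Nat.eq_zero_or_pos k with rfl | hk1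
  · exact ⟨Ioi 0, measurableSet_Ioi, levelMeasure_Ioi_lt_top hk f,
      fun s t _ ht h => absurd ht h⟩
  · obtain ⟨δ, hδ, h⟩ := density_eventually_zero hk hk1 hμ hrot
    refine ⟨Ici δ, measurableSet_Ici, ?_, fun s t hst _ ht => ?_⟩
    · rw [levelMeasure_Ici hk f hδ]
      exact ENNReal.ofReal_lt_top
    · rcases le_total s 0 with h0 | h0
      · exact density_of_nonpos hk hμ h0
      · exact h s ⟨h0, hst.trans (not_le.1 ht).le⟩

/-- The bound covers all `s ≤ t` because φ will be evaluated at `t` rounded down. It is a constant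
on a set of finite measure: φ is bounded on `[0, T]`, and no mass lies above the level `T` where the
level sets become empty. -/
theorem exists_dominating {μ : QC N → ℝ} (hμ : IsVal k μ) (hrot : IsRotationInvariant μ)
    (f : QC N) : ∃ g : ℝ → ℝ, IntegrableOn g (Ioi 0) (levelMeasure hk f) ∧
      ∀ᵐ t ∂(levelMeasure hk f).restrict (Ioi 0), ∀ s ≤ t, ‖density hk μ s‖ ≤ g t := by
  obtain ⟨U, hU, hfin, hzero⟩ := exists_carrier hk hμ hrot f
  obtain ⟨T, hT0, hT⟩ := exists_levelSet_eq_empty f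
  obtain ⟨B, hB⟩ := (isCompact_Icc (a := (0 : ℝ)) (b := T)).exists_bound_of_continuousOn
    (continuous_density hk hμ).continuousOn
  have hB0 : 0 ≤ B := (norm_nonneg _).trans (hB 0 ⟨le_rfl, hT0.le⟩)
  refine ⟨U.indicator fun _ => B, ?_, ?_⟩
  · refine Integrable.mono_measure ?_ Measure.restrict_le_self
    rw [integrable_indicator_iff hU]
    exact integrableOn_const hfin.ne
  · have hae : ∀ᵐ t ∂levelMeasure hk f, t < T := by
      rw [ae_iff]
      simp only [not_lt]
      change levelMeasure hk f (Ici T) = 0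
      rw [levelMeasure_Ici hk f hT0, levelVol_eq_zero hk f (hT T le_rfl), ENNReal.ofReal_zero]
    filter_upwards [ae_restrict_mem measurableSet_Ioi, ae_restrict_of_ae hae] with t ht htT s hst
    by_cases h : t ∈ U
    · rw [indicator_of_mem h]
      rcases le_total s 0 with h0 | h0
      · rw [density_of_nonpos hk hμ h0, norm_zero]
        exact hB0
      · exact hB s ⟨h0, hst.trans htT.le⟩
    · rw [indicator_of_notMem h, hzero s t hst ht h, norm_zero]

/-- The largest multiple of `2^{-m}` that is at most `t`. -/
noncomputable def dyadicFloor (m : ℕ) (t : ℝ) : ℝ := (⌊2 ^ m * t⌋₊ : ℝ) / 2 ^ m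

theorem dyadicFloor_le (m : ℕ) {t : ℝ} (ht : 0 ≤ t) : dyadicFloor m t ≤ t := by
  rw [dyadicFloor, div_le_iff₀ (by positivity), mul_comm]
  exact Nat.floor_le (by positivity)

theorem dyadicFloor_nonneg (m : ℕ) (t : ℝ) : 0 ≤ dyadicFloor m t := by
  unfold dyadicFloor
  positivity

theorem measurable_dyadicFloor (m : ℕ) : Measurable (dyadicFloor m) :=
  ((measurable_from_nat (f := fun n : ℕ => (n : ℝ))).comp
    (Nat.measurable_floor.comp (measurable_const_mul _))).div_const _

theorem monotone_dyadicFloor (t : ℝ) : Monotone fun m => dyadicFloor m t := by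
  refine monotone_nat_of_le_succ fun m => ?_
  rcases le_total t 0 with ht | ht
  · have : dyadicFloor m t = 0 := by
      rw [dyadicFloor, Nat.floor_of_nonpos (mul_nonpos_of_nonneg_of_nonpos (by positivity) ht)]
      simp
    rw [this]
    exact dyadicFloor_nonneg _ _
  · have h1 : ((2 * ⌊2 ^ m * t⌋₊ : ℕ) : ℝ) ≤ ⌊2 ^ (m + 1) * t⌋₊ := by
      refine Nat.cast_le.2 (Nat.le_floor ?_)
      have := Nat.floor_le (a := 2 ^ m * t) (by positivity)
      push_cast
      rw [pow_succ]
      linarith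
    push_cast at h1
    unfold dyadicFloor
    rw [div_le_div_iff₀ (by positivity) (by positivity)]
    have h2 : (0 : ℝ) < 2 ^ m := by positivity
    calc (⌊2 ^ m * t⌋₊ : ℝ) * 2 ^ (m + 1) = 2 * ⌊2 ^ m * t⌋₊ * 2 ^ m := by ring
      _ ≤ ⌊2 ^ (m + 1) * t⌋₊ * 2 ^ m := mul_le_mul_of_nonneg_right h1 h2.le

theorem tendsto_dyadicFloor {t : ℝ} (ht : 0 ≤ t) :
    Tendsto (fun m => dyadicFloor m t) atTop (𝓝 t) := by
  have h1 : Tendsto (fun m : ℕ => t - (1 / 2 : ℝ) ^ m) atTop (𝓝 (t - 0)) :=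
    tendsto_const_nhds.sub (tendsto_pow_atTop_nhds_zero_of_lt_one (by norm_num) (by norm_num))
  rw [sub_zero] at h1
  refine tendsto_of_tendsto_of_tendsto_of_le_of_le h1 tendsto_const_nhds (fun m => ?_)
    fun m => dyadicFloor_le m ht
  have h2 : (0 : ℝ) < 2 ^ m := by positivity
  change t - (1 / 2 : ℝ) ^ m ≤ dyadicFloor m t
  rw [dyadicFloor, le_div_iff₀ h2, sub_mul, ← mul_pow]
  have := Nat.lt_floor_add_one (2 ^ m * t)
  norm_num
  linarith

theorem dyadicFloor_eq {m i : ℕ} {t : ℝ} (h1 : (i : ℝ) / 2 ^ m ≤ t)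
    (h2 : t < ((i + 1 : ℕ) : ℝ) / 2 ^ m) : dyadicFloor m t = (i : ℝ) / 2 ^ m := by
  have h : (0 : ℝ) < 2 ^ m := by positivity
  rw [div_le_iff₀ h] at h1
  rw [lt_div_iff₀ h] at h2
  rw [dyadicFloor, (Nat.floor_eq_iff (by nlinarith [(Nat.cast_nonneg i : (0 : ℝ) ≤ i)])).2]
  push_cast at h2
  exact ⟨by linarith, by linarith⟩

theorem integrableOn_density_dyadicFloor {μ : QC N → ℝ} (hμ : IsVal k μ)
    (hrot : IsRotationInvariant μ) (f : QC N) (m : ℕ) :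
    IntegrableOn (fun t => density hk μ (dyadicFloor m t)) (Ioi 0) (levelMeasure hk f) := by
  obtain ⟨g, hg, hle⟩ := exists_dominating hk hμ hrot f
  refine hg.mono' ((continuous_density hk hμ).measurable.comp
    (measurable_dyadicFloor m)).aestronglyMeasurable ?_
  filter_upwards [hle, ae_restrict_mem measurableSet_Ioi] with t ht h0
  exact ht _ (dyadicFloor_le m (mem_Ioi.1 h0).le)

/-- The rounded function is a staircase whose bodies are level sets of `f`. By `IsVal.stair_succ`,
each step contributes φ at its height times the mass of a dyadic interval. -/
theorem exists_dyadic_approx {μ : QC N → ℝ} (hμ : IsVal k μ) (hrot : IsRotationInvariant μ)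
    (f : QC N) (m : ℕ) : ∃ h : IsQC fun x => dyadicFloor m (f x),
      μ ⟨_, h⟩ = ∫ t in Ioi (0 : ℝ), density hk μ (dyadicFloor m t) ∂(levelMeasure hk f) := by
  set S := levelMeasure hk f
  set φ := density hk μ
  obtain ⟨T, hT0, hT⟩ := exists_levelSet_eq_empty f
  have h2 : (0 : ℝ) < 2 ^ m := by positivity
  obtain ⟨M, hM⟩ := exists_nat_ge (2 ^ m * T)
  -- The heights descend from `(M + 1) / 2 ^ m ≥ T`, where the level set is empty, to `1 / 2 ^ m` at
  -- index `M`. The truncated subtraction gives height 0 beyond, where level sets need not be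
  -- bodies; hence the restriction to indices `n ≤ M`.
  set t : ℕ → ℝ := fun n => ((M + 1 - n : ℕ) : ℝ) / 2 ^ m with ht
  set K : ℕ → Set (E N) := fun n => levelSet f (t n)
  have ht0 : ∀ n, 0 ≤ t n := fun n => by positivity
  have htpos : ∀ n ≤ M, 0 < t n := fun n hn => by
    have : (0 : ℝ) < ((M + 1 - n : ℕ) : ℝ) := by exact_mod_cast (by omega)
    positivity
  have hta : Antitone t := fun i j hij => by
    simp only [ht]
    gcongr
  have hK : Monotone K := fun i j hij => levelSet_anti f (hta hij)
  have hKb : ∀ n ≤ M, IsBody (K n) := fun n hn => isBody_levelSet f (htpos n hn)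
  have hq : ∀ n ≤ M, IsQC (stair t K n) := fun n hn =>
    isQC_stair ht0 hK fun j hj => hKb j (hj.trans hn)
  have htT : T ≤ t 0 := by
    simp only [ht]
    rw [le_div_iff₀ h2]
    push_cast
    linarith
  have hK0 : K 0 = ∅ := hT _ htT
  have hfT : ∀ x, f x < T := fun x => by
    by_contra! h
    have : x ∈ levelSet f T := h
    rw [hT T le_rfl] at this
    exact this
  have hint := integrableOn_density_dyadicFloor hk hμ hrot f m
  have hSfin : ∀ s, 0 < s → S (Ici s) < ⊤ := fun s hs => by
    rw [levelMeasure_Ici hk f hs]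
    exact ENNReal.ofReal_lt_top
  have hS : ∀ n ≤ M, S.real (Ici (t n)) = intrinsicVolume hk (K n) := fun n hn => by
    rw [Measure.real, levelMeasure_Ici hk f (htpos n hn),
      ENNReal.toReal_ofReal (levelVol_nonneg hk f _)]
    rfl
  have key : ∀ n, ∀ hn : n ≤ M, μ ⟨_, hq n hn⟩ = ∫ s in Ici (t n), φ (dyadicFloor m s) ∂S := by
    intro n
    induction n with
    | zero =>
      intro hn
      have e : (⟨_, hq 0 hn⟩ : QC N) = QC.zero N := by
        refine Subtype.ext ?_
        change (K 0).indicator _ = _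
        rw [hK0, indicator_empty]
        rfl
      rw [e, hμ.valuation.1, Measure.restrict_eq_zero.2, integral_zero_measure]
      rw [levelMeasure_Ici hk f (htpos 0 hn), levelVol_eq_zero hk f hK0, ENNReal.ofReal_zero]
    | succ n ih =>
      intro hn
      have hn' : n ≤ M := by omega
      rw [hμ.stair_succ hk hrot ht0 hta hK (hq n hn') (hq _ hn) (hKb n hn') (hKb _ hn), ih hn']
      have e1 : Ici (t (n + 1)) = Ico (t (n + 1)) (t n) ∪ Ici (t n) :=
        (Ico_union_Ici_eq_Ici (hta n.le_succ)).symm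
      have hsub : Ici (t (n + 1)) ⊆ Ioi 0 := fun s hs => (htpos _ hn).trans_le hs
      have hd : Disjoint (Ico (t (n + 1)) (t n)) (Ici (t n)) := by
        rw [disjoint_left]
        intro s h1 h2
        exact absurd h1.2 (not_lt.2 h2)
      have e2 : ∫ s in Ico (t (n + 1)) (t n), φ (dyadicFloor m s) ∂S =
          φ (t (n + 1)) * (intrinsicVolume hk (K (n + 1)) - intrinsicVolume hk (K n)) := by
        have e3 : ∫ s in Ico (t (n + 1)) (t n), φ (dyadicFloor m s) ∂S =
            ∫ s in Ico (t (n + 1)) (t n), φ (t (n + 1)) ∂S := by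
          refine setIntegral_congr_fun measurableSet_Ico fun s hs => ?_
          rw [dyadicFloor_eq (i := M + 1 - (n + 1)) hs.1]
          refine hs.2.trans_eq ?_
          simp only [ht]
          congr 2
          omega
        rw [e3, setIntegral_const, smul_eq_mul, mul_comm, ← hS _ hn, ← hS _ hn']
        congr 1
        have hIco : Ico (t (n + 1)) (t n) = Ici (t (n + 1)) \ Ici (t n) := by
          ext s
          simp
        rw [hIco, measureReal_sdiff (Ici_subset_Ici.2 (hta n.le_succ)) measurableSet_Ici
          (hSfin _ (htpos _ hn)).ne]
      rw [e1, setIntegral_union hd measurableSet_Ici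
        (hint.mono_set ((subset_union_left.trans e1.ge).trans hsub))
        (hint.mono_set ((subset_union_right.trans e1.ge).trans hsub)), e2]
      ring
  have efun : stair t K M = fun x => dyadicFloor m (f x) := by
    ext x
    have hfx : 0 ≤ f x := f.2.1 x
    have hfloor := Nat.floor_le (a := 2 ^ m * f x) (by positivity)
    refine le_antisymm (stair_le (dyadicFloor_nonneg _ _) fun j hj hx => ?_) ?_
    · have hx' : ((M + 1 - j : ℕ) : ℝ) / 2 ^ m ≤ f x := hx
      rw [div_le_iff₀ h2, mul_comm] at hx'
      simp only [ht, dyadicFloor]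
      gcongr
      exact Nat.le_floor hx'
    · rcases Nat.eq_zero_or_pos ⌊2 ^ m * f x⌋₊ with h0 | hpos
      · rw [dyadicFloor, h0, Nat.cast_zero, zero_div]
        exact stair_nonneg ht0 _ _
      · have hle : ⌊2 ^ m * f x⌋₊ ≤ M := by
          refine Nat.floor_le_of_le (le_trans ?_ hM)
          exact mul_le_mul_of_nonneg_left (hfT x).le h2.le
        have e : t (M + 1 - ⌊2 ^ m * f x⌋₊) = dyadicFloor m (f x) := by
          simp only [ht, dyadicFloor]
          congr 2
          omega
        rw [← e]
        refine le_stair (by omega) ?_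
        change t _ ≤ f x
        rw [e]
        exact dyadicFloor_le m hfx
  have hqc : IsQC fun x => dyadicFloor m (f x) := efun ▸ hq M le_rfl
  refine ⟨hqc, ?_⟩
  have e4 : (⟨_, hqc⟩ : QC N) = ⟨_, hq M le_rfl⟩ := Subtype.ext efun.symm
  rw [e4, key M le_rfl]
  symm
  refine setIntegral_eq_of_subset_of_forall_sdiff_eq_zero measurableSet_Ioi
    (fun s hs => (htpos M le_rfl).trans_le hs) fun s hs => ?_
  -- Below the lowest positive height the rounding is 0, and φ(0) = 0.
  have hs2 : s < t M := not_le.1 hs.2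
  have : dyadicFloor m s = ((0 : ℕ) : ℝ) / 2 ^ m := by
    refine dyadicFloor_eq (by simpa using (mem_Ioi.1 hs.1).le) (hs2.trans_eq ?_)
    simp only [ht]
    congr 2
    omega
  rw [this, Nat.cast_zero, zero_div]
  exact density_of_nonpos hk hμ le_rfl

theorem IsVal.integral_density {μ : QC N → ℝ} (hμ : IsVal k μ) (hrot : IsRotationInvariant μ)
    (f : QC N) : IntegrableOn (density hk μ) (Ioi 0) (levelMeasure hk f) ∧
      μ f = ∫ t in Ioi (0 : ℝ), density hk μ t ∂(levelMeasure hk f) := by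
  obtain ⟨g, hg, hle⟩ := exists_dominating hk hμ hrot f
  have hcont := continuous_density hk hμ
  refine ⟨hg.mono' hcont.aestronglyMeasurable (hle.mono fun t ht => ht t le_rfl), ?_⟩
  choose hq heq using exists_dyadic_approx hk hμ hrot f
  have h1 := hμ.continuous (fun m => ⟨_, hq m⟩) f (fun x => tendsto_dyadicFloor (f.2.1 x))
    (Or.inl fun x => monotone_dyadicFloor (f x))
  simp only [heq] at h1
  refine tendsto_nhds_unique h1 (tendsto_integral_of_dominated_convergence g
    (fun m => (integrableOn_density_dyadicFloor hk hμ hrot f m).aestronglyMeasurable) hg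
    (fun m => ?_) ?_)
  · filter_upwards [hle, ae_restrict_mem measurableSet_Ioi] with t ht h0
    exact ht _ (dyadicFloor_le m (mem_Ioi.1 h0).le)
  · filter_upwards [ae_restrict_mem measurableSet_Ioi] with t h0
    exact (hcont.tendsto t).comp (tendsto_dyadicFloor (mem_Ioi.1 h0).le)

theorem levelMeasure_step {t : ℝ} (ht : 0 < t) {K : Set (E N)} (hK : IsBody K) :
    levelMeasure hk (step t K) = ENNReal.ofReal (intrinsicVolume hk K) • Measure.dirac t := by
  have h : ∀ s, 0 < s → (ENNReal.ofReal (intrinsicVolume hk K) • Measure.dirac t) (Ici s) =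
      ENNReal.ofReal (levelVol hk (step t K) s) := by
    intro s hs
    rw [Measure.smul_apply, Measure.dirac_apply' _ measurableSet_Ici, smul_eq_mul, levelVol,
      coe_step t hK, max_eq_left ht.le]
    by_cases hst : s ≤ t
    · have e : levelSet (K.indicator fun _ => t) s = K := by
        ext x
        by_cases hx : x ∈ K <;> simp [levelSet, hx, hst, hs]
      rw [e, indicator_of_mem (mem_Ici.2 hst), Pi.one_apply, mul_one]
    · have e : levelSet (K.indicator fun _ => t) s = ∅ := by
        ext x
        by_cases hx : x ∈ K <;> simp [levelSet, hx, hst, hs]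
      rw [e, indicator_of_notMem (mt mem_Ici.1 hst), mul_zero, (isBodyVal_intrinsicVolume hk).empty,
        ENNReal.ofReal_zero]
  have h0 : (ENNReal.ofReal (intrinsicVolume hk K) • Measure.dirac t) (Iic 0) = 0 := by
    rw [Measure.smul_apply, Measure.dirac_apply' _ measurableSet_Iic,
      indicator_of_notMem (mt mem_Iic.1 (not_le.2 ht)), smul_zero]
  have h1 := isLevelMeasure_of_Ici hk h0 h
  exact (Classical.epsilon_spec (p := IsLevelMeasure hk (step t K)) ⟨_, h1⟩).unique hk h1

/-- For a unit cube Q in `F`, the level measure of t·1_Q is V_k(Q) times the Dirac mass at `t`, so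
the defining formula evaluates the Klain function pointwise. -/
theorem klainFunction_unique {μ : QC N → ℝ} (hμ : IsVal k μ) (hrot : IsRotationInvariant μ)
    {Kl : ℝ → Gr N k → ℝ} (hKl : IsKlainFunction hk μ Kl) {t : ℝ} (ht : 0 < t) (F : Gr N k) :
    Kl t F = density hk μ t := by
  let b := stdOrthonormalBasis ℝ F.1
  let e : Fin (Module.finrank ℝ F.1) → E N := fun i => b i
  have he : Orthonormal ℝ e := b.orthonormal.comp_linearIsometry F.1.subtypeₗᵢ
  have hK : IsBody (cube e) := isBody_cube e
  have hpos : 0 < intrinsicVolume hk (cube e) :=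
    intrinsicVolume_cube_pos hk he ((Fintype.card_fin _).trans F.2)
  have hsub : tsupport (step t (cube e) : E N → ℝ) ⊆ (F.1 : Set (E N)) := by
    refine closure_minimal ?_ F.1.closed_of_finiteDimensional
    rw [coe_step t hK]
    refine support_indicator_subset.trans ?_
    rintro _ ⟨s, -, rfl⟩
    exact F.1.sum_mem fun i _ => F.1.smul_mem _ (b i).2
  obtain ⟨-, h⟩ := hKl F (step t (cube e)) hsub
  have hres : (Measure.dirac t).restrict (Ioi 0) = Measure.dirac t :=
    Measure.restrict_eq_self_of_ae_mem ((ae_dirac_iff measurableSet_Ioi).2 (mem_Ioi.2 ht))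
  rw [levelMeasure_step hk ht hK, hμ.step_eq hk hrot t hK, Measure.restrict_smul,
    hres, integral_smul_measure,
    integral_dirac, ENNReal.toReal_ofReal hpos.le, smul_eq_mul, mul_comm] at h
  exact (mul_left_cancel₀ hpos.ne' h).symm

end QuasiConcaveVal

theorem theoremt3 (N k : ℕ) (hN : 1 ≤ N) (hk : k ≤ N) (μ : QuasiConcaveVal.QC N → ℝ)
    (hμ : QuasiConcaveVal.IsVal k μ) (hrot : QuasiConcaveVal.IsRotationInvariant μ) :
    ∃ φ : ℝ → ℝ,
      ContinuousOn φ (Set.Ici 0) ∧ φ 0 = 0 ∧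
      (1 ≤ k → ∃ δ : ℝ, 0 < δ ∧ ∀ t ∈ Set.Icc 0 δ, φ t = 0) ∧
      QuasiConcaveVal.IsKlainFunction hk μ (fun t _ => φ t) ∧
      (∀ Kl : ℝ → QuasiConcaveVal.Gr N k → ℝ, QuasiConcaveVal.IsKlainFunction hk μ Kl →
        ∀ (t : ℝ), 0 < t → ∀ F : QuasiConcaveVal.Gr N k, Kl t F = φ t) ∧
      ∀ f : QuasiConcaveVal.QC N,
        MeasureTheory.IntegrableOn φ (Set.Ioi 0) (QuasiConcaveVal.levelMeasure hk f) ∧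
        μ f = ∫ t in Set.Ioi (0 : ℝ), φ t ∂(QuasiConcaveVal.levelMeasure hk f) :=
  ⟨QuasiConcaveVal.density hk μ, (QuasiConcaveVal.continuous_density hk hμ).continuousOn,
    QuasiConcaveVal.density_of_nonpos hk hμ le_rfl,
    fun hk1 => QuasiConcaveVal.density_eventually_zero hk hk1 hμ hrot,
    fun _ f _ => hμ.integral_density hk hrot f,
    fun _ hKl _ ht F => QuasiConcaveVal.klainFunction_unique hk hμ hrot hKl ht F,
    fun f => hμ.integral_density hk hrot f⟩
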